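/- Let $k>4$ be an even integer and $m\ge 1$ an integer. Write $e(x)=e^{2\pi i x}$. **Jacobi group.** For a commutative ring $R$ let $G_n^J(R)=Sp_n(R)\ltimes H_n(R)$, with elements $\gamma=g\,h$, $g=\left(\begin{smallmatrix}A&B\\C&D\end{smallmatrix}\right)\in Sp_n(R)$, $h=(\lambda,\mu,\kappa)$, $\lambda,\mu\in R^n$ (row vectors), $\kappa\in R$, where $(\lambda_1,\mu_1,\kappa_1)(\lambda_2,\mu_2,\kappa_2)=(\lambda_1+\lambda_2,\mu_1+\mu_2,\kappa_1+\kappa_2+\lambda_1\mu_2^t-\mu_1\lambda_2^t)$ and $g^{-1}(\lambda,\mu,\kappa)g=((\lambda,\mu)g,\kappa)$. Put $\Gamma_n=Sp_n(\mathbb Z)$, $\Gamma_n^J=G_n^J(\mathbb Z)$, $\Gamma=\Gamma_1$, $\Gamma^J=\Gamma_1^J$, and let $Z(\Gamma^J)$ be the center of $\Gamma^J$. **Slash operator.** $G_n^J(\mathbb R)$ acts on $\mathbb H_n^J=\mathbb H_n\times\mathbb C^n$ (with $\mathbb H_n$ the Siegel upper half-space) by $\gamma\circ(\mathcal T,Z)=\big((A\mathcal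 T+B)(C\mathcal T+D)^{-1},(Z+\lambda\mathcal T+\mu)(C\mathcal T+D)^{-1}\big)$. Put $$J_{k,m}(g,(\mathcal T,Z))=\det(C\mathcal T+D)^k\,e\big(m\,Z(C\mathcal T+D)^{-1}CZ^t\big),\qquad J_{k,m}(h,(\mathcal T,Z))=e\big(-m(\lambda\mathcal T\lambda^t+2\lambda Z^t+\kappa+\mu\lambda^t)\big),$$ $J_{k,m}(gh,(\mathcal T,Z))=J_{k,m}(g,h\circ(\mathcal T,Z))\,J_{k,m}(h,(\mathcal T,Z))$ and $(\Phi|\gamma)(\mathcal T,Z)=J_{k,m}(\gamma,(\mathcal T,Z))^{-1}\,\Phi(\gamma\circ(\mathcal T,Z))$. **Embeddings.** For $g_i=\left(\begin{smallmatrix}a_i&b_i\\c_i&d_i\end{smallmatrix}\right)\in Sp_1$ let $$g_1\times g_2=\left(\begin{smallmatrix}a_1&0&b_1&0\\0&a_2&0&b_2\\c_1&0&d_1&0\\0&c_2&0&d_2\end{smallmatrix}\right)\in Sp_2 .$$ For $\gamma=g\,(\lambda,\mu,\kappa)\in G_1^J(\mathbb R)$ let $\gamma^\uparrow=(g\times I_2)\,((\lambda,0),(\mu,0),\kappa)\in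 G_2^J(\mathbb R)$. **The series $E_{II}$.** Let $\Gamma_\infty\subset\Gamma_2$ be the subgroup with $C=0$, let $\Gamma_\infty^J\subset\Gamma_2^J$ be the subgroup of the $\gamma$ with $\lambda=0$ and $g\in\Gamma_\infty$, and for $d\ge1$ let $h_d=\left(\begin{smallmatrix}1&0&0&0\\0&0&0&-1\\0&0&1&-d\\d&1&0&0\end{smallmatrix}\right)\in\Gamma_2$. Let $E_{II}$ be the subseries of the Jacobi Eisenstein series $\sum_{\gamma\in\Gamma_\infty^J\backslash\Gamma_2^J}J_{k,m}^{-1}(\gamma,\cdot)$ consisting of the cosets of those $\gamma$ whose symplectic part lies in $\bigcup_{d\ge1}\Gamma_\infty h_d(\Gamma\times\Gamma)$. **The series $P^J_{k,m}$ and the operators $\mathbb X(d)^\uparrow$.** For $\mathcal T=\left(\begin{smallmatrix}\tau&u\\u&\zeta\end{smallmatrix}\right)$ and $Z=(z_1,z_2)$ put $$\psi_{k,m}(\mathcal T,Z)=(\tau+2u+\zeta)^k\,e\!\left(\frac{m(z_1+z_2)^2}{\tau+2u+\zeta}\right),\qquad P^J_{k,m}=\sum_{\gamma\in Z(\Gamma^J)\backslash\Gamma^J}\psi_{k,m}^{-1}\,\big|\,\gamma^\uparrow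 .$$ For $d\ge1$ put $\mathbb X(d)=\Gamma^J\left(\begin{smallmatrix}d&0\\0&d^{-1}\end{smallmatrix}\right)\Gamma^J\subset G_1^J(\mathbb R)$ and $\Phi\,|\,\mathbb X(d)^\uparrow=\sum_{\eta\in\Gamma^J\backslash\mathbb X(d)}\Phi\,|\,\eta^\uparrow$. **Proposition.** For any choice of coset representatives in the sums above: each $\Gamma^J\backslash\mathbb X(d)$ is finite, the series $E_{II}$ and $P^J_{k,m}$ converge absolutely at every point of $\mathbb H_2^J$, and for all $(\mathcal T,Z)\in\mathbb H_2^J$ $$E_{II}(\mathcal T,Z)=\sum_{d=1}^\infty\big(P^J_{k,m}\,|\,\mathbb X(d)^\uparrow\big)(\mathcal T,Z)\,d^{-k},$$ the sum over $d$ being absolutely convergent. -/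

import Mathlib

open Matrix

noncomputable section

/-- The Jacobi group `G_n^J(R) = Sp_n(R) ⋉ H_n(R)`. The element with fields `g, lam, mu, kappa` is
the product `g · (λ, μ, κ)` of a symplectic matrix and a Heisenberg element. -/
@[ext]
structure JacobiGroup (n : ℕ) (R : Type) [CommRing R] where
  g : symplecticGroup (Fin n) R
  lam : Fin n → R
  mu : Fin n → R
  kappa : R

namespace JacobiGroup

variable {n : ℕ} {R : Type} [CommRing R]

/-- The row vector `(λ, μ)` of length `2n`. -/
def row (x : JacobiGroup n R) : Fin n ⊕ Fin n → R := Sum.elim x.lam x.mu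

/-- The row vector `(λ, μ) g = (λ A + μ C, λ B + μ D)`. -/
def rowAct (x : JacobiGroup n R) (g : symplecticGroup (Fin n) R) : Fin n ⊕ Fin n → R :=
  x.row ᵥ* (g : Matrix (Fin n ⊕ Fin n) (Fin n ⊕ Fin n) R)

/-- `(g₁ h₁)(g₂ h₂) = (g₁ g₂) (g₂⁻¹ h₁ g₂ · h₂)`, where `g⁻¹ (λ, μ, κ) g = ((λ, μ) g, κ)` and
`(λ₁, μ₁, κ₁)(λ₂, μ₂, κ₂) = (λ₁ + λ₂, μ₁ + μ₂, κ₁ + κ₂ + λ₁ μ₂ᵗ - μ₁ λ₂ᵗ)`. -/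
instance : Mul (JacobiGroup n R) where
  mul x y :=
    { g := x.g * y.g
      lam := fun i => x.rowAct y.g (Sum.inl i) + y.lam i
      mu := fun i => x.rowAct y.g (Sum.inr i) + y.mu i
      kappa := x.kappa + y.kappa
        + (fun i => x.rowAct y.g (Sum.inl i)) ⬝ᵥ y.mu
        - (fun i => x.rowAct y.g (Sum.inr i)) ⬝ᵥ y.lam }

instance : One (JacobiGroup n R) where
  one := { g := 1, lam := 0, mu := 0, kappa := 0 }

instance : Inv (JacobiGroup n R) where
  inv x :=
    { g := x.g⁻¹
      lam := fun i => -x.rowAct x.g⁻¹ (Sum.inl i)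
      mu := fun i => -x.rowAct x.g⁻¹ (Sum.inr i)
      kappa := -x.kappa }

/-- The alternating form `λ₁ μ₂ᵗ - μ₁ λ₂ᵗ` on row vectors of length `2n`. -/
def form (v w : Fin n ⊕ Fin n → R) : R :=
  (fun i => v (Sum.inl i)) ⬝ᵥ (fun i => w (Sum.inr i))
    - (fun i => v (Sum.inr i)) ⬝ᵥ (fun i => w (Sum.inl i))

theorem form_eq (v w : Fin n ⊕ Fin n → R) : form v w = -(v ⬝ᵥ (Matrix.J (Fin n) R *ᵥ w)) := by
  simp only [form, Matrix.J, dotProduct, Fintype.sum_sum_type, fromBlocks_mulVec]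
  simp [neg_mulVec, Function.comp_def]
  ring

theorem form_vecMul (v w : Fin n ⊕ Fin n → R) (g : symplecticGroup (Fin n) R) :
    form (v ᵥ* (g : Matrix (Fin n ⊕ Fin n) (Fin n ⊕ Fin n) R))
      (w ᵥ* (g : Matrix (Fin n ⊕ Fin n) (Fin n ⊕ Fin n) R)) = form v w := by
  have hg := SymplecticGroup.mem_iff.1 g.2
  rw [form_eq, form_eq, ← Matrix.mulVec_transpose _ w, ← Matrix.dotProduct_mulVec,
    Matrix.mulVec_mulVec, Matrix.mulVec_mulVec, hg]

theorem form_add_left (v v' w : Fin n ⊕ Fin n → R) :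
    form (v + v') w = form v w + form v' w := by
  simp only [form, dotProduct, Pi.add_apply, add_mul, Finset.sum_add_distrib]; ring

theorem form_add_right (v w w' : Fin n ⊕ Fin n → R) :
    form v (w + w') = form v w + form v w' := by
  simp only [form, dotProduct, Pi.add_apply, mul_add, Finset.sum_add_distrib]; ring

theorem ext_row {x y : JacobiGroup n R} (hg : x.g = y.g) (hr : x.row = y.row)
    (hk : x.kappa = y.kappa) : x = y := by
  refine JacobiGroup.ext hg ?_ ?_ hk
  · funext i; exact congrFun hr (Sum.inl i)
  · funext i; exact congrFun hr (Sum.inr i)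

theorem mul_g (x y : JacobiGroup n R) : (x * y).g = x.g * y.g := rfl

theorem mul_row (x y : JacobiGroup n R) : (x * y).row = x.rowAct y.g + y.row := by
  funext i; cases i <;> rfl

theorem mul_kappa (x y : JacobiGroup n R) :
    (x * y).kappa = x.kappa + y.kappa + form (x.rowAct y.g) y.row := add_sub_assoc _ _ _

theorem inv_row (x : JacobiGroup n R) : (x⁻¹).row = -x.rowAct x.g⁻¹ := by
  funext i; cases i <;> rfl

instance : Group (JacobiGroup n R) :=
  Group.ofLeftAxioms
    (by
      intro x y z
      refine ext_row (mul_assoc _ _ _) ?_ ?_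
      · simp only [mul_row, mul_g, rowAct, Submonoid.coe_mul, Matrix.add_vecMul,
          Matrix.vecMul_vecMul, add_assoc]
      · simp only [mul_kappa, mul_row, mul_g, rowAct, Submonoid.coe_mul, Matrix.add_vecMul,
          form_add_left, form_add_right, ← Matrix.vecMul_vecMul, form_vecMul]
        ring)
    (by
      intro x
      have h0 : (1 : JacobiGroup n R).row = 0 := by
        funext i; cases i <;> rfl
      refine ext_row (one_mul _) ?_ ?_
      · simp [mul_row, rowAct, h0]
      · have h1 : (1 : JacobiGroup n R).kappa = 0 := rfl
        simp [mul_kappa, rowAct, h0, h1, form])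
    (by
      intro x
      have h0 : (1 : JacobiGroup n R).row = 0 := by
        funext i; cases i <;> rfl
      have hx : (x⁻¹).rowAct x.g = -x.row := by
        rw [rowAct, inv_row, rowAct, Matrix.neg_vecMul, Matrix.vecMul_vecMul,
          ← Submonoid.coe_mul, inv_mul_cancel]
        simp
      refine ext_row (inv_mul_cancel _) ?_ ?_
      · rw [mul_row, hx, h0, neg_add_cancel]
      · have h1 : (1 : JacobiGroup n R).kappa = 0 := rfl
        have h2 : (x⁻¹).kappa = -x.kappa := rfl
        rw [mul_kappa, hx, h1, h2]
        simp [form, dotProduct, mul_comm])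

end JacobiGroup

/-- Base change `Sp_n(R) → Sp_n(S)` along a ring homomorphism, entry by entry. -/
def symplecticMap {n : ℕ} {R S : Type} [CommRing R] [CommRing S] (f : R →+* S) :
    symplecticGroup (Fin n) R →* symplecticGroup (Fin n) S where
  toFun g := ⟨(g : Matrix (Fin n ⊕ Fin n) (Fin n ⊕ Fin n) R).map f, SymplecticGroup.map_mem g.2 f⟩
  map_one' := Subtype.ext (by simp [Matrix.map_one])
  map_mul' x y := Subtype.ext (by simp [Matrix.map_mul])

/-- Base change `G_n^J(R) → G_n^J(S)` along a ring homomorphism, entry by entry. -/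
def JacobiGroup.map {n : ℕ} {R S : Type} [CommRing R] [CommRing S] (f : R →+* S) :
    JacobiGroup n R →* JacobiGroup n S :=
  have key : ∀ (x : JacobiGroup n R) (g : symplecticGroup (Fin n) R) (i : Fin n ⊕ Fin n),
      (JacobiGroup.mk (symplecticMap f x.g) (fun i => f (x.lam i)) (fun i => f (x.mu i))
        (f x.kappa)).rowAct (symplecticMap f g) i = f (x.rowAct g i) := by
    intro x g i
    simp [JacobiGroup.rowAct, JacobiGroup.row, symplecticMap, Matrix.vecMul, dotProduct]
  { toFun := fun x =>
      { g := symplecticMap f x.g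
        lam := fun i => f (x.lam i)
        mu := fun i => f (x.mu i)
        kappa := f x.kappa }
    map_one' := by
      refine JacobiGroup.ext (map_one _) ?_ ?_ (map_zero f)
      · funext i; exact map_zero f
      · funext i; exact map_zero f
    map_mul' := by
      intro x y
      refine JacobiGroup.ext (map_mul _ _ _) ?_ ?_ ?_
      · funext i
        exact (map_add f _ _).trans (congrArg (· + f (y.lam i)) (key x y.g (Sum.inl i)).symm)
      · funext i
        exact (map_add f _ _).trans (congrArg (· + f (y.mu i)) (key x y.g (Sum.inr i)).symm)
      · change f (x.kappa + y.kappa + (fun i => x.rowAct y.g (Sum.inl i)) ⬝ᵥ y.mu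
            - (fun i => x.rowAct y.g (Sum.inr i)) ⬝ᵥ y.lam)
          = f x.kappa + f y.kappa + (fun i => _) ⬝ᵥ (fun i => f (y.mu i))
            - (fun i => _) ⬝ᵥ (fun i => f (y.lam i))
        simp only [key, dotProduct, map_add, map_sub, map_sum, map_mul] }

/-- The Siegel modular group `Γ_n = Sp_n(ℤ)`, as a subgroup of `Sp_n(ℝ)`. -/
def siegelModularGroup (n : ℕ) : Subgroup (symplecticGroup (Fin n) ℝ) :=
  (symplecticMap (Int.castRingHom ℝ)).range

/-- The Jacobi modular group `Γ_n^J = G_n^J(ℤ)`, as a subgroup of `G_n^J(ℝ)`. -/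
def jacobiModularGroup (n : ℕ) : Subgroup (JacobiGroup n ℝ) :=
  (JacobiGroup.map (Int.castRingHom ℝ)).range

/-- The center `Z(Γ^J)` of `Γ^J = Γ_1^J`, as a subgroup of `G_1^J(ℝ)`. -/
def centerJacobiModularGroup : Subgroup (JacobiGroup 1 ℝ) :=
  (Subgroup.center (jacobiModularGroup 1)).map (jacobiModularGroup 1).subtype

/-- The elements `(A B; C D)` of `Γ_n` with `C = 0`. -/
def siegelParabolic (n : ℕ) : Set (symplecticGroup (Fin n) ℝ) :=
  {g | g ∈ siegelModularGroup n ∧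
    (g : Matrix (Fin n ⊕ Fin n) (Fin n ⊕ Fin n) ℝ).toBlocks₂₁ = 0}

/-- `Γ_∞^J`: the elements of `Γ_n^J` with `λ = 0` and `C = 0`. -/
def jacobiParabolic (n : ℕ) : Set (JacobiGroup n ℝ) :=
  {γ | γ ∈ jacobiModularGroup n ∧ γ.lam = 0 ∧ γ.g ∈ siegelParabolic n}

/-- `R` is a set of representatives for the left cosets `H s`, `s ∈ S`, i.e. for `H \ S`
(used for a subgroup `H` and a set `S` with `H S = S`). -/
def IsCosetReps {G : Type} [Mul G] (H S R : Set G) : Prop :=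
  R ⊆ S ∧ ∀ s ∈ S, ∃! r, r ∈ R ∧ ∃ h ∈ H, s = h * r

/-! ### Action and automorphy factor -/

/-- Pairs `(𝒯, Z)` of a complex `n × n` matrix and a row vector of length `n`. -/
abbrev JacobiPoint (n : ℕ) : Type := Matrix (Fin n) (Fin n) ℂ × (Fin n → ℂ)

/-- `ℍ_n^J = ℍ_n × ℂⁿ`: `𝒯` is symmetric with positive definite imaginary part, `Z` arbitrary. -/
def jacobiHalfSpace (n : ℕ) : Set (JacobiPoint n) :=
  {x | x.1.IsSymm ∧ (x.1.map Complex.im).PosDef}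

/-- `e(x) = exp(2πix)`. -/
def expTwoPiI (x : ℂ) : ℂ := Complex.exp (2 * Real.pi * Complex.I * x)

namespace JacobiGroup

variable {n : ℕ}

/-- The blocks `A, B, C, D` of the symplectic part, as complex matrices. -/
def A (γ : JacobiGroup n ℝ) : Matrix (Fin n) (Fin n) ℂ :=
  (γ.g : Matrix (Fin n ⊕ Fin n) (Fin n ⊕ Fin n) ℝ).toBlocks₁₁.map Complex.ofReal
/-- A block of the symplectic part. -/
def B (γ : JacobiGroup n ℝ) : Matrix (Fin n) (Fin n) ℂ :=
  (γ.g : Matrix (Fin n ⊕ Fin n) (Fin n ⊕ Fin n) ℝ).toBlocks₁₂.map Complex.ofReal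
/-- A block of the symplectic part. -/
def C (γ : JacobiGroup n ℝ) : Matrix (Fin n) (Fin n) ℂ :=
  (γ.g : Matrix (Fin n ⊕ Fin n) (Fin n ⊕ Fin n) ℝ).toBlocks₂₁.map Complex.ofReal
/-- A block of the symplectic part. -/
def D (γ : JacobiGroup n ℝ) : Matrix (Fin n) (Fin n) ℂ :=
  (γ.g : Matrix (Fin n ⊕ Fin n) (Fin n ⊕ Fin n) ℝ).toBlocks₂₂.map Complex.ofReal

/-- `λ` as a complex row vector. -/
def lamC (γ : JacobiGroup n ℝ) : Fin n → ℂ := fun i => (γ.lam i : ℂ)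
/-- `μ` as a complex row vector. -/
def muC (γ : JacobiGroup n ℝ) : Fin n → ℂ := fun i => (γ.mu i : ℂ)

/-- The matrix `J(g, 𝒯) = C 𝒯 + D`. -/
def J (γ : JacobiGroup n ℝ) (T : Matrix (Fin n) (Fin n) ℂ) : Matrix (Fin n) (Fin n) ℂ :=
  γ.C * T + γ.D

/-- The row vector `Z + λ 𝒯 + μ`, second component of `(λ, μ, κ) ∘ (𝒯, Z) = (𝒯, Z + λ 𝒯 + μ)`. -/
def shift (γ : JacobiGroup n ℝ) (x : JacobiPoint n) : Fin n → ℂ :=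
  x.2 + γ.lamC ᵥ* x.1 + γ.muC

/-- `γ ∘ (𝒯, Z) = ((A𝒯 + B)(C𝒯 + D)⁻¹, (Z + λ𝒯 + μ)(C𝒯 + D)⁻¹)`. -/
def act (γ : JacobiGroup n ℝ) (x : JacobiPoint n) : JacobiPoint n :=
  ((γ.A * x.1 + γ.B) * (γ.J x.1)⁻¹, γ.shift x ᵥ* (γ.J x.1)⁻¹)

/-- The automorphy factor `J_{k,m}(γ, (𝒯, Z)) = J_{k,m}(g, h ∘ (𝒯, Z)) J_{k,m}(h, (𝒯, Z))` of
`γ = g h`, where `J_{k,m}(g, (𝒯, Z)) = det(C𝒯 + D)^k e(m Z (C𝒯 + D)⁻¹ C Zᵗ)` and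
`J_{k,m}(h, (𝒯, Z)) = e(-m (λ 𝒯 λᵗ + 2 λ Zᵗ + κ + μ λᵗ))` for `h = (λ, μ, κ)`. -/
def automorphyFactor (k m : ℕ) (γ : JacobiGroup n ℝ) (x : JacobiPoint n) : ℂ :=
  ((γ.J x.1).det ^ k *
      expTwoPiI (m * (γ.shift x ⬝ᵥ (((γ.J x.1)⁻¹ * γ.C) *ᵥ γ.shift x)))) *
    expTwoPiI (-m * (γ.lamC ⬝ᵥ (x.1 *ᵥ γ.lamC) + 2 * (γ.lamC ⬝ᵥ x.2) + γ.kappa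
      + γ.muC ⬝ᵥ γ.lamC))

/-- The slash operator `(Φ |_{k,m} γ)(𝒯, Z) = J_{k,m}(γ, (𝒯, Z))⁻¹ Φ(γ ∘ (𝒯, Z))`. -/
def slash (k m : ℕ) (Φ : JacobiPoint n → ℂ) (γ : JacobiGroup n ℝ) (x : JacobiPoint n) : ℂ :=
  (γ.automorphyFactor k m x)⁻¹ * Φ (γ.act x)

end JacobiGroup

/-! ### The embeddings of degree one into degree two -/

/-- The entries of an element of `Sp_1(R) = SL_2(R)` placed in a `4 × 4` matrix: the embedding
`(a₁ b₁; c₁ d₁) × (a₂ b₂; c₂ d₂) ↦ (a₁ 0 b₁ 0; 0 a₂ 0 b₂; c₁ 0 d₁ 0; 0 c₂ 0 d₂)`. -/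
def symplecticProd {R : Type} [CommRing R] (g₁ g₂ : symplecticGroup (Fin 1) R) :
    symplecticGroup (Fin 2) R :=
  let M₁ := (g₁ : Matrix (Fin 1 ⊕ Fin 1) (Fin 1 ⊕ Fin 1) R)
  let M₂ := (g₂ : Matrix (Fin 1 ⊕ Fin 1) (Fin 1 ⊕ Fin 1) R)
  ⟨fromBlocks
      !![M₁ (.inl 0) (.inl 0), 0; 0, M₂ (.inl 0) (.inl 0)]
      !![M₁ (.inl 0) (.inr 0), 0; 0, M₂ (.inl 0) (.inr 0)]
      !![M₁ (.inr 0) (.inl 0), 0; 0, M₂ (.inr 0) (.inl 0)]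
      !![M₁ (.inr 0) (.inr 0), 0; 0, M₂ (.inr 0) (.inr 0)], by
    have key : ∀ g : symplecticGroup (Fin 1) R,
        (g : Matrix (Fin 1 ⊕ Fin 1) (Fin 1 ⊕ Fin 1) R) (.inl 0) (.inl 0) * g.1 (.inr 0) (.inr 0)
          - g.1 (.inr 0) (.inl 0) * g.1 (.inl 0) (.inr 0) = 1 := by
      intro g
      have h := g.2
      rw [← fromBlocks_toBlocks g.1, SymplecticGroup.fromBlocks_mem_iff] at h
      have := congrFun (congrFun h.2.2 0) 0
      simpa [Matrix.mul_apply, toBlocks₁₁, toBlocks₁₂, toBlocks₂₁, toBlocks₂₂] using this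
    have k₁ := key g₁
    have k₂ := key g₂
    rw [SymplecticGroup.fromBlocks_mem_iff]
    refine ⟨?_, ?_, ?_⟩
    · ext i j; fin_cases i <;> fin_cases j <;> simp [Matrix.mul_apply, M₁, M₂, mul_comm]
    · ext i j; fin_cases i <;> fin_cases j <;> simp [Matrix.mul_apply, M₁, M₂, mul_comm]
    · ext i j
      fin_cases i <;> fin_cases j <;> simp [Matrix.mul_apply, M₁, M₂, k₁, k₂]⟩

/-- The embedding `γ ↦ γ^↑ = γ × I₂` of `G_1^J` into `G_2^J`. -/
def JacobiGroup.up {R : Type} [CommRing R] (γ : JacobiGroup 1 R) : JacobiGroup 2 R where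
  g := symplecticProd γ.g 1
  lam := ![γ.lam 0, 0]
  mu := ![γ.mu 0, 0]
  kappa := γ.kappa

/-! ### The Eisenstein series, the Poincaré series and the Hecke operators -/

/-- The representatives
`h_d = (1 0 0 0; 0 0 0 -1; 0 0 1 -d; d 1 0 0)` of the nontrivial double cosets. -/
def garrettRep (d : ℕ) : symplecticGroup (Fin 2) ℝ :=
  ⟨fromBlocks !![1, 0; 0, 0] !![0, 0; 0, -1] !![0, 0; (d : ℝ), 1] !![1, -(d : ℝ); 0, 0], by
    rw [SymplecticGroup.fromBlocks_mem_iff]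
    refine ⟨?_, ?_, ?_⟩ <;>
    · ext i j; fin_cases i <;> fin_cases j <;> simp [Matrix.mul_apply]⟩

/-- The elements of `Γ_2^J` whose symplectic part lies in `⋃_{d ≥ 1} Γ_∞ h_d (Γ × Γ)`. -/
def garrettCell : Set (JacobiGroup 2 ℝ) :=
  {γ | γ ∈ jacobiModularGroup 2 ∧ ∃ d : ℕ, 1 ≤ d ∧ ∃ p ∈ siegelParabolic 2,
    ∃ g₁ ∈ siegelModularGroup 1, ∃ g₂ ∈ siegelModularGroup 1,
      γ.g = p * garrettRep d * symplecticProd g₁ g₂}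

/-- The sum of `J_{k,m}(γ, (𝒯, Z))⁻¹` over a set `R` of elements of `Γ_2^J`. For `R` a set of
representatives of `Γ_∞^J \ Γ_2^J` this is the Jacobi Eisenstein series `E_{k,m}^{J,2}`; for `R` a
set of representatives of the cosets in `garrettCell` it is its subseries `E_II`. -/
def jacobiEisensteinSum (k m : ℕ) (R : Set (JacobiGroup 2 ℝ)) (x : JacobiPoint 2) : ℂ :=
  ∑' γ : R, ((γ : JacobiGroup 2 ℝ).automorphyFactor k m x)⁻¹

/-- `ψ_{k,m}(𝒯, Z) = (τ + 2u + ζ)^k e(m (z₁ + z₂)² / (τ + 2u + ζ))`, for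
`𝒯 = (τ u; u ζ)` and `Z = (z₁, z₂)`. -/
def psi (k m : ℕ) (x : JacobiPoint 2) : ℂ :=
  (x.1 0 0 + 2 * x.1 0 1 + x.1 1 1) ^ k *
    expTwoPiI (m * (x.2 0 + x.2 1) ^ 2 / (x.1 0 0 + 2 * x.1 0 1 + x.1 1 1))

/-- The Poincaré type series `P_{k,m}^J = ∑_γ ψ_{k,m}⁻¹ |_{k,m} γ^↑`, the sum being over a set `R`
of representatives of `Z(Γ^J) \ Γ^J`. -/
def jacobiPoincare (k m : ℕ) (R : Set (JacobiGroup 1 ℝ)) (x : JacobiPoint 2) : ℂ :=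
  ∑' γ : R, (γ : JacobiGroup 1 ℝ).up.slash k m (fun y => (psi k m y)⁻¹) x

/-- `diag(d, d⁻¹)` as an element of `Sp_1(ℝ) ⊂ G_1^J(ℝ)`, for `d ≥ 1`. -/
def diagElement (d : ℕ+) : JacobiGroup 1 ℝ where
  g := ⟨fromBlocks !![(d : ℝ)] 0 0 !![(d : ℝ)⁻¹], by
    have hd : (d : ℝ) ≠ 0 := by exact_mod_cast d.ne_zero
    rw [SymplecticGroup.fromBlocks_mem_iff]
    refine ⟨by simp, by simp, ?_⟩
    ext i j; fin_cases i; fin_cases j; simp [Matrix.mul_apply, hd]⟩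
  lam := 0
  mu := 0
  kappa := 0

/-- The double coset `𝕏(d) = Γ^J diag(d, d⁻¹) Γ^J`. -/
def heckeDoubleCoset (d : ℕ+) : Set (JacobiGroup 1 ℝ) :=
  DoubleCoset.doubleCoset (diagElement d) (jacobiModularGroup 1) (jacobiModularGroup 1)

/-- The operator `Φ ↦ Φ | 𝕏(d)^↑ = ∑_η Φ |_{k,m} η^↑`, the (finite) sum being over a set `R` of
representatives of `Γ^J \ 𝕏(d)`. -/
def heckeUp (k m : ℕ) (R : Set (JacobiGroup 1 ℝ)) (Φ : JacobiPoint 2 → ℂ) (x : JacobiPoint 2) :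
    ℂ :=
  ∑' η : R, (η : JacobiGroup 1 ℝ).up.slash k m Φ x

end

noncomputable section

/-! ### The cocycle property of the automorphy factor -/

/-! The argument rests on the cocycle relation for J_{k,m} and on one orbit computation. The bottom
rows of h_1 span a Lagrangian in ℝ² ⊕ ℝ², the graph of the anti-symplectic map (x, y) ↦ (x, -y).
Hence the stabilizer of this Lagrangian in Sp_1 × Sp_1 is a twisted diagonal: whatever acts in the
second variable can be moved to the first at the cost of a Siegel parabolic factor on the left
(`garrettElement_mul_down`), and nothing in the first variable alone stabilizes it except central
elements (`eq_central_of_mem_siegelJacobi`).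

Over ℝ one has h_d = diag(d⁻¹, 1, d, 1) · h_1 · (diag(d, d⁻¹) × I₂) (`garrettElement_eq`). Therefore
every γ in the cell has the form q h_1 ξ^↑ with ξ ∈ 𝕏(d) and q a real parabolic element with det D =
±d and κ integral. As k is even, q contributes exactly d^k to the automorphy factor. As J_{k,m}(h_1,
·) = ψ, the cocycle relation gives J_{k,m}(γ, ·)⁻¹ = d^{-k} ψ⁻¹ | ξ^↑ (`slash_psi_inv`). The element
ξ is determined up to the center, d is determined by ξ, and the products of representatives of
Z(Γ^J) \ Γ^J and Γ^J \ 𝕏(d) run once through the classes Z(Γ^J) \ 𝕏(d). So the cosets of the cell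
correspond to triples (d, η, γ) (`exists_equiv_cosetReps`), and regrouping by d and then by η is the
proposition.

The regrouping needs absolute convergence of the whole family (`summable_slash_psi_inv`). For ξ with
symplectic part (a b; c d'), put S = a² + b² + c² + d'². The determinant δ of C𝒯 + D for h_1 ξ^↑
satisfies |δ|² ≥ ε S, and the exponential factor is at most a constant times exp(-ε' (λ² + μ²) / S);
both follow from writing an imaginary part as a positive definite Hermitian form with matrix adj(Im
𝒯) (`hermitian_lower_bound`, `im_mul_conj_eq`). The classes of ξ inject into tuples of integers:
entries of dξ, the number d, one of finitely many residue classes for (λ, μ), and two integral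
parts. The bounds are dominated by a product of summable weights in these integers, which is
possible for k ≥ 6. -/

/-- A real symmetric positive definite matrix is positive definite on complex vectors. -/
theorem Matrix.PosDef.re_star_dotProduct_pos {n : ℕ} {Y : Matrix (Fin n) (Fin n) ℝ}
    (hY : Y.PosDef) {w : Fin n → ℂ} (hw : w ≠ 0) :
    0 < (star w ⬝ᵥ (Y.map Complex.ofReal *ᵥ w)).re := by
  have key : (star w ⬝ᵥ (Y.map Complex.ofReal *ᵥ w)).re
      = (fun i => (w i).re) ⬝ᵥ (Y *ᵥ fun i => (w i).re)
        + (fun i => (w i).im) ⬝ᵥ (Y *ᵥ fun i => (w i).im) := by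
    simp only [dotProduct, mulVec, Complex.re_sum, ← Finset.sum_add_distrib]
    refine Finset.sum_congr rfl fun i _ => ?_
    simp [Complex.mul_re, Complex.re_sum, Complex.im_sum]
  rw [key]
  have hnn : ∀ v : Fin n → ℝ, 0 ≤ v ⬝ᵥ (Y *ᵥ v) := fun v => by
    simpa using hY.posSemidef.dotProduct_mulVec_nonneg v
  have hpos : ∀ v : Fin n → ℝ, v ≠ 0 → 0 < v ⬝ᵥ (Y *ᵥ v) := fun v hv => by
    simpa using hY.dotProduct_mulVec_pos hv
  by_cases h : (fun i => (w i).re) = 0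
  · refine add_pos_of_nonneg_of_pos (hnn _) (hpos _ fun h' => hw ?_)
    funext i
    exact Complex.ext (congrFun h i) (congrFun h' i)
  · exact add_pos_of_pos_of_nonneg (hpos _ h) (hnn _)

namespace JacobiGroup

variable {n : ℕ}

section Blocks

variable (γ γ' : JacobiGroup n ℝ)

theorem blocks_mem : fromBlocks γ.A γ.B γ.C γ.D ∈ symplecticGroup (Fin n) ℂ := by
  have h := SymplecticGroup.map_mem γ.g.2 Complex.ofRealHom
  rw [← fromBlocks_toBlocks γ.g.1, fromBlocks_map] at h
  exact h

theorem blocks_mul : fromBlocks (γ * γ').A (γ * γ').B (γ * γ').C (γ * γ').D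
    = fromBlocks γ.A γ.B γ.C γ.D * fromBlocks γ'.A γ'.B γ'.C γ'.D := by
  have h : ∀ δ : JacobiGroup n ℝ, fromBlocks δ.A δ.B δ.C δ.D
      = Complex.ofRealHom.mapMatrix δ.g.1 := by
    intro δ
    conv_rhs => rw [← fromBlocks_toBlocks δ.g.1]
    simp only [RingHom.mapMatrix_apply, fromBlocks_map]
    rfl
  rw [h, h, h, ← map_mul]
  rfl

theorem mul_A : (γ * γ').A = γ.A * γ'.A + γ.B * γ'.C := by
  have := blocks_mul γ γ'
  rw [fromBlocks_multiply, fromBlocks_inj] at this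
  exact this.1

theorem mul_B : (γ * γ').B = γ.A * γ'.B + γ.B * γ'.D := by
  have := blocks_mul γ γ'
  rw [fromBlocks_multiply, fromBlocks_inj] at this
  exact this.2.1

theorem mul_C : (γ * γ').C = γ.C * γ'.A + γ.D * γ'.C := by
  have := blocks_mul γ γ'
  rw [fromBlocks_multiply, fromBlocks_inj] at this
  exact this.2.2.1

theorem mul_D : (γ * γ').D = γ.C * γ'.B + γ.D * γ'.D := by
  have := blocks_mul γ γ'
  rw [fromBlocks_multiply, fromBlocks_inj] at this
  exact this.2.2.2

theorem transpose_A_mul_C : γ.Aᵀ * γ.C = γ.Cᵀ * γ.A :=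
  (SymplecticGroup.fromBlocks_mem_iff.1 γ.blocks_mem).1

theorem transpose_B_mul_D : γ.Bᵀ * γ.D = γ.Dᵀ * γ.B :=
  (SymplecticGroup.fromBlocks_mem_iff.1 γ.blocks_mem).2.1

theorem transpose_A_mul_D : γ.Aᵀ * γ.D - γ.Cᵀ * γ.B = 1 :=
  (SymplecticGroup.fromBlocks_mem_iff.1 γ.blocks_mem).2.2

theorem A_mul_transpose_B : γ.A * γ.Bᵀ = γ.B * γ.Aᵀ := by
  have h := SymplecticGroup.transpose_mem γ.blocks_mem
  rw [fromBlocks_transpose] at h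
  simpa using (SymplecticGroup.fromBlocks_mem_iff.1 h).1

theorem C_mul_transpose_D : γ.C * γ.Dᵀ = γ.D * γ.Cᵀ := by
  have h := SymplecticGroup.transpose_mem γ.blocks_mem
  rw [fromBlocks_transpose] at h
  simpa using (SymplecticGroup.fromBlocks_mem_iff.1 h).2.1

theorem A_mul_transpose_D : γ.A * γ.Dᵀ - γ.B * γ.Cᵀ = 1 := by
  have h := SymplecticGroup.transpose_mem γ.blocks_mem
  rw [fromBlocks_transpose] at h
  simpa using (SymplecticGroup.fromBlocks_mem_iff.1 h).2.2

theorem rowC_mul : (Sum.elim (γ * γ').lamC (γ * γ').muC : Fin n ⊕ Fin n → ℂ)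
    = Sum.elim γ.lamC γ.muC ᵥ* fromBlocks γ'.A γ'.B γ'.C γ'.D + Sum.elim γ'.lamC γ'.muC := by
  have h : fromBlocks γ'.A γ'.B γ'.C γ'.D = γ'.g.1.map Complex.ofRealHom := by
    conv_rhs => rw [← fromBlocks_toBlocks γ'.g.1, fromBlocks_map]
    rfl
  have e : ∀ δ : JacobiGroup n ℝ, (Sum.elim δ.lamC δ.muC : Fin n ⊕ Fin n → ℂ)
      = Complex.ofRealHom ∘ δ.row := by
    intro δ
    funext i
    cases i <;> rfl
  rw [h, e, e, e, mul_row]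
  funext i
  rw [Pi.add_apply, ← RingHom.map_vecMul, ← rowAct]
  simp

theorem mul_lamC : (γ * γ').lamC = γ.lamC ᵥ* γ'.A + γ.muC ᵥ* γ'.C + γ'.lamC := by
  funext i
  have := congrFun (rowC_mul γ γ') (Sum.inl i)
  rw [vecMul_fromBlocks] at this
  simpa using this

theorem mul_muC : (γ * γ').muC = γ.lamC ᵥ* γ'.B + γ.muC ᵥ* γ'.D + γ'.muC := by
  funext i
  have := congrFun (rowC_mul γ γ') (Sum.inr i)
  rw [vecMul_fromBlocks] at this
  simpa using this

theorem mul_kappaC : ((γ * γ').kappa : ℂ) = γ.kappa + γ'.kappa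
    + (γ.lamC ᵥ* γ'.A + γ.muC ᵥ* γ'.C) ⬝ᵥ γ'.muC
    - (γ.lamC ᵥ* γ'.B + γ.muC ᵥ* γ'.D) ⬝ᵥ γ'.lamC := by
  have h := mul_kappa γ γ'
  have h1 : (fun i => ((γ.rowAct γ'.g (Sum.inl i) : ℝ) : ℂ))
      = γ.lamC ᵥ* γ'.A + γ.muC ᵥ* γ'.C := by
    have := mul_lamC γ γ'
    rw [← add_left_inj γ'.lamC, ← this]
    funext i
    exact (Complex.ofReal_add _ _).symm
  have h2 : (fun i => ((γ.rowAct γ'.g (Sum.inr i) : ℝ) : ℂ))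
      = γ.lamC ᵥ* γ'.B + γ.muC ᵥ* γ'.D := by
    have := mul_muC γ γ'
    rw [← add_left_inj γ'.muC, ← this]
    funext i
    exact (Complex.ofReal_add _ _).symm
  rw [h, ← h1, ← h2]
  simp only [form, dotProduct, lamC, muC, row]
  push_cast
  ring_nf
  rfl

end Blocks

/-- If (C𝒯 + D)w = 0, evaluate (A𝒯 + B)ᴴ(C𝒯 + D) - (C𝒯 + D)ᴴ(A𝒯 + B) = 𝒯ᴴ - 𝒯 = -2i Im 𝒯 at w. The
left side vanishes, while Im 𝒯 is positive definite. -/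
theorem isUnit_det_J (γ : JacobiGroup n ℝ) {x : JacobiPoint n} (hx : x ∈ jacobiHalfSpace n) :
    IsUnit (γ.J x.1).det := by
  rw [isUnit_iff_ne_zero]
  intro h0
  obtain ⟨w, hw, hJw⟩ := Matrix.exists_mulVec_eq_zero_iff.2 h0
  obtain ⟨hs, hp⟩ := hx
  have hreal : ∀ M : Matrix (Fin n) (Fin n) ℝ, (M.map Complex.ofReal)ᴴ = (M.map Complex.ofReal)ᵀ := by
    intro M
    ext i j
    simp [conjTranspose_apply]
  have hA : γ.Aᴴ = γ.Aᵀ := hreal _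
  have hB : γ.Bᴴ = γ.Bᵀ := hreal _
  have hC : γ.Cᴴ = γ.Cᵀ := hreal _
  have hD : γ.Dᴴ = γ.Dᵀ := hreal _
  have h3 : γ.Dᵀ * γ.A - γ.Bᵀ * γ.C = 1 := by
    have := congrArg transpose γ.transpose_A_mul_D
    simpa using this
  have key : (γ.A * x.1 + γ.B)ᴴ * γ.J x.1 - (γ.J x.1)ᴴ * (γ.A * x.1 + γ.B) = x.1ᴴ - x.1 := by
    simp only [J, conjTranspose_add, conjTranspose_mul, hA, hB, hC, hD]
    calc _ = x.1ᴴ * (γ.Aᵀ * γ.C - γ.Cᵀ * γ.A) * x.1 + x.1ᴴ * (γ.Aᵀ * γ.D - γ.Cᵀ * γ.B)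
          - (γ.Dᵀ * γ.A - γ.Bᵀ * γ.C) * x.1 + (γ.Bᵀ * γ.D - γ.Dᵀ * γ.B) := by noncomm_ring
      _ = _ := by
        rw [γ.transpose_A_mul_C, γ.transpose_B_mul_D, γ.transpose_A_mul_D, h3]
        noncomm_ring
  have hT : x.1ᴴ - x.1 = (-2 * Complex.I) • (x.1.map Complex.im).map Complex.ofReal := by
    ext i j
    rw [Matrix.sub_apply, conjTranspose_apply, hs.apply i j, Matrix.smul_apply, map_apply, map_apply]
    apply Complex.ext <;> simp; ring
  have h1 : star w ⬝ᵥ ((x.1ᴴ - x.1) *ᵥ w) = 0 := by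
    rw [← key, sub_mulVec, ← mulVec_mulVec, ← mulVec_mulVec, hJw, mulVec_zero, zero_sub,
      dotProduct_neg, dotProduct_mulVec, ← star_mulVec, hJw]
    simp
  have h2 := hp.re_star_dotProduct_pos hw
  rw [hT, smul_mulVec, dotProduct_smul, smul_eq_mul, mul_eq_zero] at h1
  rcases h1 with h1 | h1
  · simp at h1
  · rw [h1] at h2
    simp at h2

/-- The second component of the numerator: `(A𝒯 + B)`. -/
theorem act_fst_mul_J (γ : JacobiGroup n ℝ) {x : JacobiPoint n} (h : IsUnit (γ.J x.1).det) :
    (γ.act x).1 * γ.J x.1 = γ.A * x.1 + γ.B := by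
  rw [act, nonsing_inv_mul_cancel_right _ _ h]

theorem J_mul (γ γ' : JacobiGroup n ℝ) {x : JacobiPoint n} (h : IsUnit (γ'.J x.1).det) :
    (γ * γ').J x.1 = γ.J (γ'.act x).1 * γ'.J x.1 := by
  rw [J, J, add_mul, mul_assoc, act_fst_mul_J _ h, mul_C, mul_D, J]
  noncomm_ring

theorem isSymm_act (γ : JacobiGroup n ℝ) {x : JacobiPoint n} (hs : x.1.IsSymm)
    (h : IsUnit (γ.J x.1).det) : (γ.act x).1.IsSymm := by
  have hs' : x.1ᵀ = x.1 := hs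
  have h3 : γ.Dᵀ * γ.A - γ.Bᵀ * γ.C = 1 := by
    have := congrArg transpose γ.transpose_A_mul_D
    simpa using this
  have key : (γ.J x.1)ᵀ * (γ.A * x.1 + γ.B) = (γ.A * x.1 + γ.B)ᵀ * γ.J x.1 := by
    simp only [J, transpose_add, transpose_mul, hs']
    rw [← sub_eq_zero]
    calc _ = x.1 * (γ.Cᵀ * γ.A - γ.Aᵀ * γ.C) * x.1 - x.1 * (γ.Aᵀ * γ.D - γ.Cᵀ * γ.B)
          + (γ.Dᵀ * γ.A - γ.Bᵀ * γ.C) * x.1 - (γ.Bᵀ * γ.D - γ.Dᵀ * γ.B) := by noncomm_ring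
      _ = _ := by
        rw [γ.transpose_A_mul_C, γ.transpose_B_mul_D, γ.transpose_A_mul_D, h3]
        noncomm_ring
  have ht : IsUnit ((γ.J x.1)ᵀ).det := by rwa [det_transpose]
  change ((γ.A * x.1 + γ.B) * (γ.J x.1)⁻¹)ᵀ = (γ.A * x.1 + γ.B) * (γ.J x.1)⁻¹
  rw [transpose_mul, transpose_nonsing_inv]
  calc _ = ((γ.J x.1)ᵀ)⁻¹ * ((γ.A * x.1 + γ.B)ᵀ * γ.J x.1) * (γ.J x.1)⁻¹ := by
        rw [← mul_assoc, mul_nonsing_inv_cancel_right _ _ h]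
    _ = _ := by
        rw [← key, nonsing_inv_mul_cancel_left _ _ ht]

theorem shift_mul (γ γ' : JacobiGroup n ℝ) {x : JacobiPoint n} (h : IsUnit (γ'.J x.1).det) :
    (γ * γ').shift x = γ.shift (γ'.act x) ᵥ* γ'.J x.1 := by
  have e : (γ'.act x).2 ᵥ* γ'.J x.1 = γ'.shift x := by
    rw [act, vecMul_vecMul, nonsing_inv_mul _ h, vecMul_one]
  rw [shift, shift, add_vecMul, add_vecMul, e, vecMul_vecMul, act_fst_mul_J _ h, mul_lamC,
    mul_muC, shift, J]
  simp only [add_vecMul, vecMul_add, vecMul_vecMul]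
  abel

/-- Only C'𝒯 + D' has to be invertible, since `Matrix.mul_inv_rev` is unconditional. Invariance of
the half-space under the action is therefore not needed. -/
theorem act_mul (γ γ' : JacobiGroup n ℝ) {x : JacobiPoint n} (hx : x ∈ jacobiHalfSpace n) :
    (γ * γ').act x = γ.act (γ'.act x) := by
  have h := γ'.isUnit_det_J hx
  have e : (γ * γ').A * x.1 + (γ * γ').B = (γ.A * (γ'.act x).1 + γ.B) * γ'.J x.1 := by
    rw [add_mul, mul_assoc, act_fst_mul_J _ h, mul_A, mul_B, J]
    noncomm_ring
  refine Prod.ext ?_ ?_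
  · change ((γ * γ').A * x.1 + (γ * γ').B) * ((γ * γ').J x.1)⁻¹
      = (γ.A * (γ'.act x).1 + γ.B) * (γ.J (γ'.act x).1)⁻¹
    rw [e, J_mul _ _ h, Matrix.mul_inv_rev, ← mul_assoc, mul_nonsing_inv_cancel_right _ _ h]
  · change (γ * γ').shift x ᵥ* ((γ * γ').J x.1)⁻¹
      = γ.shift (γ'.act x) ᵥ* (γ.J (γ'.act x).1)⁻¹
    rw [J_mul _ _ h, Matrix.mul_inv_rev, shift_mul _ _ h, vecMul_vecMul, ← mul_assoc, mul_nonsing_inv _ h,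
      one_mul]

/-- The quantity `Z (C𝒯 + D)⁻¹ C Zᵗ` at the shifted point, minus
`λ 𝒯 λᵗ + 2 λ Zᵗ + κ + μ λᵗ`. -/
def exponent (γ : JacobiGroup n ℝ) (x : JacobiPoint n) : ℂ :=
  γ.shift x ⬝ᵥ (((γ.J x.1)⁻¹ * γ.C) *ᵥ γ.shift x)
    - (γ.lamC ⬝ᵥ (x.1 *ᵥ γ.lamC) + 2 * (γ.lamC ⬝ᵥ x.2) + γ.kappa + γ.muC ⬝ᵥ γ.lamC)

theorem automorphyFactor_eq (k m : ℕ) (γ : JacobiGroup n ℝ) (x : JacobiPoint n) :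
    γ.automorphyFactor k m x = (γ.J x.1).det ^ k * expTwoPiI (m * γ.exponent x) := by
  rw [automorphyFactor, exponent, mul_assoc, expTwoPiI, expTwoPiI, expTwoPiI, ← Complex.exp_add]
  congr 2
  ring

end JacobiGroup

/-! ### Bilinear forms and the additivity of the exponent -/

/-- The bilinear form `a M bᵗ`. -/
def bilin {n : ℕ} (M : Matrix (Fin n) (Fin n) ℂ) (a b : Fin n → ℂ) : ℂ := a ⬝ᵥ (M *ᵥ b)

section bilin

variable {n : ℕ} (M N : Matrix (Fin n) (Fin n) ℂ) (a b c : Fin n → ℂ)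

theorem bilin_add_left : bilin M (a + b) c = bilin M a c + bilin M b c := add_dotProduct _ _ _

theorem bilin_add_right : bilin M a (b + c) = bilin M a b + bilin M a c := by
  rw [bilin, mulVec_add, dotProduct_add]; rfl

theorem bilin_add_mat : bilin (M + N) a b = bilin M a b + bilin N a b := by
  rw [bilin, add_mulVec, dotProduct_add]; rfl

theorem bilin_sub_mat : bilin (M - N) a b = bilin M a b - bilin N a b := by
  rw [bilin, sub_mulVec, dotProduct_sub]; rfl

theorem bilin_vecMul_left : bilin M (a ᵥ* N) b = bilin (N * M) a b := by
  rw [bilin, bilin, ← dotProduct_mulVec, mulVec_mulVec]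

theorem bilin_vecMul_right : bilin M a (b ᵥ* N) = bilin (M * Nᵀ) a b := by
  rw [bilin, bilin, ← mulVec_transpose, mulVec_mulVec]

theorem bilin_transpose : bilin Mᵀ a b = bilin M b a := by
  rw [bilin, bilin, mulVec_transpose, dotProduct_comm, ← dotProduct_mulVec]

theorem dotProduct_eq_bilin : a ⬝ᵥ b = bilin 1 a b := by rw [bilin, one_mulVec]

end bilin

namespace JacobiGroup

variable {n : ℕ}

theorem exponent_eq_bilin (γ : JacobiGroup n ℝ) (x : JacobiPoint n) :
    γ.exponent x = bilin ((γ.J x.1)⁻¹ * γ.C) (γ.shift x) (γ.shift x)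
      - (bilin x.1 γ.lamC γ.lamC + 2 * bilin 1 γ.lamC x.2 + γ.kappa
        + bilin 1 γ.muC γ.lamC) := by
  simp only [exponent, bilin, one_mulVec]

/-- This is the cocycle relation in additive form. By 𝒯'C' = A' - (J'⁻¹)ᵗ the quadratic form of the
product, at the common shift s, splits into that of `γ` plus the symmetric form C'J'ᵗ. Expanding s =
wJ'⁻¹ + λ𝒯' + μ in the latter gives the form of `γ'` at w and terms that match the changes in λ, μ
and κ. -/
theorem exponent_mul (γ γ' : JacobiGroup n ℝ) {x : JacobiPoint n} (hx : x ∈ jacobiHalfSpace n) :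
    (γ * γ').exponent x = γ.exponent (γ'.act x) + γ'.exponent x := by
  have hs : x.1ᵀ = x.1 := hx.1
  have h' := γ'.isUnit_det_J hx
  have h'' := (γ * γ').isUnit_det_J hx
  have hJ := J_mul γ γ' h'
  -- The point γ' ∘ x is not known to lie in the half-space; invertibility there comes from the
  -- determinant of the product.
  have h0 : IsUnit (γ.J (γ'.act x).1).det := by
    rw [hJ, det_mul, IsUnit.mul_iff] at h''
    exact h''.1
  have hT : (γ'.act x).1ᵀ = (γ'.act x).1 := γ'.isSymm_act hx.1 h'
  have hFT := act_fst_mul_J γ' h'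
  have hZ : (γ'.act x).2 = γ'.shift x ᵥ* (γ'.J x.1)⁻¹ := rfl
  have hshift := shift_mul γ γ' h'
  have hs1 : γ.shift (γ'.act x) = γ'.shift x ᵥ* (γ'.J x.1)⁻¹
      + γ.lamC ᵥ* (γ'.act x).1 + γ.muC := rfl
  have hw : γ'.shift x = x.2 + γ'.lamC ᵥ* x.1 + γ'.muC := rfl
  have hAD := γ'.A_mul_transpose_D
  have hAB := γ'.A_mul_transpose_B
  have hCD := γ'.C_mul_transpose_D
  have hJ'def : γ'.J x.1 = γ'.C * x.1 + γ'.D := rfl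
  set s := γ.shift (γ'.act x)
  set T' := (γ'.act x).1
  set J₀ := γ.J T'
  set J' := γ'.J x.1
  set w := γ'.shift x
  have hJP : J' * J'⁻¹ = 1 := mul_nonsing_inv _ h'
  have hPJ : J'⁻¹ * J' = 1 := nonsing_inv_mul _ h'
  have hJPt : J'⁻¹ᵀ * J'ᵀ = 1 := by rw [← transpose_mul, hJP, transpose_one]
  have hPJt : J'ᵀ * J'⁻¹ᵀ = 1 := by rw [← transpose_mul, hPJ, transpose_one]
  have hA1 : γ'.Aᵀ * γ'.C = γ'.Cᵀ * γ'.A := γ'.transpose_A_mul_C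
  have hD1 : γ'.Dᵀ * γ'.A - γ'.Bᵀ * γ'.C = 1 := by
    have := congrArg transpose γ'.transpose_A_mul_D
    simpa using this
  -- `𝒯' C' = A' - (J'⁻¹)ᵗ`
  have hTC : T' * γ'.C = γ'.A - J'⁻¹ᵀ := by
    have e : J'ᵀ * (γ'.A - T' * γ'.C) = 1 := by
      have e1 : J'ᵀ * T' = (γ'.A * x.1 + γ'.B)ᵀ := by
        rw [← hFT, transpose_mul, hT]
      rw [mul_sub, ← mul_assoc, e1, hJ'def]
      simp only [transpose_add, transpose_mul, hs]
      calc _ = x.1 * (γ'.Cᵀ * γ'.A - γ'.Aᵀ * γ'.C) + (γ'.Dᵀ * γ'.A - γ'.Bᵀ * γ'.C) := by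
            noncomm_ring
        _ = 1 := by rw [hA1, hD1, sub_self, mul_zero, zero_add]
    have e2 : γ'.A - T' * γ'.C = J'⁻¹ᵀ := by
      rw [← one_mul (γ'.A - T' * γ'.C), ← hJPt, mul_assoc, e, mul_one]
    rw [← e2]
    abel
  have hC'' : J₀⁻¹ * (γ * γ').C = J₀⁻¹ * γ.C * J'⁻¹ᵀ + γ'.C := by
    have e : (γ * γ').C = γ.C * J'⁻¹ᵀ + J₀ * γ'.C := by
      have e0 : J₀ = γ.C * T' + γ.D := rfl
      rw [e0, add_mul, mul_assoc, hTC, mul_C]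
      noncomm_ring
    rw [e, mul_add, ← mul_assoc, ← mul_assoc, nonsing_inv_mul _ h0, one_mul]
  have hsymm : ∀ u v, bilin (γ'.C * J'ᵀ) u v = bilin (γ'.C * J'ᵀ) v u := by
    intro u v
    rw [← bilin_transpose]
    congr 1
    rw [hJ'def]
    simp only [transpose_add, transpose_mul, transpose_transpose, hs, mul_add, hCD, mul_assoc]
  have main : bilin (((γ * γ').J x.1)⁻¹ * (γ * γ').C) ((γ * γ').shift x) ((γ * γ').shift x)
      = bilin (J₀⁻¹ * γ.C) s s + bilin (γ'.C * J'ᵀ) s s := by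
    rw [hshift, hJ, Matrix.mul_inv_rev, mul_assoc, hC'', bilin_vecMul_left, bilin_vecMul_right,
      ← mul_assoc, hJP, one_mul, add_mul, mul_assoc _ J'⁻¹ᵀ, hJPt, mul_one, bilin_add_mat]
  have t1 : bilin (γ'.C * J'ᵀ) (w ᵥ* J'⁻¹) (w ᵥ* J'⁻¹) = bilin (J'⁻¹ * γ'.C) w w := by
    rw [bilin_vecMul_left, bilin_vecMul_right, mul_assoc, mul_assoc, hPJt, mul_one]
  have t2 : bilin (γ'.C * J'ᵀ) (γ.lamC ᵥ* T') (w ᵥ* J'⁻¹)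
      = bilin γ'.A γ.lamC w - bilin 1 γ.lamC (w ᵥ* J'⁻¹) := by
    rw [bilin_vecMul_left, bilin_vecMul_right, bilin_vecMul_right, mul_assoc, mul_assoc, hPJt,
      mul_one, hTC, bilin_sub_mat, one_mul]
  have t3 : bilin (γ'.C * J'ᵀ) γ.muC (w ᵥ* J'⁻¹) = bilin γ'.C γ.muC w := by
    rw [bilin_vecMul_right, mul_assoc, hPJt, mul_one]
  have eTJ : J'ᵀ * T' = x.1 * γ'.Aᵀ + γ'.Bᵀ := by
    have := congrArg transpose hFT
    rw [transpose_mul, hT] at this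
    rw [this]
    simp only [transpose_add, transpose_mul, hs]
  have t4 : bilin (γ'.C * J'ᵀ) (γ.lamC ᵥ* T') (γ.lamC ᵥ* T')
      = bilin (γ'.A * x.1 * γ'.Aᵀ) γ.lamC γ.lamC + bilin (γ'.A * γ'.Bᵀ) γ.lamC γ.lamC
        - bilin T' γ.lamC γ.lamC := by
    rw [bilin_vecMul_left, bilin_vecMul_right, hT, mul_assoc, mul_assoc, eTJ, ← mul_assoc, hTC,
      sub_mul, ← eTJ, ← mul_assoc J'⁻¹ᵀ, hJPt, one_mul, eTJ, mul_add, ← mul_assoc, bilin_sub_mat,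
      bilin_add_mat]
  have t5 : bilin (γ'.C * J'ᵀ) γ.muC (γ.lamC ᵥ* T')
      = bilin (γ'.C * x.1 * γ'.Aᵀ) γ.muC γ.lamC + bilin (γ'.C * γ'.Bᵀ) γ.muC γ.lamC := by
    rw [bilin_vecMul_right, hT, mul_assoc, eTJ, mul_add, ← mul_assoc, bilin_add_mat]
  have t6 : bilin (γ'.C * J'ᵀ) γ.muC γ.muC
      = bilin (γ'.C * x.1 * γ'.Cᵀ) γ.muC γ.muC + bilin (γ'.C * γ'.Dᵀ) γ.muC γ.muC := by
    rw [hJ'def, transpose_add, transpose_mul, hs, mul_add, ← mul_assoc, bilin_add_mat]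
  have expand : bilin (γ'.C * J'ᵀ) s s = bilin (J'⁻¹ * γ'.C) w w
      + 2 * (bilin γ'.A γ.lamC w - bilin 1 γ.lamC (w ᵥ* J'⁻¹)) + 2 * bilin γ'.C γ.muC w
      + (bilin (γ'.A * x.1 * γ'.Aᵀ) γ.lamC γ.lamC + bilin (γ'.A * γ'.Bᵀ) γ.lamC γ.lamC
        - bilin T' γ.lamC γ.lamC)
      + 2 * (bilin (γ'.C * x.1 * γ'.Aᵀ) γ.muC γ.lamC + bilin (γ'.C * γ'.Bᵀ) γ.muC γ.lamC)
      + (bilin (γ'.C * x.1 * γ'.Cᵀ) γ.muC γ.muC + bilin (γ'.C * γ'.Dᵀ) γ.muC γ.muC) := by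
    rw [hs1]
    simp only [bilin_add_left, bilin_add_right]
    rw [hsymm (w ᵥ* J'⁻¹) (γ.lamC ᵥ* T'), hsymm (w ᵥ* J'⁻¹) γ.muC, hsymm (γ.lamC ᵥ* T') γ.muC,
      t1, t2, t3, t4, t5, t6]
    ring
  have hsw : ∀ (M : Matrix (Fin n) (Fin n) ℂ) (u v : Fin n → ℂ), bilin M u v = bilin Mᵀ v u :=
    fun M u v => (bilin_transpose M v u).symm
  rw [exponent_eq_bilin, exponent_eq_bilin, exponent_eq_bilin, main, expand, hZ, mul_lamC, mul_muC,
    mul_kappaC]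
  have q1 : bilin γ'.A γ.lamC w = bilin γ'.A γ.lamC x.2 + bilin (γ'.A * x.1) γ.lamC γ'.lamC
      + bilin γ'.A γ.lamC γ'.muC := by
    rw [hw, bilin_add_right, bilin_add_right, bilin_vecMul_right, hs]
  have q2 : bilin γ'.C γ.muC w = bilin γ'.C γ.muC x.2 + bilin (γ'.C * x.1) γ.muC γ'.lamC
      + bilin γ'.C γ.muC γ'.muC := by
    rw [hw, bilin_add_right, bilin_add_right, bilin_vecMul_right, hs]
  rw [q1, q2]
  simp only [dotProduct_eq_bilin, bilin_add_left, bilin_add_right, bilin_vecMul_left,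
    bilin_vecMul_right, one_mul, mul_one, ← mul_assoc]
  have r1 : bilin (γ'.A * x.1 * γ'.Cᵀ) γ.lamC γ.muC = bilin (γ'.C * x.1 * γ'.Aᵀ) γ.muC γ.lamC := by
    rw [hsw]; simp only [transpose_mul, transpose_transpose, hs, mul_assoc]
  have r2 : bilin (x.1 * γ'.Aᵀ) γ'.lamC γ.lamC = bilin (γ'.A * x.1) γ.lamC γ'.lamC := by
    rw [hsw]; simp only [transpose_mul, transpose_transpose, hs]
  have r3 : bilin (x.1 * γ'.Cᵀ) γ'.lamC γ.muC = bilin (γ'.C * x.1) γ.muC γ'.lamC := by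
    rw [hsw]; simp only [transpose_mul, transpose_transpose, hs]
  have r4 : bilin (γ'.C * γ'.Bᵀ) γ.muC γ.lamC = bilin (γ'.B * γ'.Cᵀ) γ.lamC γ.muC := by
    rw [hsw]; simp only [transpose_mul, transpose_transpose]
  -- The relation A'D'ᵗ - B'C'ᵗ = 1 enters here and supplies the summand μλᵗ.
  have r5 : bilin (γ'.D * γ'.Aᵀ) γ.muC γ.lamC = bilin (γ'.B * γ'.Cᵀ) γ.lamC γ.muC
      + bilin 1 γ.muC γ.lamC := by
    rw [hsw]
    simp only [transpose_mul, transpose_transpose]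
    rw [sub_eq_iff_eq_add'.1 hAD, bilin_add_mat, hsw 1, transpose_one]
  have r6 : bilin γ'.Aᵀ γ'.muC γ.lamC = bilin γ'.A γ.lamC γ'.muC := bilin_transpose _ _ _
  have r7 : bilin γ'.Cᵀ γ'.muC γ.muC = bilin γ'.C γ.muC γ'.muC := bilin_transpose _ _ _
  rw [r1, r2, r3, r4, r5, r6, r7, hAB, hCD]
  ring

theorem automorphyFactor_mul (k m : ℕ) (γ γ' : JacobiGroup n ℝ) {x : JacobiPoint n}
    (hx : x ∈ jacobiHalfSpace n) :
    (γ * γ').automorphyFactor k m x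
      = γ.automorphyFactor k m (γ'.act x) * γ'.automorphyFactor k m x := by
  rw [automorphyFactor_eq, automorphyFactor_eq, automorphyFactor_eq, exponent_mul _ _ hx,
    J_mul _ _ (γ'.isUnit_det_J hx), det_mul, mul_add, expTwoPiI, expTwoPiI, expTwoPiI, mul_add,
    Complex.exp_add, mul_pow]
  ring

theorem slash_mul (k m : ℕ) (Φ : JacobiPoint n → ℂ) (γ γ' : JacobiGroup n ℝ) {x : JacobiPoint n}
    (hx : x ∈ jacobiHalfSpace n) :
    (γ * γ').slash k m Φ x
      = (γ'.automorphyFactor k m x)⁻¹ * γ.slash k m Φ (γ'.act x) := by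
  rw [slash, slash, automorphyFactor_mul _ _ _ _ hx, act_mul _ _ hx, _root_.mul_inv_rev, mul_assoc]

end JacobiGroup

/-! ### Integrality -/

/-- The integers, as a subring of the reals. -/
abbrev realIntegers : Subring ℝ := (Int.castRingHom ℝ).range

theorem intCast_mem_realIntegers (z : ℤ) : (z : ℝ) ∈ realIntegers := ⟨z, rfl⟩

/-- An integral lift of the entries is again symplectic because ℤ → ℝ is injective, so integrality
can be tested entry by entry. -/
theorem mem_siegelModularGroup_iff {n : ℕ} {g : symplecticGroup (Fin n) ℝ} :
    g ∈ siegelModularGroup n ↔ ∀ i j, g.1 i j ∈ realIntegers := by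
  constructor
  · rintro ⟨g₀, rfl⟩ i j
    exact ⟨g₀.1 i j, rfl⟩
  · intro h
    choose f hf using h
    have hmap : (Matrix.of f).map (Int.castRingHom ℝ) = g.1 := by
      ext i j
      exact hf i j
    refine ⟨⟨Matrix.of f, ?_⟩, Subtype.ext hmap⟩
    rw [SymplecticGroup.mem_iff]
    have hg := SymplecticGroup.mem_iff.1 g.2
    have hinj : Function.Injective ((Int.castRingHom ℝ).mapMatrix :
        Matrix (Fin n ⊕ Fin n) (Fin n ⊕ Fin n) ℤ →+* _) :=
      Matrix.map_injective (RingHom.injective_int (Int.castRingHom ℝ))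
    apply hinj
    have hJ : (Int.castRingHom ℝ).mapMatrix (Matrix.J (Fin n) ℤ) = Matrix.J (Fin n) ℝ :=
      Matrix.map_J (Fin n) (Int.castRingHom ℝ)
    rw [map_mul, map_mul, hJ, RingHom.mapMatrix_apply, RingHom.mapMatrix_apply, transpose_map,
      hmap, hg]

theorem mem_jacobiModularGroup_iff {n : ℕ} {γ : JacobiGroup n ℝ} :
    γ ∈ jacobiModularGroup n ↔ γ.g ∈ siegelModularGroup n ∧ (∀ i, γ.lam i ∈ realIntegers) ∧
      (∀ i, γ.mu i ∈ realIntegers) ∧ γ.kappa ∈ realIntegers := by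
  constructor
  · rintro ⟨γ₀, rfl⟩
    exact ⟨⟨γ₀.g, rfl⟩, fun i => ⟨γ₀.lam i, rfl⟩, fun i => ⟨γ₀.mu i, rfl⟩, ⟨γ₀.kappa, rfl⟩⟩
  · rintro ⟨⟨g, hg⟩, h1, h2, ⟨z, hz⟩⟩
    choose l hl using h1
    choose m hm using h2
    exact ⟨⟨g, l, m, z⟩, JacobiGroup.ext hg (funext hl) (funext hm) hz⟩

namespace JacobiGroup

section General

variable {n : ℕ} {R : Type} [CommRing R]

theorem mul_lam_apply (x y : JacobiGroup n R) (i : Fin n) :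
    (x * y).lam i = ∑ j, x.lam j * y.g.1 (.inl j) (.inl i) + ∑ j, x.mu j * y.g.1 (.inr j) (.inl i)
      + y.lam i := by
  change x.rowAct y.g (.inl i) + y.lam i = _
  simp [rowAct, row, vecMul, dotProduct]

theorem mul_mu_apply (x y : JacobiGroup n R) (i : Fin n) :
    (x * y).mu i = ∑ j, x.lam j * y.g.1 (.inl j) (.inr i) + ∑ j, x.mu j * y.g.1 (.inr j) (.inr i)
      + y.mu i := by
  change x.rowAct y.g (.inr i) + y.mu i = _
  simp [rowAct, row, vecMul, dotProduct]

theorem mul_kappa_apply (x y : JacobiGroup n R) :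
    (x * y).kappa = x.kappa + y.kappa + ∑ i, ((x * y).lam i - y.lam i) * y.mu i
      - ∑ i, ((x * y).mu i - y.mu i) * y.lam i := by
  change x.kappa + y.kappa + (fun i => x.rowAct y.g (.inl i)) ⬝ᵥ y.mu
      - (fun i => x.rowAct y.g (.inr i)) ⬝ᵥ y.lam
    = x.kappa + y.kappa + ∑ i, ((x.rowAct y.g (.inl i) + y.lam i) - y.lam i) * y.mu i
      - ∑ i, ((x.rowAct y.g (.inr i) + y.mu i) - y.mu i) * y.lam i
  simp only [add_sub_cancel_right]
  rfl

end General

/-- The entry `a` of the symplectic part `(a b; c d)` of an element of `G_1^J`. -/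
abbrev ea {R : Type} [CommRing R] (γ : JacobiGroup 1 R) : R := γ.g.1 (.inl 0) (.inl 0)
/-- The entry `b` of the symplectic part. -/
abbrev eb {R : Type} [CommRing R] (γ : JacobiGroup 1 R) : R := γ.g.1 (.inl 0) (.inr 0)
/-- The entry `c` of the symplectic part. -/
abbrev ec {R : Type} [CommRing R] (γ : JacobiGroup 1 R) : R := γ.g.1 (.inr 0) (.inl 0)
/-- The entry `d` of the symplectic part. -/
abbrev ed {R : Type} [CommRing R] (γ : JacobiGroup 1 R) : R := γ.g.1 (.inr 0) (.inr 0)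

section One

variable {R : Type} [CommRing R]

/-- An element of `G_1^J` from its entries. -/
def mk₁ (a b c d l m κ : R) (h : a * d - c * b = 1) : JacobiGroup 1 R where
  g := ⟨fromBlocks !![a] !![b] !![c] !![d], by
    rw [SymplecticGroup.fromBlocks_mem_iff]
    refine ⟨?_, ?_, ?_⟩ <;> ext i j <;> fin_cases i <;> fin_cases j
    · simp [Matrix.mul_apply, mul_comm]
    · simp [Matrix.mul_apply, mul_comm]
    · simpa [Matrix.mul_apply] using h⟩
  lam := ![l]
  mu := ![m]
  kappa := κ

theorem det_eq (γ : JacobiGroup 1 R) : γ.ea * γ.ed - γ.ec * γ.eb = 1 := by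
  have h := γ.g.2
  rw [← fromBlocks_toBlocks γ.g.1, SymplecticGroup.fromBlocks_mem_iff] at h
  have := congrFun (congrFun h.2.2 0) 0
  simpa [Matrix.mul_apply, toBlocks₁₁, toBlocks₁₂, toBlocks₂₁, toBlocks₂₂] using this

theorem ext₁ {x y : JacobiGroup 1 R} (ha : x.ea = y.ea) (hb : x.eb = y.eb) (hc : x.ec = y.ec)
    (hd : x.ed = y.ed) (hl : x.lam 0 = y.lam 0) (hm : x.mu 0 = y.mu 0)
    (hk : x.kappa = y.kappa) : x = y := by
  refine JacobiGroup.ext (Subtype.ext ?_) ?_ ?_ hk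
  · ext i j
    rcases i with i | i <;> rcases j with j | j <;> fin_cases i <;> fin_cases j <;> assumption
  · funext i; fin_cases i; exact hl
  · funext i; fin_cases i; exact hm

variable (x y : JacobiGroup 1 R)

theorem mul_ea : (x * y).ea = x.ea * y.ea + x.eb * y.ec := by
  simp [ea, mul_g, Matrix.mul_apply]
theorem mul_eb : (x * y).eb = x.ea * y.eb + x.eb * y.ed := by
  simp [eb, mul_g, Matrix.mul_apply]
theorem mul_ec : (x * y).ec = x.ec * y.ea + x.ed * y.ec := by
  simp [ec, mul_g, Matrix.mul_apply]
theorem mul_ed : (x * y).ed = x.ec * y.eb + x.ed * y.ed := by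
  simp [ed, mul_g, Matrix.mul_apply]
theorem mul_lam₁ : (x * y).lam 0 = x.lam 0 * y.ea + x.mu 0 * y.ec + y.lam 0 := by
  simp [mul_lam_apply]
theorem mul_mu₁ : (x * y).mu 0 = x.lam 0 * y.eb + x.mu 0 * y.ed + y.mu 0 := by
  simp [mul_mu_apply]
theorem mul_kappa₁ : (x * y).kappa = x.kappa + y.kappa
    + (x.lam 0 * y.ea + x.mu 0 * y.ec) * y.mu 0 - (x.lam 0 * y.eb + x.mu 0 * y.ed) * y.lam 0 := by
  simp [mul_kappa_apply, mul_lam₁, mul_mu₁]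

end One

theorem mem_jacobiModularGroup_one_iff {γ : JacobiGroup 1 ℝ} : γ ∈ jacobiModularGroup 1 ↔
    (γ.ea ∈ realIntegers ∧ γ.eb ∈ realIntegers ∧ γ.ec ∈ realIntegers ∧ γ.ed ∈ realIntegers) ∧
      γ.lam 0 ∈ realIntegers ∧ γ.mu 0 ∈ realIntegers ∧ γ.kappa ∈ realIntegers := by
  rw [mem_jacobiModularGroup_iff, mem_siegelModularGroup_iff]
  constructor
  · rintro ⟨h1, h2, h3, h4⟩
    exact ⟨⟨h1 _ _, h1 _ _, h1 _ _, h1 _ _⟩, h2 0, h3 0, h4⟩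
  · rintro ⟨⟨ha, hb, hc, hd⟩, h2, h3, h4⟩
    refine ⟨?_, ?_, ?_, h4⟩
    · intro i j
      rcases i with i | i <;> rcases j with j | j <;> fin_cases i <;> fin_cases j <;> assumption
    · intro i; fin_cases i; exact h2
    · intro i; fin_cases i; exact h3

/-! ### The two embeddings of degree one into degree two -/

section Embeddings

variable {R : Type} [CommRing R]

theorem symplecticProd_mul (g₁ g₂ h₁ h₂ : symplecticGroup (Fin 1) R) :
    symplecticProd (g₁ * h₁) (g₂ * h₂) = symplecticProd g₁ g₂ * symplecticProd h₁ h₂ := by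
  refine Subtype.ext ?_
  ext i j
  rcases i with i | i <;> rcases j with j | j <;> fin_cases i <;> fin_cases j <;>
    simp [symplecticProd, Matrix.mul_apply, Fintype.sum_sum_type]

/-- The embedding `γ ↦ I₂ × γ` of `G_1^J` into `G_2^J` in the second variable. -/
def down (γ : JacobiGroup 1 R) : JacobiGroup 2 R where
  g := symplecticProd 1 γ.g
  lam := ![0, γ.lam 0]
  mu := ![0, γ.mu 0]
  kappa := γ.kappa

theorem up_mul (x y : JacobiGroup 1 R) : (x * y).up = x.up * y.up := by
  refine JacobiGroup.ext ?_ ?_ ?_ ?_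
  · change symplecticProd (x.g * y.g) 1 = symplecticProd x.g 1 * symplecticProd y.g 1
    rw [← symplecticProd_mul, one_mul]
  · funext i
    rw [mul_lam_apply]
    fin_cases i <;> simp [up, mul_lam₁, symplecticProd]
  · funext i
    rw [mul_mu_apply]
    fin_cases i <;> simp [up, mul_mu₁, symplecticProd]
  · simp [mul_kappa_apply, mul_mu_apply, mul_lam_apply, up, symplecticProd]

theorem up_mul_down (x y : JacobiGroup 1 R) : x.up * y.down = y.down * x.up := by
  refine JacobiGroup.ext ?_ ?_ ?_ ?_
  · change symplecticProd x.g 1 * symplecticProd 1 y.g = symplecticProd 1 y.g * symplecticProd x.g 1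
    rw [← symplecticProd_mul, ← symplecticProd_mul, one_mul, one_mul, mul_one, mul_one]
  · funext i
    rw [mul_lam_apply, mul_lam_apply]
    fin_cases i <;> simp [up, down, symplecticProd]
  · funext i
    rw [mul_mu_apply, mul_mu_apply]
    fin_cases i <;> simp [up, down, symplecticProd]
  · simp [mul_kappa_apply, mul_mu_apply, mul_lam_apply, up, down, symplecticProd]
    ring

theorem up_one : (1 : JacobiGroup 1 R).up = 1 := by
  have h := up_mul (1 : JacobiGroup 1 R) 1
  rw [one_mul] at h
  exact (mul_eq_left.1 h.symm)

theorem up_inv (x : JacobiGroup 1 R) : (x⁻¹).up = x.up⁻¹ :=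
  eq_inv_of_mul_eq_one_left (by rw [← up_mul, inv_mul_cancel, up_one])

end Embeddings

theorem symplecticProd_mem {g₁ g₂ : symplecticGroup (Fin 1) ℝ} (h₁ : g₁ ∈ siegelModularGroup 1)
    (h₂ : g₂ ∈ siegelModularGroup 1) : symplecticProd g₁ g₂ ∈ siegelModularGroup 2 := by
  rw [mem_siegelModularGroup_iff] at *
  intro i j
  rcases i with i | i <;> rcases j with j | j <;> fin_cases i <;> fin_cases j <;>
    simp [symplecticProd, h₁ _ _, h₂ _ _, -RingHom.mem_range, zero_mem]

theorem up_mem {γ : JacobiGroup 1 ℝ} (h : γ ∈ jacobiModularGroup 1) :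
    γ.up ∈ jacobiModularGroup 2 := by
  rw [mem_jacobiModularGroup_iff] at *
  refine ⟨symplecticProd_mem h.1 (one_mem _), ?_, ?_, h.2.2.2⟩
  · intro i; fin_cases i
    · exact h.2.1 0
    · exact zero_mem _
  · intro i; fin_cases i
    · exact h.2.2.1 0
    · exact zero_mem _

theorem down_mem {γ : JacobiGroup 1 ℝ} (h : γ ∈ jacobiModularGroup 1) :
    γ.down ∈ jacobiModularGroup 2 := by
  rw [mem_jacobiModularGroup_iff] at *
  refine ⟨symplecticProd_mem (one_mem _) h.1, ?_, ?_, h.2.2.2⟩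
  · intro i; fin_cases i
    · exact zero_mem _
    · exact h.2.1 0
  · intro i; fin_cases i
    · exact zero_mem _
    · exact h.2.2.1 0

end JacobiGroup

namespace JacobiGroup

/-! ### The real Siegel parabolic subgroup -/

theorem toBlocks₂₁_mul {n : ℕ} (g g' : symplecticGroup (Fin n) ℝ) :
    (g * g').1.toBlocks₂₁ = g.1.toBlocks₂₁ * g'.1.toBlocks₁₁ + g.1.toBlocks₂₂ * g'.1.toBlocks₂₁ := by
  ext i j
  simp [toBlocks₂₁, toBlocks₂₂, toBlocks₁₁, Matrix.mul_apply, Fintype.sum_sum_type]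

theorem toBlocks₂₂_mul {n : ℕ} (g g' : symplecticGroup (Fin n) ℝ) :
    (g * g').1.toBlocks₂₂ = g.1.toBlocks₂₁ * g'.1.toBlocks₁₂ + g.1.toBlocks₂₂ * g'.1.toBlocks₂₂ := by
  ext i j
  simp [toBlocks₂₁, toBlocks₂₂, toBlocks₁₂, Matrix.mul_apply, Fintype.sum_sum_type]

theorem toBlocks₂₁_inv {n : ℕ} (g : symplecticGroup (Fin n) ℝ) :
    (g⁻¹).1.toBlocks₂₁ = -g.1.toBlocks₂₁ᵀ := by
  have h : (g⁻¹).1 = (-Matrix.J (Fin n) ℝ) * g.1ᵀ * Matrix.J (Fin n) ℝ := SymplecticGroup.coe_inv g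
  rw [h]
  conv_lhs => rw [← fromBlocks_toBlocks g.1]
  simp [Matrix.J, fromBlocks_transpose, fromBlocks_multiply, fromBlocks_neg]

theorem toBlocks₂₁_one (n : ℕ) : (1 : symplecticGroup (Fin n) ℝ).1.toBlocks₂₁ = 0 := by
  change (1 : Matrix (Fin n ⊕ Fin n) (Fin n ⊕ Fin n) ℝ).toBlocks₂₁ = 0
  rw [← fromBlocks_one, toBlocks_fromBlocks₂₁]

/-- The elements of `G_n^J(ℝ)` with `λ = 0` and `C = 0`. -/
def siegelJacobi (n : ℕ) : Subgroup (JacobiGroup n ℝ) where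
  carrier := {q | q.lam = 0 ∧ q.g.1.toBlocks₂₁ = 0}
  one_mem' := ⟨rfl, toBlocks₂₁_one n⟩
  mul_mem' := by
    rintro x y ⟨hx, hx'⟩ ⟨hy, hy'⟩
    refine ⟨?_, ?_⟩
    · funext i
      have : ∀ j, y.g.1 (.inr j) (.inl i) = 0 := fun j => congrFun (congrFun hy' j) i
      simp [mul_lam_apply, hx, hy, this]
    · rw [mul_g, toBlocks₂₁_mul, hx', hy']
      simp
  inv_mem' := by
    rintro x ⟨hx, hx'⟩
    have h0 : (x⁻¹).g.1.toBlocks₂₁ = 0 := by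
      change (x.g⁻¹).1.toBlocks₂₁ = 0
      rw [toBlocks₂₁_inv, hx', transpose_zero, neg_zero]
    refine ⟨?_, h0⟩
    funext i
    have h2 : (x * x⁻¹).lam i = 0 := by
      rw [mul_inv_cancel]
      rfl
    have : ∀ j, (x⁻¹).g.1 (.inr j) (.inl i) = 0 := fun j => congrFun (congrFun h0 j) i
    rw [mul_lam_apply, hx] at h2
    simpa [this] using h2

/-- The determinant of the block `D`. -/
def detD {n : ℕ} (q : JacobiGroup n ℝ) : ℝ := q.g.1.toBlocks₂₂.det

theorem detD_mul {n : ℕ} {q : JacobiGroup n ℝ} (hq : q ∈ siegelJacobi n) (q' : JacobiGroup n ℝ) :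
    (q * q').detD = q.detD * q'.detD := by
  rw [detD, mul_g, toBlocks₂₂_mul, hq.2, zero_mul, zero_add, det_mul]
  rfl

theorem kappa_mul {n : ℕ} {q q' : JacobiGroup n ℝ} (hq : q ∈ siegelJacobi n)
    (hq' : q' ∈ siegelJacobi n) : (q * q').kappa = q.kappa + q'.kappa := by
  rw [mul_kappa_apply, (mul_mem hq hq').1, hq'.1]
  simp

/-- With C = 0 and λ = 0 every term involving 𝒯 or Z disappears, so the factor is constant even for
non-integral parabolic elements. -/
theorem automorphyFactor_of_mem_siegelJacobi (k m : ℕ) {n : ℕ} {q : JacobiGroup n ℝ}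
    (hq : q ∈ siegelJacobi n) (x : JacobiPoint n) :
    q.automorphyFactor k m x = (q.detD : ℂ) ^ k * expTwoPiI (-m * q.kappa) := by
  have hC : q.C = 0 := by
    rw [C, hq.2]
    ext i j
    simp
  have hl : q.lamC = 0 := by
    funext i
    rw [lamC, hq.1]
    simp
  have hdet : q.D.det = (q.detD : ℂ) := by
    rw [detD]
    exact (RingHom.map_det Complex.ofRealHom _).symm
  rw [automorphyFactor_eq, J, hC, zero_mul, zero_add, hdet, exponent, hC, hl]
  simp

theorem expTwoPiI_intCast (z : ℤ) : expTwoPiI z = 1 := by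
  rw [expTwoPiI, mul_comm, Complex.exp_int_mul_two_pi_mul_I]

/-- The elements of the real parabolic subgroup with `κ` integral and `det D = ± t`. -/
def IsParabolicOfNorm (t : ℝ) (q : JacobiGroup 2 ℝ) : Prop :=
  q ∈ siegelJacobi 2 ∧ q.detD ^ 2 = t ^ 2 ∧ q.kappa ∈ realIntegers

theorem IsParabolicOfNorm.mul {s t : ℝ} {q r : JacobiGroup 2 ℝ} (hq : IsParabolicOfNorm s q)
    (hr : IsParabolicOfNorm t r) : IsParabolicOfNorm (s * t) (q * r) := by
  refine ⟨mul_mem hq.1 hr.1, ?_, ?_⟩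
  · rw [detD_mul hq.1, mul_pow, mul_pow, hq.2.1, hr.2.1]
  · rw [kappa_mul hq.1 hr.1]
    exact add_mem hq.2.2 hr.2.2

/-- Evenness of k removes the sign of det D, and integrality of mκ makes the exponential trivial. -/
theorem IsParabolicOfNorm.automorphyFactor_mul {k : ℕ} (hk : Even k) (m : ℕ) {t : ℝ}
    {q : JacobiGroup 2 ℝ} (hq : IsParabolicOfNorm t q) (γ : JacobiGroup 2 ℝ) {x : JacobiPoint 2}
    (hx : x ∈ jacobiHalfSpace 2) :
    (q * γ).automorphyFactor k m x = (t : ℂ) ^ k * γ.automorphyFactor k m x := by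
  obtain ⟨h1, h2, z, hz⟩ := hq
  rw [JacobiGroup.automorphyFactor_mul _ _ _ _ hx, automorphyFactor_of_mem_siegelJacobi _ _ h1]
  have e1 : (q.detD : ℂ) ^ k = (t : ℂ) ^ k := by
    obtain ⟨j, rfl⟩ := hk
    rw [← two_mul, pow_mul, pow_mul]
    congr 1
    exact_mod_cast h2
  have e2 : expTwoPiI (-m * q.kappa) = 1 := by
    rw [← hz, ← expTwoPiI_intCast (-m * z)]
    simp
  rw [e1, e2, mul_one]

theorem mem_jacobiParabolic_iff {n : ℕ} {γ : JacobiGroup n ℝ} :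
    γ ∈ jacobiParabolic n ↔ γ ∈ jacobiModularGroup n ∧ γ ∈ siegelJacobi n :=
  ⟨fun h => ⟨h.1, h.2.1, h.2.2.2⟩,
    fun h => ⟨h.1, h.2.1, (mem_jacobiModularGroup_iff.1 h.1).1, h.2.2⟩⟩

/-! ### Elements with trivial Heisenberg part -/

/-- A symplectic matrix as an element of the Jacobi group. -/
def ofSymplectic {n : ℕ} {R : Type} [CommRing R] (g : symplecticGroup (Fin n) R) :
    JacobiGroup n R := ⟨g, 0, 0, 0⟩

theorem ofSymplectic_mul {n : ℕ} {R : Type} [CommRing R] (g : symplecticGroup (Fin n) R)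
    (γ : JacobiGroup n R) : ofSymplectic g * γ = ⟨g * γ.g, γ.lam, γ.mu, γ.kappa⟩ := by
  refine JacobiGroup.ext rfl ?_ ?_ ?_
  · funext i; simp [mul_lam_apply, ofSymplectic]
  · funext i; simp [mul_mu_apply, ofSymplectic]
  · simp [mul_kappa_apply, mul_mu_apply, mul_lam_apply, ofSymplectic]

theorem ofSymplectic_mem {n : ℕ} {g : symplecticGroup (Fin n) ℝ} (hg : g ∈ siegelModularGroup n) :
    ofSymplectic g ∈ jacobiModularGroup n :=
  mem_jacobiModularGroup_iff.2
    ⟨hg, fun _ => zero_mem realIntegers, fun _ => zero_mem realIntegers, zero_mem realIntegers⟩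

theorem up_mul_down_eq {R : Type} [CommRing R] (x y : JacobiGroup 1 R) :
    x.up * y.down = ⟨symplecticProd x.g y.g, ![x.lam 0, y.lam 0], ![x.mu 0, y.mu 0],
      x.kappa + y.kappa⟩ := by
  refine JacobiGroup.ext ?_ ?_ ?_ ?_
  · change symplecticProd x.g 1 * symplecticProd 1 y.g = _
    rw [← symplecticProd_mul, one_mul, mul_one]
  · funext i
    rw [mul_lam_apply]
    fin_cases i <;> simp [up, down, symplecticProd]
  · funext i
    rw [mul_mu_apply]
    fin_cases i <;> simp [up, down, symplecticProd]
  · simp [mul_kappa_apply, mul_mu_apply, mul_lam_apply, up, down, symplecticProd]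

/-- The representative `h_d` as an element of `G_2^J`. -/
def garrettElement (d : ℕ) : JacobiGroup 2 ℝ := ofSymplectic (garrettRep d)

theorem garrettRep_mem (d : ℕ) : garrettRep d ∈ siegelModularGroup 2 := by
  rw [mem_siegelModularGroup_iff]
  intro i j
  rcases i with i | i <;> rcases j with j | j <;> fin_cases i <;> fin_cases j <;>
    simp only [garrettRep, fromBlocks_apply₁₁, fromBlocks_apply₁₂, fromBlocks_apply₂₁,
      fromBlocks_apply₂₂] <;>
    simp [-RingHom.mem_range, zero_mem, one_mem, natCast_mem]

/-- `diag(d⁻¹, 1, d, 1)`. -/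
def scaleElement (d : ℕ+) : JacobiGroup 2 ℝ :=
  ofSymplectic ⟨fromBlocks !![(d : ℝ)⁻¹, 0; 0, 1] 0 0 !![(d : ℝ), 0; 0, 1], by
    have hd : (d : ℝ) ≠ 0 := by exact_mod_cast d.ne_zero
    rw [SymplecticGroup.fromBlocks_mem_iff]
    refine ⟨by simp, by simp, ?_⟩
    ext i j; fin_cases i <;> fin_cases j <;> simp [Matrix.mul_apply, hd]⟩

theorem isParabolicOfNorm_scaleElement (d : ℕ+) : IsParabolicOfNorm d (scaleElement d) := by
  refine ⟨⟨rfl, ?_⟩, ?_, zero_mem _⟩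
  · simp [scaleElement, ofSymplectic]
  · simp [scaleElement, ofSymplectic, detD]

/-- This is the origin of both 𝕏(d) and d^{-k}: the non-integral left factor is parabolic with det D
= d, and the right factor is diag(d, d⁻¹) in the first variable. -/
theorem garrettElement_eq (d : ℕ+) :
    garrettElement d = scaleElement d * (garrettElement 1 * (diagElement d).up) := by
  have hd : (d : ℝ) ≠ 0 := by exact_mod_cast d.ne_zero
  rw [garrettElement, garrettElement, scaleElement, ofSymplectic_mul, ofSymplectic_mul]
  refine JacobiGroup.ext (Subtype.ext ?_) ?_ ?_ rfl
  · simp only [ofSymplectic, up, diagElement, symplecticProd, garrettRep, Submonoid.coe_mul,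
      fromBlocks_multiply]
    congr 1 <;> ext i j <;> fin_cases i <;> fin_cases j <;> simp [hd]
  · funext i; fin_cases i <;> rfl
  · funext i; fin_cases i <;> rfl

/-! ### Exchanging the two variables -/

/-- The anti-automorphism of `G_1^J` that moves the second variable to the first. -/
def flip {R : Type} [CommRing R] (γ : JacobiGroup 1 R) : JacobiGroup 1 R :=
  mk₁ γ.ed γ.eb γ.ec γ.ea (γ.mu 0 * γ.ec - γ.lam 0 * γ.ed) (γ.mu 0 * γ.ea - γ.lam 0 * γ.eb)
    γ.kappa (by rw [mul_comm]; exact γ.det_eq)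

theorem flip_flip {R : Type} [CommRing R] (γ : JacobiGroup 1 R) : γ.flip.flip = γ := by
  have h := γ.det_eq
  refine ext₁ rfl rfl rfl rfl ?_ ?_ rfl
  · change (γ.mu 0 * γ.ea - γ.lam 0 * γ.eb) * γ.ec - (γ.mu 0 * γ.ec - γ.lam 0 * γ.ed) * γ.ea
      = γ.lam 0
    linear_combination (γ.lam 0) * h
  · change (γ.mu 0 * γ.ea - γ.lam 0 * γ.eb) * γ.ed - (γ.mu 0 * γ.ec - γ.lam 0 * γ.ed) * γ.eb
      = γ.mu 0
    linear_combination (γ.mu 0) * h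

theorem flip_mem {γ : JacobiGroup 1 ℝ} (h : γ ∈ jacobiModularGroup 1) :
    γ.flip ∈ jacobiModularGroup 1 := by
  rw [mem_jacobiModularGroup_one_iff] at *
  obtain ⟨⟨ha, hb, hc, hd⟩, hl, hm, hk⟩ := h
  exact ⟨⟨hd, hb, hc, ha⟩, sub_mem (mul_mem hm hc) (mul_mem hl hd),
    sub_mem (mul_mem hm ha) (mul_mem hl hb), hk⟩

/-- The parabolic element relating `h_1 (I₂ × γ)` and `h_1 (flip γ × I₂)`. -/
def flipElement (γ : JacobiGroup 1 ℝ) : JacobiGroup 2 ℝ where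
  g := ⟨fromBlocks !![γ.ea, γ.eb; γ.ec, γ.ed] !![-γ.eb, 0; 0, -γ.ec] 0
      !![γ.ed, -γ.ec; -γ.eb, γ.ea], by
    have h := γ.det_eq
    rw [SymplecticGroup.fromBlocks_mem_iff]
    refine ⟨by simp, ?_, ?_⟩
    · ext i j; fin_cases i <;> fin_cases j <;> simp [Matrix.mul_apply] <;> ring
    · ext i j; fin_cases i <;> fin_cases j <;> simp [Matrix.mul_apply] <;> linarith⟩
  lam := 0
  mu := ![-γ.mu 0, γ.lam 0]
  kappa := 0

theorem isParabolicOfNorm_flipElement (γ : JacobiGroup 1 ℝ) :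
    IsParabolicOfNorm 1 (flipElement γ) := by
  refine ⟨⟨rfl, ?_⟩, ?_, zero_mem _⟩
  · simp [flipElement]
  · have h := γ.det_eq
    have : (flipElement γ).detD = 1 := by
      simp [flipElement, detD, det_fin_two]
      linarith
    rw [this]

/-- The symplectic part of `flip` is ε γ⁻¹ ε with ε = diag(1, -1). Acting by γ in the second
variable and by ε γ⁻¹ ε in the first moves the graph of ε, spanned by the bottom rows of h_1, to the
same Lagrangian. The two products thus differ by a parabolic element on the left, which is given
explicitly. -/
theorem garrettElement_mul_down (γ : JacobiGroup 1 ℝ) :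
    garrettElement 1 * γ.down = flipElement γ * (garrettElement 1 * γ.flip.up) := by
  have h := γ.det_eq
  rw [garrettElement, ofSymplectic_mul, ofSymplectic_mul]
  have hg : (garrettRep 1 * γ.down.g) = (flipElement γ).g * (garrettRep 1 * γ.flip.up.g) := by
    refine Subtype.ext ?_
    simp only [down, up, symplecticProd, garrettRep, flipElement, flip, mk₁, Submonoid.coe_mul,
      fromBlocks_multiply]
    congr 1 <;> ext i j <;> fin_cases i <;> fin_cases j <;> simp <;> linarith
  have e : ∀ i j, (garrettRep 1 * γ.flip.up.g).1 i j
      = ((garrettRep 1).1 * γ.flip.up.g.1) i j := fun _ _ => rfl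
  have hl : (flipElement γ * ⟨garrettRep 1 * γ.flip.up.g, γ.flip.up.lam, γ.flip.up.mu,
      γ.flip.up.kappa⟩).lam = γ.down.lam := by
    funext i
    rw [mul_lam_apply]
    simp only [e]
    fin_cases i <;>
      simp [down, up, symplecticProd, garrettRep, flipElement, flip, mk₁, fromBlocks_multiply]
  have hm : (flipElement γ * ⟨garrettRep 1 * γ.flip.up.g, γ.flip.up.lam, γ.flip.up.mu,
      γ.flip.up.kappa⟩).mu = γ.down.mu := by
    funext i
    rw [mul_mu_apply]
    simp only [e]
    fin_cases i <;>
      simp [down, up, symplecticProd, garrettRep, flipElement, flip, mk₁, fromBlocks_multiply]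
  refine JacobiGroup.ext hg hl.symm hm.symm ?_
  rw [mul_kappa_apply, hl, hm]
  simp [down, up, flipElement, flip, mk₁]
  ring

end JacobiGroup

namespace JacobiGroup

/-! ### The Hecke double cosets -/

theorem mem_heckeDoubleCoset_iff {d : ℕ+} {ξ : JacobiGroup 1 ℝ} : ξ ∈ heckeDoubleCoset d ↔
    ∃ α ∈ jacobiModularGroup 1, ∃ β ∈ jacobiModularGroup 1, ξ = α * diagElement d * β :=
  DoubleCoset.mem_doubleCoset

theorem mul_mem_heckeDoubleCoset {d : ℕ+} {γ ξ : JacobiGroup 1 ℝ} (hγ : γ ∈ jacobiModularGroup 1)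
    (hξ : ξ ∈ heckeDoubleCoset d) : γ * ξ ∈ heckeDoubleCoset d := by
  obtain ⟨α, hα, β, hβ, rfl⟩ := mem_heckeDoubleCoset_iff.1 hξ
  exact mem_heckeDoubleCoset_iff.2 ⟨γ * α, mul_mem hγ hα, β, hβ, by simp only [mul_assoc]⟩

/-- Factor h_d through h_1, move the second variable past h_1 with `garrettElement_mul_down`, and
collect the parabolic factors on the left. What remains in the first variable is flip γ₂ · diag(d,
d⁻¹) · γ₁. -/
theorem exists_eq_mul_of_mem_garrettCell {γ : JacobiGroup 2 ℝ} (hγ : γ ∈ garrettCell) :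
    ∃ d : ℕ+, ∃ ξ ∈ heckeDoubleCoset d, ∃ q : JacobiGroup 2 ℝ, IsParabolicOfNorm d q ∧
      γ = q * (garrettElement 1 * ξ.up) := by
  obtain ⟨hγ, d, hd, p, hp, g₁, h₁, g₂, h₂, hg⟩ := hγ
  obtain ⟨-, hl, hm, hk⟩ := mem_jacobiModularGroup_iff.1 hγ
  lift d to ℕ+ using hd
  -- The Heisenberg part is split by coordinates; κ is central and is assigned entirely to γ₁.
  set γ₁ : JacobiGroup 1 ℝ := ⟨g₁, ![γ.lam 0], ![γ.mu 0], γ.kappa⟩ with hγ₁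
  set γ₂ : JacobiGroup 1 ℝ := ⟨g₂, ![γ.lam 1], ![γ.mu 1], 0⟩ with hγ₂
  have m₁ : γ₁ ∈ jacobiModularGroup 1 := by
    rw [mem_jacobiModularGroup_iff]
    refine ⟨h₁, ?_, ?_, hk⟩ <;> intro i <;> fin_cases i
    exacts [hl 0, hm 0]
  have m₂ : γ₂ ∈ jacobiModularGroup 1 := by
    rw [mem_jacobiModularGroup_iff]
    refine ⟨h₂, ?_, ?_, zero_mem realIntegers⟩ <;> intro i <;> fin_cases i
    exacts [hl 1, hm 1]
  have hpar : IsParabolicOfNorm 1 (ofSymplectic p) := by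
    refine ⟨⟨rfl, hp.2⟩, ?_, zero_mem realIntegers⟩
    have hp' := (mem_jacobiParabolic_iff (γ := ofSymplectic p)).1 ⟨ofSymplectic_mem hp.1, rfl, hp⟩
    -- The determinant of D is an integer with an integral inverse, hence ±1.
    have hone : (ofSymplectic p).detD * (ofSymplectic p)⁻¹.detD = 1 := by
      rw [← detD_mul hp'.2, mul_inv_cancel, detD]
      have : (1 : JacobiGroup 2 ℝ).g.1.toBlocks₂₂ = 1 := by
        change toBlocks₂₂ (1 : Matrix (Fin 2 ⊕ Fin 2) (Fin 2 ⊕ Fin 2) ℝ) = 1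
        rw [← fromBlocks_one, toBlocks_fromBlocks₂₂]
      rw [this, det_one]
    have hint : ∀ δ ∈ jacobiModularGroup 2, δ.detD ∈ realIntegers := by
      intro δ hδ
      have := mem_siegelModularGroup_iff.1 (mem_jacobiModularGroup_iff.1 hδ).1
      rw [detD, det_fin_two]
      exact sub_mem (mul_mem (this _ _) (this _ _)) (mul_mem (this _ _) (this _ _))
    obtain ⟨a, ha⟩ := hint _ hp'.1
    obtain ⟨b, hb⟩ := hint _ (inv_mem hp'.1)
    rw [← ha, ← hb] at hone
    have hone' : a * b = 1 := by
      simp only [eq_intCast] at hone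
      exact_mod_cast hone
    rw [← ha]
    rcases Int.eq_one_or_neg_one_of_mul_eq_one hone' with h | h <;> simp [h]
  refine ⟨d, γ₂.flip * diagElement d * γ₁,
    mem_heckeDoubleCoset_iff.2 ⟨_, flip_mem m₂, _, m₁, rfl⟩,
    ofSymplectic p * (scaleElement d * flipElement γ₂), ?_, ?_⟩
  · have := hpar.mul ((isParabolicOfNorm_scaleElement d).mul (isParabolicOfNorm_flipElement γ₂))
    rwa [one_mul, mul_one] at this
  · have e : γ = ofSymplectic p * (garrettElement d * (γ₁.up * γ₂.down)) := by
      rw [up_mul_down_eq, garrettElement, ofSymplectic_mul, ofSymplectic_mul]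
      refine JacobiGroup.ext ?_ ?_ ?_ (add_zero _).symm
      · rw [hg, mul_assoc]
      · funext i; fin_cases i <;> rfl
      · funext i; fin_cases i <;> rfl
    calc γ = ofSymplectic p * (scaleElement d * (garrettElement 1 * (diagElement d).up)
          * (γ₁.up * γ₂.down)) := by rw [e, garrettElement_eq]
      _ = ofSymplectic p * (scaleElement d * ((garrettElement 1 * γ₂.down) *
          ((diagElement d).up * γ₁.up))) := by
        rw [up_mul_down γ₁ γ₂]
        simp only [mul_assoc]
        rw [← mul_assoc (diagElement d).up γ₂.down, up_mul_down]
        simp only [mul_assoc]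
      _ = _ := by
        rw [garrettElement_mul_down]
        simp only [up_mul, mul_assoc]

/-- The converse factorization: for ξ = α diag(d, d⁻¹) β the factor α is moved back to the second
variable. Since `flip` is an involution, it appears there as flip α. -/
theorem exists_mul_mem_garrettCell {d : ℕ+} {ξ : JacobiGroup 1 ℝ} (hξ : ξ ∈ heckeDoubleCoset d) :
    ∃ q : JacobiGroup 2 ℝ, IsParabolicOfNorm d q ∧
      q * (garrettElement 1 * ξ.up) ∈ garrettCell := by
  obtain ⟨α, hα, β, hβ, rfl⟩ := mem_heckeDoubleCoset_iff.1 hξ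
  refine ⟨scaleElement d * flipElement α.flip, ?_, ?_⟩
  · have := (isParabolicOfNorm_scaleElement d).mul (isParabolicOfNorm_flipElement α.flip)
    rwa [mul_one] at this
  have e : scaleElement d * flipElement α.flip * (garrettElement 1 * (α * diagElement d * β).up)
      = garrettElement d * (β.up * α.flip.down) := by
    have h1 := garrettElement_mul_down α.flip
    rw [flip_flip] at h1
    calc _ = scaleElement d * (flipElement α.flip * (garrettElement 1 * α.up))
          * ((diagElement d).up * β.up) := by simp only [up_mul, mul_assoc]
      _ = scaleElement d * garrettElement 1 * (α.flip.down * (diagElement d).up) * β.up := by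
          rw [← h1]; simp only [mul_assoc]
      _ = scaleElement d * (garrettElement 1 * (diagElement d).up) * (α.flip.down * β.up) := by
          rw [← up_mul_down]; simp only [mul_assoc]
      _ = _ := by rw [← garrettElement_eq, up_mul_down]
  rw [e]
  refine ⟨mul_mem (ofSymplectic_mem (garrettRep_mem d))
    (mul_mem (up_mem hβ) (down_mem (flip_mem hα))), d, d.pos, 1, ⟨one_mem _, toBlocks₂₁_one 2⟩,
    β.g,
    (mem_jacobiModularGroup_iff.1 hβ).1, α.flip.g,
    (mem_jacobiModularGroup_iff.1 (flip_mem hα)).1, ?_⟩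
  rw [one_mul, garrettElement, ofSymplectic_mul, up_mul_down_eq]

/-! ### Uniqueness of ξ up to the center -/

/-- The element `(0, 0, κ)` of the Heisenberg group. -/
def central (κ : ℝ) : JacobiGroup 1 ℝ := ⟨1, 0, 0, κ⟩

theorem central_mul (κ : ℝ) (ξ : JacobiGroup 1 ℝ) :
    central κ * ξ = ⟨ξ.g, ξ.lam, ξ.mu, κ + ξ.kappa⟩ := by
  refine JacobiGroup.ext (one_mul _) ?_ ?_ ?_
  · funext i; fin_cases i; simp [mul_lam_apply, central]
  · funext i; fin_cases i; simp [mul_mu_apply, central]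
  · simp [mul_kappa_apply, mul_lam_apply, mul_mu_apply, central]

theorem mul_central (κ : ℝ) (γ : JacobiGroup 1 ℝ) : γ * central κ = central κ * γ := by
  rw [central_mul]
  refine JacobiGroup.ext (mul_one _) ?_ ?_ ?_
  · funext i; fin_cases i; simp [mul_lam_apply, central]
  · funext i; fin_cases i; simp [mul_mu_apply, central]
  · simp [mul_kappa_apply, mul_lam_apply, mul_mu_apply, central, add_comm]

theorem central_mem_iff {κ : ℝ} : central κ ∈ jacobiModularGroup 1 ↔ κ ∈ realIntegers := by
  rw [mem_jacobiModularGroup_iff]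
  exact ⟨fun h => h.2.2.2, fun h => ⟨one_mem _, fun _ => zero_mem realIntegers,
    fun _ => zero_mem realIntegers, h⟩⟩

/-- An element acting only in the first variable preserves the graph spanned by the bottom rows of
h_1 only if its symplectic part is 1. The vanishing second coordinates of (λ, μ) then force the μ of
`q`, and with it λ and μ of `ζ`, to be zero. -/
theorem eq_central_of_mem_siegelJacobi {ζ : JacobiGroup 1 ℝ} {q : JacobiGroup 2 ℝ}
    (hq : q ∈ siegelJacobi 2) (h : garrettElement 1 * ζ.up = q * garrettElement 1) :
    ζ = central ζ.kappa := by
  obtain ⟨hl, hC⟩ := hq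
  have hC' : ∀ i j, q.g.1 (.inr i) (.inl j) = 0 := fun i j => congrFun (congrFun hC i) j
  have hg : ∀ i j, ((garrettRep 1).1 * ζ.up.g.1) i j = (q.g.1 * (garrettRep 1).1) i j := fun i j =>
    congrArg (fun γ : JacobiGroup 2 ℝ => γ.g.1 i j) h
  have hlam := fun i => congrArg (fun γ : JacobiGroup 2 ℝ => γ.lam i) h
  have hmu := fun i => congrArg (fun γ : JacobiGroup 2 ℝ => γ.mu i) h
  simp only [mul_lam_apply, mul_mu_apply, hl] at hlam hmu
  have g1 := fun i j => hg (.inr i) (.inl j)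
  have g2 := fun i j => hg (.inr i) (.inr j)
  have g100 := g1 0 0
  have g101 := g1 0 1
  have g110 := g1 1 0
  have g111 := g1 1 1
  have g200 := g2 0 0
  have g201 := g2 0 1
  have g210 := g2 1 0
  have g211 := g2 1 1
  have l0 := hlam 0
  have l1 := hlam 1
  have m0 := hmu 0
  have m1 := hmu 1
  simp [garrettRep, up, symplecticProd, Matrix.mul_apply, Fintype.sum_sum_type, hC',
    garrettElement, ofSymplectic] at g100 g101 g110 g111 g200 g201 g210 g211 l0 l1 m0 m1
  refine ext₁ ?_ ?_ ?_ ?_ ?_ ?_ rfl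
  · change ζ.ea = 1
    simp only [ea]; linarith
  · change ζ.eb = 0
    simp only [eb]; linarith
  · change ζ.ec = 0
    simp only [ec]; linarith
  · change ζ.ed = 1
    simp only [ed]; linarith
  · change ζ.lam 0 = 0
    linarith
  · change ζ.mu 0 = 0
    linarith

theorem eq_central_mul_of_eq_mul {ξ ξ' : JacobiGroup 1 ℝ} {q : JacobiGroup 2 ℝ}
    (hq : q ∈ siegelJacobi 2)
    (h : garrettElement 1 * ξ.up = q * (garrettElement 1 * ξ'.up)) :
    ∃ κ, ξ = central κ * ξ' := by
  have : garrettElement 1 * (ξ * ξ'⁻¹).up = q * garrettElement 1 := by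
    rw [up_mul, ← mul_assoc, h, up_inv]
    group
  have h1 := eq_central_of_mem_siegelJacobi hq this
  exact ⟨_, by rw [← h1, inv_mul_cancel_right]⟩

theorem eq_central_mul_of_row_eq {ξ ξ' : JacobiGroup 1 ℝ} (hg : ξ.g = ξ'.g)
    (hl : ξ.lam 0 = ξ'.lam 0) (hm : ξ.mu 0 = ξ'.mu 0) : ∃ κ, ξ = central κ * ξ' := by
  refine ⟨ξ.kappa - ξ'.kappa, ?_⟩
  rw [central_mul]
  refine JacobiGroup.ext hg ?_ ?_ (sub_add_cancel _ _).symm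
  · funext i; fin_cases i; exact hl
  · funext i; fin_cases i; exact hm

/-! ### Invariants of the Hecke double cosets and the center -/

/-- The matrix `t (a b; c d)` is integral. -/
def IntegralMul (t : ℝ) (ξ : JacobiGroup 1 ℝ) : Prop :=
  t * ξ.ea ∈ realIntegers ∧ t * ξ.eb ∈ realIntegers ∧ t * ξ.ec ∈ realIntegers ∧
    t * ξ.ed ∈ realIntegers

theorem IntegralMul.mul_left {t : ℝ} {ξ γ : JacobiGroup 1 ℝ} (h : IntegralMul t ξ)
    (hγ : γ ∈ jacobiModularGroup 1) : IntegralMul t (γ * ξ) := by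
  obtain ⟨h1, h2, h3, h4⟩ := h
  obtain ⟨⟨a, b, c, d⟩, -⟩ := mem_jacobiModularGroup_one_iff.1 hγ
  rw [IntegralMul, mul_ea, mul_eb, mul_ec, mul_ed]
  simp only [mul_add, mul_left_comm t]
  exact ⟨add_mem (mul_mem a h1) (mul_mem b h3), add_mem (mul_mem a h2) (mul_mem b h4),
    add_mem (mul_mem c h1) (mul_mem d h3), add_mem (mul_mem c h2) (mul_mem d h4)⟩

theorem IntegralMul.mul_right {t : ℝ} {ξ γ : JacobiGroup 1 ℝ} (h : IntegralMul t ξ)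
    (hγ : γ ∈ jacobiModularGroup 1) : IntegralMul t (ξ * γ) := by
  obtain ⟨h1, h2, h3, h4⟩ := h
  obtain ⟨⟨a, b, c, d⟩, -⟩ := mem_jacobiModularGroup_one_iff.1 hγ
  rw [IntegralMul, mul_ea, mul_eb, mul_ec, mul_ed]
  simp only [mul_add, ← mul_assoc t]
  exact ⟨add_mem (mul_mem h1 a) (mul_mem h2 c), add_mem (mul_mem h1 b) (mul_mem h2 d),
    add_mem (mul_mem h3 a) (mul_mem h4 c), add_mem (mul_mem h3 b) (mul_mem h4 d)⟩

theorem integralMul_of_mem_heckeDoubleCoset {d : ℕ+} {ξ : JacobiGroup 1 ℝ}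
    (hξ : ξ ∈ heckeDoubleCoset d) : IntegralMul d ξ := by
  obtain ⟨α, hα, β, hβ, rfl⟩ := mem_heckeDoubleCoset_iff.1 hξ
  refine IntegralMul.mul_right (IntegralMul.mul_left ?_ hα) hβ
  have hd : (d : ℝ) ≠ 0 := by exact_mod_cast d.ne_zero
  have hn : (d : ℝ) ∈ realIntegers := natCast_mem realIntegers (d : ℕ)
  refine ⟨mul_mem hn hn, ?_, ?_, ?_⟩
  · change (d : ℝ) * 0 ∈ realIntegers
    rw [mul_zero]; exact zero_mem _
  · change (d : ℝ) * 0 ∈ realIntegers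
    rw [mul_zero]; exact zero_mem _
  · change (d : ℝ) * (d : ℝ)⁻¹ ∈ realIntegers
    rw [mul_inv_cancel₀ hd]; exact one_mem _

/-- Integrality of eξ is invariant under Γ^J on both sides, so it may be tested on diag(d, d⁻¹),
where it says e/d ∈ ℤ. -/
theorem dvd_of_integralMul {d e : ℕ+} {ξ : JacobiGroup 1 ℝ} (hξ : ξ ∈ heckeDoubleCoset d)
    (h : IntegralMul e ξ) : d ∣ e := by
  obtain ⟨α, hα, β, hβ, rfl⟩ := mem_heckeDoubleCoset_iff.1 hξ
  have h1 := (h.mul_left (inv_mem hα)).mul_right (inv_mem hβ)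
  have e1 : α⁻¹ * (α * diagElement d * β) * β⁻¹ = diagElement d := by group
  rw [e1] at h1
  obtain ⟨z, hz⟩ := h1.2.2.2
  have hd : (d : ℝ) ≠ 0 := by exact_mod_cast d.ne_zero
  have hz' : (z : ℝ) = e * (d : ℝ)⁻¹ := hz
  have h2 : (e : ℝ) = d * z := by rw [hz']; field_simp
  rw [PNat.dvd_iff, ← Int.natCast_dvd_natCast]
  exact ⟨z, by exact_mod_cast h2⟩

/-- The number d is the least common denominator of the symplectic part, hence the sets 𝕏(d) are
disjoint. -/
theorem eq_of_mem_heckeDoubleCoset {d d' : ℕ+} {ξ ξ' : JacobiGroup 1 ℝ}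
    (hξ : ξ ∈ heckeDoubleCoset d) (hξ' : ξ' ∈ heckeDoubleCoset d') (h : ξ.g = ξ'.g) : d = d' := by
  have e1 : ∀ t, IntegralMul t ξ ↔ IntegralMul t ξ' := by
    intro t; simp only [IntegralMul, ea, eb, ec, ed, h]
  exact PNat.dvd_antisymm
    (dvd_of_integralMul hξ ((e1 _).2 (integralMul_of_mem_heckeDoubleCoset hξ')))
    (dvd_of_integralMul hξ' ((e1 _).1 (integralMul_of_mem_heckeDoubleCoset hξ)))

/-- Since diag(d, d⁻¹) has trivial Heisenberg part, multiplying by it leaves κ unchanged on either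
side. So κ is a difference of two integral third components. -/
theorem mem_realIntegers_of_central {d : ℕ+} {ξ ξ' : JacobiGroup 1 ℝ}
    (hξ : ξ ∈ heckeDoubleCoset d) (hξ' : ξ' ∈ heckeDoubleCoset d) {κ : ℝ}
    (h : ξ = central κ * ξ') : κ ∈ realIntegers := by
  obtain ⟨α, hα, β, hβ, rfl⟩ := mem_heckeDoubleCoset_iff.1 hξ
  obtain ⟨α', hα', β', hβ', rfl⟩ := mem_heckeDoubleCoset_iff.1 hξ'
  have e : (α'⁻¹ * α) * diagElement d = central κ * (diagElement d * (β' * β⁻¹)) := by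
    calc _ = α'⁻¹ * (α * diagElement d * β) * β⁻¹ := by group
      _ = α'⁻¹ * central κ * (α' * diagElement d * β') * β⁻¹ := by rw [h]; group
      _ = _ := by
        rw [mul_central]
        group
  have e' := congrArg JacobiGroup.kappa e
  rw [central_mul] at e'
  simp only [mul_kappa₁ _ (diagElement d), mul_kappa₁ (diagElement d)] at e'
  simp [diagElement] at e'
  obtain ⟨-, -, -, h1⟩ := mem_jacobiModularGroup_iff.1 (mul_mem (inv_mem hα') hα)
  obtain ⟨-, -, -, h2⟩ := mem_jacobiModularGroup_iff.1 (mul_mem hβ' (inv_mem hβ))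
  rw [eq_sub_of_add_eq e'.symm]
  exact sub_mem h1 h2

/-- Commuting with (1, 0, 0) and (0, 1, 0) forces the symplectic part to fix both basis vectors, and
the third components then force λ = μ = 0. -/
theorem mem_centerJacobiModularGroup_iff {ζ : JacobiGroup 1 ℝ} :
    ζ ∈ centerJacobiModularGroup ↔ ∃ κ ∈ realIntegers, ζ = central κ := by
  constructor
  · rintro ⟨⟨z, hz⟩, hc, rfl⟩
    have hc' : ∀ γ ∈ jacobiModularGroup 1, γ * z = z * γ := fun γ hγ =>
      congrArg Subtype.val (Subgroup.mem_center_iff.1 hc ⟨γ, hγ⟩)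
    have h1 := hc' ⟨1, ![1], 0, 0⟩ (mem_jacobiModularGroup_iff.2 ⟨one_mem _,
      fun i => by fin_cases i; exact one_mem realIntegers, fun _ => zero_mem realIntegers,
      zero_mem realIntegers⟩)
    have h2 := hc' ⟨1, 0, ![1], 0⟩ (mem_jacobiModularGroup_iff.2 ⟨one_mem _,
      fun _ => zero_mem realIntegers, fun i => by fin_cases i; exact one_mem realIntegers,
      zero_mem realIntegers⟩)
    have l1 := congrArg (fun γ : JacobiGroup 1 ℝ => γ.lam 0) h1
    have m1 := congrArg (fun γ : JacobiGroup 1 ℝ => γ.mu 0) h1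
    have k1 := congrArg JacobiGroup.kappa h1
    have l2 := congrArg (fun γ : JacobiGroup 1 ℝ => γ.lam 0) h2
    have m2 := congrArg (fun γ : JacobiGroup 1 ℝ => γ.mu 0) h2
    have k2 := congrArg JacobiGroup.kappa h2
    simp only [mul_lam₁, mul_mu₁, mul_kappa₁] at l1 m1 k1 l2 m2 k2
    simp [ea, eb, ec, ed] at l1 m1 k1 l2 m2 k2
    rw [add_comm, add_right_inj] at l1 m2
    rw [l1, m1] at k1
    rw [l2, m2] at k2
    have hz' := mem_jacobiModularGroup_iff.1 hz
    refine ⟨z.kappa, hz'.2.2.2, ext₁ l1 m1 l2 m2 ?_ ?_ rfl⟩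
    · change z.lam 0 = 0
      linarith
    · change z.mu 0 = 0
      linarith
  · rintro ⟨κ, hκ, rfl⟩
    refine ⟨⟨central κ, central_mem_iff.2 hκ⟩, Subgroup.mem_center_iff.2 ?_, rfl⟩
    rintro ⟨γ, hγ⟩
    refine Subtype.ext ?_
    change γ * central κ = central κ * γ
    exact mul_central _ _
end JacobiGroup

/-! ### Estimates for the terms of the Poincaré series -/

/-- A lower bound for the Hermitian form with matrix `adj Y`, evaluated at `(λ, l) 𝒯 + (μ, -m)`. -/
theorem hermitian_lower_bound {τ u ζ : ℂ} (hp : 0 < τ.im) (hD : 0 < τ.im * ζ.im - u.im ^ 2) :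
    ∃ ε > 0, ∀ lam mu l m : ℝ, ∀ W₁ W₂ : ℂ, W₁ = lam * τ + l * u + mu → W₂ = lam * u + l * ζ - m →
      ε * (Complex.normSq W₁ + Complex.normSq W₂) ≤ ζ.im * Complex.normSq W₁
        - 2 * u.im * (W₁.re * W₂.re + W₁.im * W₂.im) + τ.im * Complex.normSq W₂ ∧
      ε * (lam ^ 2 + mu ^ 2 + l ^ 2 + m ^ 2) ≤ ζ.im * Complex.normSq W₁
        - 2 * u.im * (W₁.re * W₂.re + W₁.im * W₂.im) + τ.im * Complex.normSq W₂ := by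
  obtain ⟨τ₁, p⟩ := τ
  obtain ⟨u₁, q⟩ := u
  obtain ⟨ζ₁, r⟩ := ζ
  simp only at hp hD ⊢
  have hr : 0 < r := by nlinarith [sq_nonneg q]
  set D := p * r - q ^ 2 with hDdef
  have hpr : 0 < p + r := by linarith
  -- Determinant over trace bounds the smallest eigenvalue of adj Y from below.
  set ε₁ := D / (p + r) with hε₁
  have hε₁pos : 0 < ε₁ := div_pos hD hpr
  have h1 : ∀ x y : ℝ, ε₁ * (x ^ 2 + y ^ 2) ≤ r * x ^ 2 - 2 * q * (x * y) + p * y ^ 2 := by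
    intro x y
    rw [hε₁, div_mul_eq_mul_div, div_le_iff₀ hpr]
    linarith [sq_nonneg (r * x - q * y), sq_nonneg (q * x - p * y)]
  -- The imaginary parts of W₁, W₂ are (λ, l)Y. Inverting Y recovers (λ, l), with squared Frobenius
  -- norm of Y⁻¹ equal to K; the real parts then recover μ and m.
  set K := (p ^ 2 + 2 * q ^ 2 + r ^ 2) / D ^ 2 with hK
  have hKnn : 0 ≤ K := by positivity
  set M := 4 + K * (1 + 3 * (τ₁ ^ 2 + 2 * u₁ ^ 2 + ζ₁ ^ 2)) with hM
  have hMpos : 0 < M := by positivity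
  refine ⟨min ε₁ (ε₁ / M), lt_min hε₁pos (div_pos hε₁pos hMpos), ?_⟩
  intro lam mu l m W₁ W₂ e₁ e₂
  have r₁ : W₁.re = lam * τ₁ + l * u₁ + mu := by rw [e₁]; simp
  have i₁ : W₁.im = lam * p + l * q := by rw [e₁]; simp
  have r₂ : W₂.re = lam * u₁ + l * ζ₁ - m := by rw [e₂]; simp
  have i₂ : W₂.im = lam * q + l * r := by rw [e₂]; simp
  simp only [Complex.normSq_apply]
  set A := W₁.re
  set B := W₁.im
  set A' := W₂.re
  set B' := W₂.im
  have hA := h1 A A'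
  have hB := h1 B B'
  have hbase : ε₁ * (A * A + B * B + (A' * A' + B' * B')) ≤ r * (A * A + B * B)
      - 2 * q * (A * A' + B * B') + p * (A' * A' + B' * B') := by linarith
  have hll : lam ^ 2 + l ^ 2 ≤ K * (B ^ 2 + B' ^ 2) := by
    rw [hK, div_mul_eq_mul_div, le_div_iff₀ (by positivity)]
    have e3 : lam * D = r * B - q * B' := by rw [i₁, i₂, hDdef]; ring
    have e4 : l * D = p * B' - q * B := by rw [i₁, i₂, hDdef]; ring
    have : (lam ^ 2 + l ^ 2) * D ^ 2 = (r * B - q * B') ^ 2 + (p * B' - q * B) ^ 2 := by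
      rw [← e3, ← e4]; ring
    rw [this]
    linarith [sq_nonneg (r * B' + q * B), sq_nonneg (p * B + q * B')]
  have hmu : mu ^ 2 ≤ 3 * (A ^ 2 + lam ^ 2 * τ₁ ^ 2 + l ^ 2 * u₁ ^ 2) := by
    have : mu = A - lam * τ₁ - l * u₁ := by rw [r₁]; ring
    rw [this]
    linarith [sq_nonneg (A + lam * τ₁), sq_nonneg (A + l * u₁), sq_nonneg (lam * τ₁ - l * u₁)]
  have hm : m ^ 2 ≤ 3 * (A' ^ 2 + lam ^ 2 * u₁ ^ 2 + l ^ 2 * ζ₁ ^ 2) := by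
    have : m = lam * u₁ + l * ζ₁ - A' := by rw [r₂]; ring
    rw [this]
    linarith [sq_nonneg (A' + lam * u₁), sq_nonneg (A' + l * ζ₁), sq_nonneg (lam * u₁ - l * ζ₁)]
  have hsum : lam ^ 2 + mu ^ 2 + l ^ 2 + m ^ 2 ≤ M * (A * A + B * B + (A' * A' + B' * B')) := by
    have h3 : lam ^ 2 + mu ^ 2 + l ^ 2 + m ^ 2 ≤ 3 * (A ^ 2 + A' ^ 2)
        + (lam ^ 2 + l ^ 2) * (1 + 3 * (τ₁ ^ 2 + 2 * u₁ ^ 2 + ζ₁ ^ 2)) := by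
      have h30 : 0 ≤ 3 * (lam ^ 2 * (u₁ ^ 2 + ζ₁ ^ 2) + l ^ 2 * (τ₁ ^ 2 + u₁ ^ 2)) := by positivity
      linarith
    set c := 1 + 3 * (τ₁ ^ 2 + 2 * u₁ ^ 2 + ζ₁ ^ 2)
    have hc : 0 ≤ c := by positivity
    have h4 := mul_le_mul_of_nonneg_right hll hc
    have h5 : 0 ≤ K * c * (A ^ 2 + A' ^ 2) := by positivity
    have h6 : 0 ≤ A ^ 2 + A' ^ 2 + 4 * (B ^ 2 + B' ^ 2) := by positivity
    rw [hM]
    linarith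
  have hnn : 0 ≤ A * A + B * B + (A' * A' + B' * B') := by
    linarith [mul_self_nonneg A, mul_self_nonneg A', mul_self_nonneg B, mul_self_nonneg B']
  constructor
  · exact (mul_le_mul_of_nonneg_right (min_le_left _ _) hnn).trans hbase
  · refine ((mul_le_mul_of_nonneg_right (min_le_right _ _) (by positivity)).trans ?_).trans hbase
    rw [div_mul_eq_mul_div, div_le_iff₀ hMpos, mul_assoc]
    refine mul_le_mul_of_nonneg_left ?_ hε₁pos.le
    linarith

/-- The imaginary part of `N₀ / δ` as a Hermitian form. -/
theorem im_mul_conj_eq {a b c d l m lam mu : ℝ} (h : a * d - c * b = 1)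
    (hlam : lam = l * a + m * c) (hmu : mu = l * b + m * d) {τ u ζ W₁ W₂ : ℂ}
    (h₁ : W₁ = lam * τ + l * u + mu) (h₂ : W₂ = lam * u + l * ζ - m) :
    ((lam * l * (τ * ζ - u ^ 2) - lam * m * τ + mu * l * ζ - mu * m : ℂ)
      * (starRingEnd ℂ) (c * (τ * ζ - u ^ 2) + a * τ + 2 * u + d * ζ + b)).im
      = ζ.im * Complex.normSq W₁ - 2 * u.im * (W₁.re * W₂.re + W₁.im * W₂.im)
        + τ.im * Complex.normSq W₂ := by
  have hl : l = lam * d - mu * c := by rw [hlam, hmu]; linear_combination -l * h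
  have hm : m = mu * a - lam * b := by rw [hlam, hmu]; linear_combination -m * h
  obtain ⟨τ₁, p⟩ := τ
  obtain ⟨u₁, q⟩ := u
  obtain ⟨ζ₁, r⟩ := ζ
  have r₁ : W₁.re = lam * τ₁ + l * u₁ + mu := by rw [h₁]; simp
  have i₁ : W₁.im = lam * p + l * q := by rw [h₁]; simp
  have r₂ : W₂.re = lam * u₁ + l * ζ₁ - m := by rw [h₂]; simp
  have i₂ : W₂.im = lam * q + l * r := by rw [h₂]; simp
  simp only [Complex.normSq_apply, r₁, i₁, r₂, i₂]
  simp [pow_two]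
  -- X and Y are the real and imaginary parts of det 𝒯. In the imaginary part of N₀ times conj δ,
  -- the coefficient of each pair among det 𝒯, τ, ζ, 1 is rewritten with la + mc = λ, lb + md = μ
  -- and their inverse relations, which eliminates a, b, c, d.
  set X := τ₁ * ζ₁ - p * r - (u₁ * u₁ - q * q) with hX
  set Y := τ₁ * r + p * ζ₁ - (u₁ * q + q * u₁) with hY
  linear_combination (exp := 1) (Y * τ₁ - X * p) * lam * (-hlam) + (Y * ζ₁ - X * r) * l * (-hl)
    + Y * (lam * (-hmu) - m * (-hl))
    + (p * ζ₁ - τ₁ * r) * (m * hl + mu * hlam) + p * m * (-hm) + r * mu * (-hmu)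

/-- The denominator `δ = c det 𝒯 + a τ + 2 u + d ζ + b` attached to `(a b; c d)`. -/
def delta (τ u ζ : ℂ) (a b c d : ℝ) : ℂ := c * (τ * ζ - u ^ 2) + a * τ + 2 * u + d * ζ + b

/-- The exponent of a term of the Poincaré series, up to a real summand. -/
def termExponent (τ u ζ z₁ z₂ : ℂ) (a b c d lam mu : ℝ) : ℂ :=
  lam ^ 2 * τ + 2 * lam * z₁ - ((c * ζ + a) * (z₁ + lam * τ + mu) ^ 2
    + 2 * (1 - c * u) * (z₁ + lam * τ + mu) * (z₂ + lam * u)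
    + (c * τ + d) * (z₂ + lam * u) ^ 2) / delta τ u ζ a b c d

section Estimates

variable {τ u ζ : ℂ}

theorem norm_delta_le (a b c d : ℝ) : ‖delta τ u ζ a b c d‖
    ≤ (1 + ‖τ‖ + ‖u‖ + ‖ζ‖ + ‖τ * ζ - u ^ 2‖) * (|a| + |b| + |c| + |d| + 2) := by
  have h : ‖delta τ u ζ a b c d‖
      ≤ |c| * ‖τ * ζ - u ^ 2‖ + |a| * ‖τ‖ + 2 * ‖u‖ + |d| * ‖ζ‖ + |b| := by
    refine (norm_add_le _ _).trans ?_
    refine add_le_add ((norm_add_le _ _).trans ?_) (by simp)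
    refine add_le_add ((norm_add_le _ _).trans ?_) (by simp)
    refine add_le_add ((norm_add_le _ _).trans ?_) (by simp)
    refine add_le_add ?_ ?_ <;> rw [norm_mul, Complex.norm_real, Real.norm_eq_abs]
  have hτ := norm_nonneg τ
  have hu := norm_nonneg u
  have hζ := norm_nonneg ζ
  have hd := norm_nonneg (τ * ζ - u ^ 2)
  have ha := abs_nonneg a
  have hb := abs_nonneg b
  have hc := abs_nonneg c
  have hd' := abs_nonneg d
  refine h.trans ?_
  generalize ‖τ‖ = x1 at *
  generalize ‖u‖ = x2 at *
  generalize ‖ζ‖ = x3 at *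
  generalize ‖τ * ζ - u ^ 2‖ = x4 at *
  have : 0 ≤ (1 + x1 + x2 + x3 + x4) * (|a| + |b| + |c| + |d| + 2)
      - (|c| * x4 + |a| * x1 + 2 * x2 + |d| * x3 + |b|) := by
    ring_nf
    positivity
  linarith

/-- Cauchy–Schwarz for five numbers gives 5(S + 4), where S = a² + b² + c² + d², and S ≥ 2 because S
= (a - d)² + (b + c)² + 2. -/
theorem sq_sum_abs_le {a b c d : ℝ} (h : a * d - c * b = 1) :
    (|a| + |b| + |c| + |d| + 2) ^ 2 ≤ 15 * (a ^ 2 + b ^ 2 + c ^ 2 + d ^ 2) := by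
  have hS : 2 ≤ a ^ 2 + b ^ 2 + c ^ 2 + d ^ 2 := by nlinarith [sq_nonneg (a - d), sq_nonneg (b + c)]
  rw [← sq_abs a, ← sq_abs b, ← sq_abs c, ← sq_abs d] at *
  generalize |a| = x1 at *
  generalize |b| = x2 at *
  generalize |c| = x3 at *
  generalize |d| = x4 at *
  linarith [sq_nonneg (x1 - x2), sq_nonneg (x1 - x3), sq_nonneg (x1 - x4), sq_nonneg (x2 - x3),
    sq_nonneg (x2 - x4), sq_nonneg (x3 - x4), sq_nonneg (x1 - 2), sq_nonneg (x2 - 2),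
    sq_nonneg (x3 - 2), sq_nonneg (x4 - 2)]

/-- The splitting is by degree in (λ, μ). The quadratic part is N₀/δ up to the real number λμ, the
linear part is expressed through W₁ and W₂, and the rest depends only on z₁, z₂ and the matrix. -/
theorem termExponent_mul_delta (z₁ z₂ : ℂ) (a b c d lam mu : ℝ) (h : delta τ u ζ a b c d ≠ 0) :
    termExponent τ u ζ z₁ z₂ a b c d lam mu
      = (lam * (lam * d - mu * c) * (τ * ζ - u ^ 2) - lam * (mu * a - lam * b) * τ
          + mu * (lam * d - mu * c) * ζ - mu * (mu * a - lam * b)) / delta τ u ζ a b c d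
        - lam * mu
        + 2 * (z₁ * (lam * u + (lam * d - mu * c) * ζ - (mu * a - lam * b))
          - z₂ * (lam * τ + (lam * d - mu * c) * u + mu)) / delta τ u ζ a b c d
        - ((c * ζ + a) * z₁ ^ 2 + 2 * (1 - c * u) * z₁ * z₂ + (c * τ + d) * z₂ ^ 2)
          / delta τ u ζ a b c d := by
  rw [termExponent]
  field_simp
  rw [delta]
  ring

/-- A lower bound for `|δ|`. -/
theorem exists_delta_lower_bound (hp : 0 < τ.im) (hD : 0 < τ.im * ζ.im - u.im ^ 2) :
    ∃ ε > 0, ∀ a b c d : ℝ, a * d - c * b = 1 →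
      ε * (a ^ 2 + b ^ 2 + c ^ 2 + d ^ 2) ≤ ‖delta τ u ζ a b c d‖ ^ 2 := by
  obtain ⟨ε₀, hε₀, hherm⟩ := hermitian_lower_bound hp hD
  set B := 1 + ‖τ‖ + ‖u‖ + ‖ζ‖ + ‖τ * ζ - u ^ 2‖ with hB
  have hBpos : 0 < B := by positivity
  set ε₁ := ε₀ ^ 2 / (8 * B ^ 2) with hε₁
  have hε₁pos : 0 < ε₁ := by positivity
  have key : ∀ a b c d : ℝ, a * d - c * b = 1 → ∀ l m lam mu : ℝ, lam = l * a + m * c →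
      mu = l * b + m * d → ε₀ * (lam ^ 2 + mu ^ 2 + l ^ 2 + m ^ 2)
        ≤ ‖(lam * l * (τ * ζ - u ^ 2) - lam * m * τ + mu * l * ζ - mu * m : ℂ)‖
          * ‖delta τ u ζ a b c d‖ := by
    intro a b c d h l m lam mu hl hm
    have h1 := (hherm lam mu l m _ _ rfl rfl).2
    rw [← im_mul_conj_eq h hl hm rfl rfl] at h1
    refine h1.trans ((Complex.im_le_norm _).trans ?_)
    rw [norm_mul, RCLike.norm_conj, delta]
  have half : ∀ x y D : ℝ, 0 ≤ D → ε₀ * (x ^ 2 + y ^ 2) ≤ (|x| + |y|) * B * D →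
      ε₀ ^ 2 * (x ^ 2 + y ^ 2) ≤ 4 * B ^ 2 * D ^ 2 := by
    intro x y D hD0 hxy
    have e1 : x ^ 2 + y ^ 2 ≤ (|x| + |y|) ^ 2 := by
      nlinarith [sq_abs x, sq_abs y, mul_nonneg (abs_nonneg x) (abs_nonneg y)]
    have e2 : (|x| + |y|) ^ 2 ≤ 2 * (x ^ 2 + y ^ 2) := by
      nlinarith [sq_abs x, sq_abs y, sq_nonneg (|x| - |y|)]
    have e3 : ε₀ * (|x| + |y|) ≤ 2 * B * D := by
      rcases (add_nonneg (abs_nonneg x) (abs_nonneg y)).eq_or_lt with h0 | h0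
      · rw [← h0, mul_zero]; positivity
      · refine le_of_mul_le_mul_right ?_ h0
        nlinarith
    have e4 : 0 ≤ ε₀ * (|x| + |y|) := by positivity
    have e5 := pow_le_pow_left₀ e4 e3 2
    nlinarith [sq_nonneg ε₀]
  refine ⟨ε₁, hε₁pos, fun a b c d h => ?_⟩
  -- The choices (l, m) = (1, 0) and (0, 1) turn (λ, μ) into the rows of the matrix. Then N₀ is
  -- linear in the row, while the Hermitian form is quadratic, and dividing leaves a lower bound for
  -- |δ|.
  have h1 := key a b c d h 1 0 a b (by ring) (by ring)
  have h2 := key a b c d h 0 1 c d (by ring) (by ring)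
  have n1 : ‖((a : ℂ) * (1 : ℝ) * (τ * ζ - u ^ 2) - a * (0 : ℝ) * τ + b * (1 : ℝ) * ζ
      - b * (0 : ℝ) : ℂ)‖ ≤ (|a| + |b|) * B := by
    have : ((a : ℂ) * (1 : ℝ) * (τ * ζ - u ^ 2) - a * (0 : ℝ) * τ + b * (1 : ℝ) * ζ
      - b * (0 : ℝ) : ℂ) = a * (τ * ζ - u ^ 2) + b * ζ := by push_cast; ring
    rw [this]
    refine (norm_add_le _ _).trans ?_
    rw [norm_mul, norm_mul, Complex.norm_real, Complex.norm_real, Real.norm_eq_abs,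
      Real.norm_eq_abs, add_mul]
    gcongr <;> rw [hB] <;>
      linarith [norm_nonneg τ, norm_nonneg u, norm_nonneg ζ, norm_nonneg (τ * ζ - u ^ 2)]
  have n2 : ‖((c : ℂ) * (0 : ℝ) * (τ * ζ - u ^ 2) - c * (1 : ℝ) * τ + d * (0 : ℝ) * ζ
      - d * (1 : ℝ) : ℂ)‖ ≤ (|c| + |d|) * B := by
    have : ((c : ℂ) * (0 : ℝ) * (τ * ζ - u ^ 2) - c * (1 : ℝ) * τ + d * (0 : ℝ) * ζ
      - d * (1 : ℝ) : ℂ) = -(c * τ + d * 1) := by push_cast; ring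
    rw [this, norm_neg]
    refine (norm_add_le _ _).trans ?_
    rw [norm_mul, norm_mul, Complex.norm_real, Complex.norm_real, Real.norm_eq_abs,
      Real.norm_eq_abs, norm_one, add_mul]
    gcongr <;> rw [hB] <;>
      linarith [norm_nonneg τ, norm_nonneg u, norm_nonneg ζ, norm_nonneg (τ * ζ - u ^ 2)]
  have hδ := norm_nonneg (delta τ u ζ a b c d)
  have k1 := half a b _ hδ (by
    have := h1.trans (mul_le_mul_of_nonneg_right n1 hδ)
    nlinarith)
  have k2 := half c d _ hδ (by
    have := h2.trans (mul_le_mul_of_nonneg_right n2 hδ)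
    nlinarith)
  rw [hε₁, div_mul_eq_mul_div, div_le_iff₀ (by positivity)]
  linarith

/-- Lower bounds for `|δ|` and for the imaginary part of the exponent. -/
theorem exists_estimate (hp : 0 < τ.im) (hD : 0 < τ.im * ζ.im - u.im ^ 2) (z₁ z₂ : ℂ) :
    ∃ ε > 0, ∃ K : ℝ, ∀ a b c d lam mu : ℝ, a * d - c * b = 1 →
      ε * (a ^ 2 + b ^ 2 + c ^ 2 + d ^ 2) ≤ ‖delta τ u ζ a b c d‖ ^ 2 ∧
      ε * ((lam ^ 2 + mu ^ 2) / (a ^ 2 + b ^ 2 + c ^ 2 + d ^ 2)) - K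
        ≤ (termExponent τ u ζ z₁ z₂ a b c d lam mu).im := by
  obtain ⟨ε₀, hε₀, hherm⟩ := hermitian_lower_bound hp hD
  set B := 1 + ‖τ‖ + ‖u‖ + ‖ζ‖ + ‖τ * ζ - u ^ 2‖ with hB
  have hBpos : 0 < B := by positivity
  set Z := ‖z₁‖ + ‖z₂‖ with hZ
  have hZnn : 0 ≤ Z := by positivity
  obtain ⟨ε₁, hε₁pos, hlow⟩ := exists_delta_lower_bound hp hD
  set G := Real.sqrt (15 / ε₁) with hG
  refine ⟨min ε₁ (ε₀ / (30 * B ^ 2)), lt_min hε₁pos (by positivity), 4 * Z ^ 2 / ε₀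
    + 4 * B * Z ^ 2 * G, ?_⟩
  intro a b c d lam mu h
  have hlow' := hlow a b c d h
  have hS : 2 ≤ a ^ 2 + b ^ 2 + c ^ 2 + d ^ 2 := by nlinarith [sq_nonneg (a - d), sq_nonneg (b + c)]
  refine ⟨(mul_le_mul_of_nonneg_right (min_le_left _ _) (by linarith)).trans hlow', ?_⟩
  have hup := norm_delta_le (τ := τ) (u := u) (ζ := ζ) a b c d
  rw [← hB] at hup
  have hsq := sq_sum_abs_le h
  set S := a ^ 2 + b ^ 2 + c ^ 2 + d ^ 2 with hSdef
  set t := |a| + |b| + |c| + |d| + 2 with ht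
  have htpos : 0 < t := by positivity
  set δ := delta τ u ζ a b c d with hδ
  have hδpos : 0 < ‖δ‖ := by
    have : 0 < ‖δ‖ ^ 2 := lt_of_lt_of_le (by positivity) hlow'
    exact lt_of_le_of_ne (norm_nonneg _) fun h0 => by simp [← h0] at this
  have hδ0 : δ ≠ 0 := norm_pos_iff.1 hδpos
  set l := lam * d - mu * c with hl
  set m := mu * a - lam * b with hm
  have hlam : lam = l * a + m * c := by rw [hl, hm]; linear_combination -lam * h
  have hmu : mu = l * b + m * d := by rw [hl, hm]; linear_combination -mu * h
  obtain ⟨W₁, hW₁⟩ : ∃ W₁ : ℂ, W₁ = lam * τ + l * u + mu := ⟨_, rfl⟩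
  obtain ⟨W₂, hW₂⟩ : ∃ W₂ : ℂ, W₂ = lam * u + l * ζ - m := ⟨_, rfl⟩
  obtain ⟨hh1, hh2⟩ := hherm lam mu l m W₁ W₂ hW₁ hW₂
  have him := im_mul_conj_eq h hlam hmu hW₁ hW₂
  set H := ζ.im * Complex.normSq W₁ - 2 * u.im * (W₁.re * W₂.re + W₁.im * W₂.im)
        + τ.im * Complex.normSq W₂ with hH
  have hE := termExponent_mul_delta z₁ z₂ a b c d lam mu hδ0
  have hcl : ((lam : ℂ) * d - mu * c) = (l : ℂ) := by rw [hl]; push_cast; ring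
  have hcm : ((mu : ℂ) * a - lam * b) = (m : ℂ) := by rw [hm]; push_cast; ring
  rw [hcl, hcm, ← hW₁, ← hW₂, ← hδ] at hE
  have hn : Complex.normSq δ = ‖δ‖ ^ 2 := Complex.normSq_eq_norm_sq δ
  have i1 : ((lam * l * (τ * ζ - u ^ 2) - lam * m * τ + mu * l * ζ - mu * m : ℂ) / δ).im
      = H / ‖δ‖ ^ 2 := by
    rw [← him, ← hn, div_eq_mul_inv, Complex.inv_def, ← mul_assoc, Complex.im_mul_ofReal,
      div_eq_mul_inv]
    rfl
  have i2 : -(2 * Z * ((‖W₁‖ + ‖W₂‖) / ‖δ‖)) ≤ (2 * (z₁ * W₂ - z₂ * W₁) / δ).im := by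
    refine (neg_le_neg ?_).trans (abs_le.1 (Complex.abs_im_le_norm _)).1
    rw [norm_div, norm_mul, Complex.norm_two, ← mul_div_assoc, mul_assoc]
    gcongr
    refine (norm_sub_le _ _).trans ?_
    rw [norm_mul, norm_mul, hZ]
    linarith [mul_nonneg (norm_nonneg z₁) (norm_nonneg W₁),
      mul_nonneg (norm_nonneg z₂) (norm_nonneg W₂)]
  -- The size t of the entries is comparable to |δ|, so the part of the exponent free of λ and μ is
  -- bounded uniformly in the matrix.
  have ht' : t ≤ G * ‖δ‖ := by
    refine (pow_le_pow_iff_left₀ htpos.le (by positivity) two_ne_zero).1 ?_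
    rw [mul_pow, hG, Real.sq_sqrt (by positivity)]
    refine hsq.trans ?_
    rw [div_mul_eq_mul_div, le_div_iff₀ hε₁pos]
    linarith
  have i3 : (((c * ζ + a) * z₁ ^ 2 + 2 * (1 - c * u) * z₁ * z₂ + (c * τ + d) * z₂ ^ 2) / δ).im
      ≤ 4 * B * Z ^ 2 * G := by
    refine (Complex.im_le_norm _).trans ?_
    rw [norm_div, div_le_iff₀ hδpos]
    refine le_trans ?_ (mul_le_mul_of_nonneg_left ht'
      (show 0 ≤ 4 * B * Z ^ 2 by positivity) |>.trans_eq (by ring))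
    have := abs_nonneg a
    have := abs_nonneg b
    have := abs_nonneg c
    have := abs_nonneg d
    have hB1 : 1 ≤ B := by
      linarith [norm_nonneg τ, norm_nonneg u, norm_nonneg ζ, norm_nonneg (τ * ζ - u ^ 2)]
    have hBτ : ‖τ‖ ≤ B := by
      linarith [norm_nonneg u, norm_nonneg ζ, norm_nonneg (τ * ζ - u ^ 2)]
    have hBu : ‖u‖ ≤ B := by
      linarith [norm_nonneg τ, norm_nonneg ζ, norm_nonneg (τ * ζ - u ^ 2)]
    have hBζ : ‖ζ‖ ≤ B := by
      linarith [norm_nonneg τ, norm_nonneg u, norm_nonneg (τ * ζ - u ^ 2)]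
    have hcomb : ∀ p q x : ℝ, 0 ≤ p → 0 ≤ q → x ≤ B → p + q ≤ t → p * x + q ≤ B * t := by
      intro p q x hp hq hx hpq
      calc p * x + q ≤ p * B + q * B :=
            add_le_add (mul_le_mul_of_nonneg_left hx hp) (le_mul_of_one_le_right hq hB1)
        _ = B * (p + q) := by ring
        _ ≤ B * t := mul_le_mul_of_nonneg_left hpq hBpos.le
    have c1 : ‖(c * ζ + a : ℂ)‖ ≤ B * t := by
      refine (norm_add_le _ _).trans ?_
      rw [norm_mul, Complex.norm_real, Complex.norm_real, Real.norm_eq_abs, Real.norm_eq_abs]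
      exact hcomb _ _ _ (abs_nonneg c) (abs_nonneg a) hBζ (by linarith)
    have c2 : ‖(1 - c * u : ℂ)‖ ≤ B * t := by
      refine (norm_sub_le _ _).trans ?_
      rw [norm_mul, Complex.norm_real, norm_one, Real.norm_eq_abs]
      rw [add_comm]
      exact hcomb _ _ _ (abs_nonneg c) zero_le_one hBu (by linarith)
    have c3 : ‖(c * τ + d : ℂ)‖ ≤ B * t := by
      refine (norm_add_le _ _).trans ?_
      rw [norm_mul, Complex.norm_real, Complex.norm_real, Real.norm_eq_abs, Real.norm_eq_abs]
      exact hcomb _ _ _ (abs_nonneg c) (abs_nonneg d) hBτ (by linarith)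
    calc _ ≤ ‖(c * ζ + a : ℂ)‖ * ‖z₁‖ ^ 2 + 2 * ‖(1 - c * u : ℂ)‖ * ‖z₁‖ * ‖z₂‖
          + ‖(c * τ + d : ℂ)‖ * ‖z₂‖ ^ 2 := by
            refine (norm_add_le _ _).trans (add_le_add ((norm_add_le _ _).trans ?_) ?_)
            · simp [norm_pow]
            · simp [norm_pow]
      _ ≤ (B * t) * ‖z₁‖ ^ 2 + 2 * (B * t) * ‖z₁‖ * ‖z₂‖ + (B * t) * ‖z₂‖ ^ 2 := by gcongr
      _ = B * t * Z ^ 2 := by rw [hZ]; ring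
      _ ≤ 4 * B * Z ^ 2 * t := by
          linarith [mul_nonneg (mul_nonneg hBpos.le htpos.le) (sq_nonneg Z)]
  set w := (‖W₁‖ + ‖W₂‖) / ‖δ‖ with hw
  have hw2 : ε₀ / 2 * w ^ 2 ≤ H / ‖δ‖ ^ 2 := by
    rw [hw, div_pow, ← mul_div_assoc]
    gcongr
    refine le_trans ?_ hh1
    rw [Complex.normSq_eq_norm_sq, Complex.normSq_eq_norm_sq]
    linarith [mul_nonneg hε₀.le (sq_nonneg (‖W₁‖ - ‖W₂‖))]
  -- Completing the square: the linear term costs at most half of the positive term bounded in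
  -- `hw2`, plus a constant. The other half yields the decay in (λ, μ).
  have hw3 : 2 * Z * w ≤ ε₀ / 4 * w ^ 2 + 4 * Z ^ 2 / ε₀ := by
    rw [← sub_nonneg]
    have : ε₀ / 4 * w ^ 2 + 4 * Z ^ 2 / ε₀ - 2 * Z * w = (ε₀ * w - 4 * Z) ^ 2 / (4 * ε₀) := by
      field_simp
      ring
    rw [this]
    positivity
  -- Here 30 = 2 · 15: a factor 2 for the half kept, and |δ|² ≤ 15 B² S.
  have hHS : min ε₁ (ε₀ / (30 * B ^ 2)) * ((lam ^ 2 + mu ^ 2) / S) ≤ H / ‖δ‖ ^ 2 / 2 := by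
    have hδ2 : ‖δ‖ ^ 2 ≤ 15 * B ^ 2 * S := by
      have := pow_le_pow_left₀ hδpos.le hup 2
      rw [mul_pow] at this
      linarith [mul_le_mul_of_nonneg_left hsq (sq_nonneg B)]
    have hSpos : 0 < S := by linarith
    calc _ ≤ ε₀ / (30 * B ^ 2) * ((lam ^ 2 + mu ^ 2) / S) := by
          gcongr
          exact min_le_right _ _
      _ = ε₀ * (lam ^ 2 + mu ^ 2) / (15 * B ^ 2 * S) / 2 := by
          field_simp
          ring
      _ ≤ ε₀ * (lam ^ 2 + mu ^ 2) / ‖δ‖ ^ 2 / 2 := by gcongr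
      _ ≤ _ := by
          gcongr
          refine le_trans (mul_le_mul_of_nonneg_left ?_ hε₀.le) hh2
          linarith [sq_nonneg l, sq_nonneg m]
  rw [hE, Complex.sub_im, Complex.add_im, Complex.sub_im, i1]
  have i4 : ((lam : ℂ) * mu).im = 0 := by simp
  rw [i4]
  linarith

end Estimates

theorem norm_expTwoPiI (w : ℂ) : ‖expTwoPiI w‖ = Real.exp (-(2 * Real.pi * w.im)) := by
  rw [expTwoPiI, Complex.norm_exp]
  congr 1
  simp

/-! ### The terms of the series through δ and the exponent -/

namespace JacobiGroup

theorem im_pos_of_mem {x : JacobiPoint 2} (hx : x ∈ jacobiHalfSpace 2) :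
    0 < (x.1 0 0).im ∧ 0 < (x.1 0 0).im * (x.1 1 1).im - (x.1 0 1).im ^ 2 := by
  obtain ⟨hs, hp⟩ := hx
  refine ⟨hp.diag_pos (i := 0), ?_⟩
  have h := hp.det_pos
  rw [det_fin_two] at h
  have h10 : x.1 1 0 = x.1 0 1 := hs.apply 0 1
  simp only [map_apply, h10] at h
  rw [pow_two]
  exact h

section Blocks

variable (ξ : JacobiGroup 1 ℝ)

theorem garrettElement_mul_up_C :
    (garrettElement 1 * ξ.up).C = !![(ξ.ec : ℂ), 0; (ξ.ea : ℂ), 1] := by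
  rw [C, garrettElement, ofSymplectic_mul]
  ext i j
  fin_cases i <;> fin_cases j <;>
    simp [toBlocks₂₁, garrettRep, up, symplecticProd, fromBlocks_multiply]

theorem garrettElement_mul_up_D :
    (garrettElement 1 * ξ.up).D = !![(ξ.ed : ℂ), -1; (ξ.eb : ℂ), 0] := by
  rw [D, garrettElement, ofSymplectic_mul]
  ext i j
  fin_cases i <;> fin_cases j <;>
    simp [toBlocks₂₂, garrettRep, up, symplecticProd, fromBlocks_multiply]

theorem garrettElement_mul_up_J {T : Matrix (Fin 2) (Fin 2) ℂ} (hT : T.IsSymm) :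
    (garrettElement 1 * ξ.up).J T = !![ξ.ec * T 0 0 + ξ.ed, ξ.ec * T 0 1 - 1;
      ξ.ea * T 0 0 + T 0 1 + ξ.eb, ξ.ea * T 0 1 + T 1 1] := by
  have h10 : T 1 0 = T 0 1 := hT.apply 0 1
  rw [J, garrettElement_mul_up_C, garrettElement_mul_up_D]
  ext i j
  fin_cases i <;> fin_cases j <;> simp [vecMul, dotProduct, h10, sub_eq_add_neg]

theorem det_garrettElement_mul_up_J {T : Matrix (Fin 2) (Fin 2) ℂ} (hT : T.IsSymm) :
    ((garrettElement 1 * ξ.up).J T).det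
      = delta (T 0 0) (T 0 1) (T 1 1) ξ.ea ξ.eb ξ.ec ξ.ed := by
  have h : (ξ.ea * ξ.ed - ξ.ec * ξ.eb : ℂ) = 1 := by exact_mod_cast ξ.det_eq
  rw [garrettElement_mul_up_J ξ hT, det_fin_two_of, delta]
  linear_combination (T 0 1) * h

theorem exponent_garrettElement_mul_up {x : JacobiPoint 2} (hT : x.1.IsSymm)
    (hδ : delta (x.1 0 0) (x.1 0 1) (x.1 1 1) ξ.ea ξ.eb ξ.ec ξ.ed ≠ 0) :
    (garrettElement 1 * ξ.up).exponent x
      = -(termExponent (x.1 0 0) (x.1 0 1) (x.1 1 1) (x.2 0) (x.2 1) ξ.ea ξ.eb ξ.ec ξ.ed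
        (ξ.lam 0) (ξ.mu 0)) - ((ξ.kappa + ξ.mu 0 * ξ.lam 0 : ℝ) : ℂ) := by
  have h : (ξ.ea * ξ.ed - ξ.ec * ξ.eb : ℂ) = 1 := by exact_mod_cast ξ.det_eq
  have h10 : x.1 1 0 = x.1 0 1 := hT.apply 0 1
  have hdet := det_garrettElement_mul_up_J ξ hT
  have hl : (garrettElement 1 * ξ.up).lamC = ![(ξ.lam 0 : ℂ), 0] := by
    funext i
    change (((garrettElement 1 * ξ.up).lam i : ℝ) : ℂ) = _
    rw [garrettElement, ofSymplectic_mul]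
    fin_cases i <;> simp [up]
  have hm : (garrettElement 1 * ξ.up).muC = ![(ξ.mu 0 : ℂ), 0] := by
    funext i
    change (((garrettElement 1 * ξ.up).mu i : ℝ) : ℂ) = _
    rw [garrettElement, ofSymplectic_mul]
    fin_cases i <;> simp [up]
  have hk : (garrettElement 1 * ξ.up).kappa = ξ.kappa := by
    rw [garrettElement, ofSymplectic_mul]; rfl
  have hs : (garrettElement 1 * ξ.up).shift x = ![x.2 0 + ξ.lam 0 * x.1 0 0 + ξ.mu 0,
      x.2 1 + ξ.lam 0 * x.1 0 1] := by
    rw [shift, hl, hm]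
    funext i
    fin_cases i <;> simp [vecMul, dotProduct]
  rw [exponent, hl, hm, hk, hs, inv_def, hdet, garrettElement_mul_up_J ξ hT,
    garrettElement_mul_up_C, adjugate_fin_two_of, Ring.inverse_eq_inv', termExponent]
  generalize delta (x.1 0 0) (x.1 0 1) (x.1 1 1) ξ.ea ξ.eb ξ.ec ξ.ed = δ at hδ
  simp [Matrix.mul_apply, mulVec, dotProduct, h10]
  field_simp
  -- The off-diagonal entries of adj(C𝒯 + D) C are 1 - cu and ad - cb - cu; the determinant relation
  -- identifies them.
  linear_combination (x.2 0 + ξ.lam 0 * x.1 0 0 + ξ.mu 0) * (x.2 1 + ξ.lam 0 * x.1 0 1) * h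

end Blocks

/-- This is the case ξ = 1 of the formulas above. Non-vanishing is assumed instead of membership in
the half-space so that it applies at translated points. -/
theorem automorphyFactor_garrettElement_one (k m : ℕ) {y : JacobiPoint 2} (hs : y.1.IsSymm)
    (hJ : ((garrettElement 1).J y.1).det ≠ 0) :
    (garrettElement 1).automorphyFactor k m y = psi k m y := by
  have hg : garrettElement 1 = garrettElement 1 * (1 : JacobiGroup 1 ℝ).up := by
    rw [up_one, mul_one]
  have ha : (1 : JacobiGroup 1 ℝ).ea = 1 := rfl
  have hb : (1 : JacobiGroup 1 ℝ).eb = 0 := rfl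
  have hc : (1 : JacobiGroup 1 ℝ).ec = 0 := rfl
  have hd : (1 : JacobiGroup 1 ℝ).ed = 1 := rfl
  have hl : (1 : JacobiGroup 1 ℝ).lam 0 = 0 := rfl
  have hm : (1 : JacobiGroup 1 ℝ).mu 0 = 0 := rfl
  have hk : (1 : JacobiGroup 1 ℝ).kappa = 0 := rfl
  have hdet := det_garrettElement_mul_up_J 1 hs
  rw [hg, hdet] at hJ
  have hδ : delta (y.1 0 0) (y.1 0 1) (y.1 1 1) (1 : ℝ) 0 0 1
      = y.1 0 0 + 2 * y.1 0 1 + y.1 1 1 := by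
    simp [delta]
  rw [hg, automorphyFactor_eq, exponent_garrettElement_mul_up 1 hs hJ, hdet, ha, hb, hc, hd, hl, hm,
    hk, termExponent, hδ, psi]
  congr 2
  simp
  ring

/-- By the cocycle relation and J_{k,m}(h_1, ·) = ψ, the terms of the Poincaré series are those of
the Eisenstein series at h_1 ξ^↑. -/
theorem slash_psi_inv (k m : ℕ) (ξ : JacobiGroup 1 ℝ) {x : JacobiPoint 2}
    (hx : x ∈ jacobiHalfSpace 2) :
    ξ.up.slash k m (fun y => (psi k m y)⁻¹) x
      = ((garrettElement 1 * ξ.up).automorphyFactor k m x)⁻¹ := by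
  have hJ := ξ.up.isUnit_det_J hx
  have hu := (garrettElement 1 * ξ.up).isUnit_det_J hx
  rw [J_mul _ _ hJ, det_mul, IsUnit.mul_iff] at hu
  rw [automorphyFactor_mul _ _ _ _ hx, _root_.mul_inv_rev, slash,
    automorphyFactor_garrettElement_one k m (isSymm_act ξ.up hx.1 hJ) hu.1.ne_zero]

/-- The terms of the Poincaré series are bounded by a power of the size of the symplectic part
times a rapidly decreasing function of the Heisenberg part. -/
theorem exists_norm_slash_psi_inv_le (j : ℕ) {m : ℕ} (hm : 1 ≤ m) {x : JacobiPoint 2}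
    (hx : x ∈ jacobiHalfSpace 2) :
    ∃ ε > 0, ∃ K > 0, ∀ ξ : JacobiGroup 1 ℝ,
      ‖ξ.up.slash (2 * j) m (fun y => (psi (2 * j) m y)⁻¹) x‖
        ≤ K * ((ξ.ea ^ 2 + ξ.eb ^ 2 + ξ.ec ^ 2 + ξ.ed ^ 2) ^ j)⁻¹
          * Real.exp (-(ε * ((ξ.lam 0 ^ 2 + ξ.mu 0 ^ 2)
            / (ξ.ea ^ 2 + ξ.eb ^ 2 + ξ.ec ^ 2 + ξ.ed ^ 2)))) := by
  obtain ⟨hp, hD⟩ := im_pos_of_mem hx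
  obtain ⟨ε, hε, K₀, hest⟩ := exists_estimate hp hD (x.2 0) (x.2 1)
  have hm' : (1 : ℝ) ≤ m := by exact_mod_cast hm
  refine ⟨2 * Real.pi * m * ε, by positivity, (ε ^ j)⁻¹ * Real.exp (2 * Real.pi * m * K₀),
    by positivity, fun ξ => ?_⟩
  obtain ⟨h1, h2⟩ := hest ξ.ea ξ.eb ξ.ec ξ.ed (ξ.lam 0) (ξ.mu 0) ξ.det_eq
  have hS : 0 < ξ.ea ^ 2 + ξ.eb ^ 2 + ξ.ec ^ 2 + ξ.ed ^ 2 := by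
    have := ξ.det_eq
    nlinarith [sq_nonneg (ξ.ea - ξ.ed), sq_nonneg (ξ.eb + ξ.ec)]
  have hu := ((garrettElement 1 * ξ.up).isUnit_det_J hx).ne_zero
  have hdet := det_garrettElement_mul_up_J ξ hx.1
  rw [hdet] at hu
  rw [slash_psi_inv _ _ _ hx, automorphyFactor_eq, hdet,
    exponent_garrettElement_mul_up ξ hx.1 hu, norm_inv, norm_mul, norm_pow, norm_expTwoPiI]
  generalize ξ.ea ^ 2 + ξ.eb ^ 2 + ξ.ec ^ 2 + ξ.ed ^ 2 = S at *
  generalize (ξ.lam 0 ^ 2 + ξ.mu 0 ^ 2) / S = X at *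
  have him : ((m : ℂ) * (-(termExponent (x.1 0 0) (x.1 0 1) (x.1 1 1) (x.2 0) (x.2 1) ξ.ea ξ.eb
      ξ.ec ξ.ed (ξ.lam 0) (ξ.mu 0)) - ((ξ.kappa + ξ.mu 0 * ξ.lam 0 : ℝ) : ℂ))).im
      = -(m * (termExponent (x.1 0 0) (x.1 0 1) (x.1 1 1) (x.2 0) (x.2 1) ξ.ea ξ.eb ξ.ec ξ.ed
        (ξ.lam 0) (ξ.mu 0)).im) := by
    rw [← Complex.ofReal_natCast, Complex.im_ofReal_mul, Complex.sub_im, Complex.ofReal_im,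
      Complex.neg_im]
    ring
  rw [him]
  generalize (termExponent (x.1 0 0) (x.1 0 1) (x.1 1 1) (x.2 0) (x.2 1) ξ.ea ξ.eb ξ.ec ξ.ed
    (ξ.lam 0) (ξ.mu 0)).im = E at *
  rw [_root_.mul_inv, ← Real.exp_neg, pow_mul]
  have e1 : ((‖delta (x.1 0 0) (x.1 0 1) (x.1 1 1) ξ.ea ξ.eb ξ.ec ξ.ed‖ ^ 2) ^ j)⁻¹
      ≤ (ε ^ j)⁻¹ * (S ^ j)⁻¹ := by
    rw [← _root_.mul_inv, ← mul_pow]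
    gcongr
  have e2 : Real.exp (-(-(2 * Real.pi * -(m * E))))
      ≤ Real.exp (2 * Real.pi * m * K₀) * Real.exp (-(2 * Real.pi * m * ε * X)) := by
    rw [← Real.exp_add, Real.exp_le_exp]
    have := mul_le_mul_of_nonneg_left h2 (show 0 ≤ 2 * Real.pi * m by positivity)
    linarith
  calc _ ≤ ((ε ^ j)⁻¹ * (S ^ j)⁻¹)
        * (Real.exp (2 * Real.pi * m * K₀) * Real.exp (-(2 * Real.pi * m * ε * X))) := by
        gcongr
    _ = _ := by ring

end JacobiGroup

/-! ### Summability -/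

/-- The weight `(1 + n²)^(-7/12)`, which is summable over the integers. -/
def weight (n : ℤ) : ℝ := (1 + (n : ℝ) ^ 2) ^ (-(7 / 12) : ℝ)

theorem weight_pos (n : ℤ) : 0 < weight n := Real.rpow_pos_of_pos (by positivity) _

theorem summable_weight : Summable weight := by
  have h : Summable fun n : ℤ => |(n : ℝ)| ^ (-(7 / 6) : ℝ) :=
    Real.summable_abs_int_rpow (by norm_num)
  refine Summable.of_norm_bounded_eventually h ?_
  filter_upwards [(Set.finite_singleton (0 : ℤ)).compl_mem_cofinite] with n hn
  have hn0 : (0 : ℝ) < |(n : ℝ)| := abs_pos.2 (by exact_mod_cast hn)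
  rw [Real.norm_of_nonneg (weight_pos n).le, weight]
  have e : |(n : ℝ)| ^ (-(7 / 6) : ℝ) = ((n : ℝ) ^ 2) ^ (-(7 / 12) : ℝ) := by
    rw [← sq_abs, ← Real.rpow_natCast, ← Real.rpow_mul hn0.le]
    norm_num
  rw [e]
  refine Real.rpow_le_rpow_of_nonpos ?_ (by linarith) (by norm_num)
  rw [← sq_abs]
  positivity

/-- The slack 4 allows for integral parts: 1 + (|t| + 1)² ≤ 4(1 + t²). -/
theorem rpow_le_weight {A : ℝ} (n : ℤ) (h : 1 + (n : ℝ) ^ 2 ≤ 4 * A) :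
    A ^ (-(7 / 12) : ℝ) ≤ 4 * weight n := by
  have h1 : A ^ (-(7 / 12) : ℝ) ≤ ((1 + (n : ℝ) ^ 2) / 4) ^ (-(7 / 12) : ℝ) :=
    Real.rpow_le_rpow_of_nonpos (by positivity) (by linarith) (by norm_num)
  refine h1.trans ?_
  rw [div_eq_inv_mul, Real.mul_rpow (by norm_num) (by positivity), ← weight]
  refine mul_le_mul_of_nonneg_right ?_ (weight_pos n).le
  rw [Real.inv_rpow (by norm_num), Real.rpow_neg (by norm_num), inv_inv]
  calc (4 : ℝ) ^ (7 / 12 : ℝ) ≤ 4 ^ (1 : ℝ) :=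
        Real.rpow_le_rpow_of_exponent_le (by norm_num) (by norm_num)
    _ = 4 := Real.rpow_one 4

/-- The index set for the comparison series. -/
abbrev WeightIndex : Type := Bool × (ℤ × ℤ × ℤ) × (ℤ × ℤ) × (ℤ × ℤ)

/-- The product of the weights of seven integers. -/
def totalWeight (p : WeightIndex) : ℝ :=
  1 * ((weight p.2.1.1 * (weight p.2.1.2.1 * weight p.2.1.2.2))
    * ((weight p.2.2.1.1 * weight p.2.2.1.2) * (weight p.2.2.2.1 * weight p.2.2.2.2)))

theorem summable_totalWeight : Summable totalWeight := by
  have h0 := summable_weight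
  have n0 : 0 ≤ weight := fun n => (weight_pos n).le
  have h2 := h0.mul_of_nonneg h0 n0 n0
  have n2 : (0 : ℤ × ℤ → ℝ) ≤ fun x => weight x.1 * weight x.2 :=
    fun x => mul_nonneg (n0 _) (n0 _)
  have h3 := h0.mul_of_nonneg h2 n0 n2
  have n3 : (0 : ℤ × ℤ × ℤ → ℝ) ≤ fun x => weight x.1 * (weight x.2.1 * weight x.2.2) :=
    fun x => mul_nonneg (n0 _) (n2 _)
  have h4 := h2.mul_of_nonneg h2 n2 n2
  have n4 : (0 : (ℤ × ℤ) × (ℤ × ℤ) → ℝ) ≤ fun x => (weight x.1.1 * weight x.1.2)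
      * (weight x.2.1 * weight x.2.2) := fun x => mul_nonneg (n2 _) (n2 _)
  have h5 := h3.mul_of_nonneg h4 n3 n4
  have n5 := fun x : (ℤ × ℤ × ℤ) × (ℤ × ℤ) × (ℤ × ℤ) => mul_nonneg (n3 x.1) (n4 x.2)
  have hb : Summable fun _ : Bool => (1 : ℝ) := Summable.of_finite
  exact hb.mul_of_nonneg h5 (fun _ => zero_le_one) n5

theorem exists_exp_neg_le {ε : ℝ} (hε : 0 < ε) :
    ∃ K > 0, ∀ X : ℝ, 0 ≤ X →
      Real.exp (-(ε * X)) ≤ K * ((1 + X) ^ (-(7 / 12) : ℝ)) ^ 2 := by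
  refine ⟨2 + 4 / ε ^ 2, by positivity, fun X hX => ?_⟩
  have h1 : (1 + X) ^ 2 ≤ (2 + 4 / ε ^ 2) * Real.exp (ε * X) := by
    have hY : 0 ≤ ε * X := by positivity
    have e1 := Real.quadratic_le_exp_of_nonneg hY
    have e2 : 1 ≤ Real.exp (ε * X) := Real.one_le_exp hY
    have e3 : X ^ 2 = (ε * X) ^ 2 / ε ^ 2 := by field_simp
    have e4 : X ^ 2 ≤ 2 / ε ^ 2 * Real.exp (ε * X) := by
      rw [e3, div_mul_eq_mul_div]
      gcongr
      nlinarith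
    have e5 : (2 + 4 / ε ^ 2) * Real.exp (ε * X)
        = 2 * Real.exp (ε * X) + 2 * (2 / ε ^ 2 * Real.exp (ε * X)) := by ring
    rw [e5]
    nlinarith [sq_nonneg (X - 1)]
  have h2 : ((1 + X) ^ 2)⁻¹ ≤ ((1 + X) ^ (-(7 / 12) : ℝ)) ^ 2 := by
    rw [← Real.rpow_natCast, ← Real.rpow_natCast, ← Real.rpow_mul (by positivity),
      ← Real.rpow_neg (by positivity)]
    exact Real.rpow_le_rpow_of_exponent_le (by linarith) (by norm_num)
  rw [Real.exp_neg]
  calc (Real.exp (ε * X))⁻¹ ≤ (2 + 4 / ε ^ 2) * ((1 + X) ^ 2)⁻¹ := by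
        rw [inv_le_iff_one_le_mul₀ (Real.exp_pos _), mul_assoc, ← div_eq_inv_mul, ← mul_div_assoc,
          le_div_iff₀ (by positivity), one_mul]
        exact h1
    _ ≤ _ := by gcongr

/-- Numerical comparison with the weights. -/
theorem mul_exp_le_totalWeight {ε : ℝ} (hε : 0 < ε) : ∃ K > 0, ∀ (j : ℕ) (β : Bool)
    (n₁ n₂ n₃ d y q₁ q₂ : ℤ) (V l m : ℝ), 3 ≤ j → 1 ≤ d → 0 ≤ y → y ≤ d → (d : ℝ) ^ 2 ≤ V →
      (n₁ : ℝ) ^ 2 ≤ V → (n₂ : ℝ) ^ 2 ≤ V → (n₃ : ℝ) ^ 2 ≤ V → |(q₁ : ℝ)| ≤ |l| + 1 →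
      |(q₂ : ℝ)| ≤ |m| + 1 →
      (V ^ j)⁻¹ * Real.exp (-(ε * ((l ^ 2 + m ^ 2) / (V / d ^ 2))))
        ≤ K * totalWeight (β, (n₁, n₂, n₃), (d, y), (q₁, q₂)) := by
  obtain ⟨K, hK, hexp⟩ := exists_exp_neg_le hε
  refine ⟨K * 4 ^ 7, by positivity, ?_⟩
  intro j β n₁ n₂ n₃ d y q₁ q₂ V l m hj hd hy hyd hdV h1 h2 h3 hq1 hq2
  have hd' : (1 : ℝ) ≤ d := by exact_mod_cast hd
  have hy' : (0 : ℝ) ≤ y := by exact_mod_cast hy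
  have hyd' : (y : ℝ) ≤ d := by exact_mod_cast hyd
  have hd2 : (1 : ℝ) ≤ (d : ℝ) ^ 2 := one_le_pow₀ hd'
  have hV : 1 ≤ V := hd2.trans hdV
  have hV0 : 0 < V := by linarith
  have hd0 : (0 : ℝ) < (d : ℝ) ^ 2 := by linarith
  have hr : 0 < 1 + (l ^ 2 + m ^ 2) := by positivity
  -- The exponent must exceed 1/2 in absolute value for summability of the weights, and five times
  -- it must not exceed 3 ≤ j.
  set s : ℝ := -(7 / 12) with hs
  set X := (l ^ 2 + m ^ 2) / (V / d ^ 2) with hX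
  have hX0 : 0 ≤ X := by positivity
  -- As d² ≤ V, one has 1 + X ≥ (1 + l² + m²) d² / V.
  have p1 : (1 + X) ^ s ≤ (1 + (l ^ 2 + m ^ 2)) ^ s * ((d : ℝ) ^ 2) ^ s / V ^ s := by
    rw [← Real.mul_rpow hr.le hd0.le, ← Real.div_rpow (by positivity) hV0.le]
    refine Real.rpow_le_rpow_of_nonpos (by positivity) ?_ (by norm_num [hs])
    rw [hX, div_div_eq_mul_div, div_le_iff₀ hV0]
    have e : (1 + (l ^ 2 + m ^ 2) * (d : ℝ) ^ 2 / V) * V = V + (l ^ 2 + m ^ 2) * (d : ℝ) ^ 2 := by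
      field_simp
    rw [e]
    linarith
  have p2 : (V ^ j)⁻¹ ≤ (V ^ s) ^ 5 := by
    rw [← Real.rpow_natCast V j, ← Real.rpow_natCast (V ^ s), ← Real.rpow_mul hV0.le,
      ← Real.rpow_neg hV0.le]
    refine Real.rpow_le_rpow_of_exponent_le hV ?_
    have : (3 : ℝ) ≤ j := by exact_mod_cast hj
    rw [hs]
    norm_num
    linarith
  have hVs : 0 < V ^ s := Real.rpow_pos_of_pos hV0 _
  have hq : ∀ (q : ℤ) (t r : ℝ), |(q : ℝ)| ≤ |t| + 1 → t ^ 2 ≤ r → 1 + (q : ℝ) ^ 2 ≤ 4 * (1 + r) := by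
    intro q t r hq hr
    have := pow_le_pow_left₀ (abs_nonneg _) hq 2
    rw [sq_abs] at this
    nlinarith [sq_abs t, sq_nonneg (|t| - 1)]
  have w1 := rpow_le_weight (A := V) n₁ (by linarith)
  have w2 := rpow_le_weight (A := V) n₂ (by linarith)
  have w3 := rpow_le_weight (A := V) n₃ (by linarith)
  have w4 := rpow_le_weight (A := (d : ℝ) ^ 2) d (by linarith)
  have w5 := rpow_le_weight (A := (d : ℝ) ^ 2) y (by nlinarith)
  have w6 := rpow_le_weight (A := 1 + (l ^ 2 + m ^ 2)) q₁ (hq q₁ l (l ^ 2 + m ^ 2) hq1 (by nlinarith [sq_nonneg m]))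
  have w7 := rpow_le_weight (A := 1 + (l ^ 2 + m ^ 2)) q₂ (hq q₂ m (l ^ 2 + m ^ 2) hq2 (by nlinarith [sq_nonneg l]))
  rw [← hs] at w1 w2 w3 w4 w5 w6 w7
  have hd2s : 0 < ((d : ℝ) ^ 2) ^ s := Real.rpow_pos_of_pos hd0 _
  have hrs : 0 < (1 + (l ^ 2 + m ^ 2)) ^ s := Real.rpow_pos_of_pos hr _
  have h1X : 0 < (1 + X) ^ s := Real.rpow_pos_of_pos (by positivity) _
  calc (V ^ j)⁻¹ * Real.exp (-(ε * X))
      ≤ (V ^ s) ^ 5 * (K * ((1 + (l ^ 2 + m ^ 2)) ^ s * ((d : ℝ) ^ 2) ^ s / V ^ s) ^ 2) := by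
        refine mul_le_mul p2 ((hexp X hX0).trans ?_) (Real.exp_pos _).le (by positivity)
        gcongr
    -- Of the five factors V^s two are spent on the exponential. The remaining three serve the
    -- matrix entries, the two powers of d² serve d and y, and the last two serve the integral
    -- parts.
    _ = K * ((V ^ s * (V ^ s * V ^ s)) * ((((d : ℝ) ^ 2) ^ s * ((d : ℝ) ^ 2) ^ s)
          * ((1 + (l ^ 2 + m ^ 2)) ^ s * (1 + (l ^ 2 + m ^ 2)) ^ s))) := by
        field_simp
    _ ≤ K * (((4 * weight n₁) * ((4 * weight n₂) * (4 * weight n₃))) * (((4 * weight d)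
          * (4 * weight y)) * ((4 * weight q₁) * (4 * weight q₂)))) := by
        have g1 := weight_pos n₁
        have g2 := weight_pos n₂
        have g3 := weight_pos n₃
        have g4 := weight_pos d
        have g5 := weight_pos y
        have g6 := weight_pos q₁
        have g7 := weight_pos q₂
        gcongr
    _ = _ := by
        simp only [totalWeight]
        ring

/-! ### Heisenberg parts modulo integral vectors -/

namespace JacobiGroup

/-- The Heisenberg parts of the elements of `𝕏(d)` with given symplectic part lie in at most `d`
classes modulo integral vectors. -/
theorem exists_row_classes (d : ℕ+) (g : symplecticGroup (Fin 1) ℝ) : ∃ b : ℝ × ℝ,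
    ∀ ξ ∈ heckeDoubleCoset d, ξ.g = g → ∃ y : ℤ, 0 ≤ y ∧ y ≤ (d : ℤ) ∧
      ξ.lam 0 - y * b.1 ∈ realIntegers ∧ ξ.mu 0 - y * b.2 ∈ realIntegers := by
  by_cases hne : ∃ ξ₀ ∈ heckeDoubleCoset d, ξ₀.g = g
  swap
  · exact ⟨0, fun ξ hξ h => (hne ⟨ξ, hξ, h⟩).elim⟩
  obtain ⟨ξ₀, hξ₀, rfl⟩ := hne
  obtain ⟨α₀, hα₀, β₀, hβ₀, rfl⟩ := mem_heckeDoubleCoset_iff.1 hξ₀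
  have hd : (d : ℝ) ≠ 0 := by exact_mod_cast d.ne_zero
  refine ⟨(β₀.ec / d, β₀.ed / d), fun ξ hξ hg => ?_⟩
  obtain ⟨α, hα, β, hβ, rfl⟩ := mem_heckeDoubleCoset_iff.1 hξ
  have hσ := mul_mem (inv_mem hα) hα₀
  set σ := α⁻¹ * α₀
  have hg' : (diagElement d * β).g = (σ * diagElement d * β₀).g := by
    have : (α⁻¹ * (α * diagElement d * β)).g = (α⁻¹ * (α₀ * diagElement d * β₀)).g := by
      rw [mul_g, hg, ← mul_g]
    rw [← mul_assoc, ← mul_assoc, inv_mul_cancel, one_mul, ← mul_assoc, ← mul_assoc] at this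
    exact this
  have da : (diagElement d).ea = d := rfl
  have db : (diagElement d).eb = 0 := rfl
  have dc : (diagElement d).ec = 0 := rfl
  have dd : (diagElement d).ed = (d : ℝ)⁻¹ := rfl
  have dl : (diagElement d).lam 0 = 0 := rfl
  have dm : (diagElement d).mu 0 = 0 := rfl
  have hlam : (α * diagElement d * β).lam 0 = α.lam 0 * (diagElement d * β).ea
      + α.mu 0 * (diagElement d * β).ec + β.lam 0 := by
    simp only [mul_lam₁, mul_ea, mul_ec, mul_mu₁, dl, dm]
    ring
  have hmu : (α * diagElement d * β).mu 0 = α.lam 0 * (diagElement d * β).eb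
      + α.mu 0 * (diagElement d * β).ed + β.mu 0 := by
    simp only [mul_lam₁, mul_mu₁, mul_eb, mul_ed, dl, dm]
    ring
  have ha : (diagElement d * β).ea = (σ * diagElement d * β₀).ea := by rw [ea, hg']
  have hb : (diagElement d * β).eb = (σ * diagElement d * β₀).eb := by rw [eb, hg']
  have hc : (diagElement d * β).ec = (σ * diagElement d * β₀).ec := by rw [ec, hg']
  have hd' : (diagElement d * β).ed = (σ * diagElement d * β₀).ed := by rw [ed, hg']
  obtain ⟨⟨sa, hsa⟩, ⟨sb, hsb⟩, ⟨sc, hsc⟩, ⟨sd, hsd⟩⟩ := (mem_jacobiModularGroup_one_iff.1 hσ).1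
  obtain ⟨-, ⟨l, hl⟩, ⟨m, hm⟩, -⟩ := mem_jacobiModularGroup_one_iff.1 hα
  obtain ⟨⟨⟨ba, hba⟩, ⟨bb, hbb⟩, ⟨bc, hbc⟩, ⟨bd, hbd⟩⟩, -⟩ := mem_jacobiModularGroup_one_iff.1 hβ₀
  obtain ⟨-, ⟨l', hl'⟩, ⟨m', hm'⟩, -⟩ := mem_jacobiModularGroup_one_iff.1 hβ
  -- Up to integers, (λ, μ) of ξ is (l, m) σ diag(d, d⁻¹) β₀. The first coordinate of (l, m)σ is
  -- multiplied by d and stays integral; the second, Y, is divided by d, so only Y mod d matters.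
  set Y := l * sb + m * sd with hY
  have hdZ : (0 : ℤ) < d := by exact_mod_cast d.pos
  have hYd : (Y : ℝ) = (Y % (d : ℤ) : ℤ) + d * (Y / (d : ℤ) : ℤ) := by
    exact_mod_cast (Int.emod_add_mul_ediv Y (d : ℤ)).symm
  have hY' : (Y : ℝ) = l * sb + m * sd := by rw [hY]; push_cast; ring
  refine ⟨Y % (d : ℤ), Int.emod_nonneg _ hdZ.ne', (Int.emod_lt_of_pos _ hdZ).le,
    ⟨(l * sa + m * sc) * d * ba + (Y / (d : ℤ)) * bc + l', ?_⟩,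
    ⟨(l * sa + m * sc) * d * bb + (Y / (d : ℤ)) * bd + m', ?_⟩⟩
  · rw [hlam, ha, hc]
    simp only [mul_ea, mul_eb, mul_ec, mul_ed, da, db, dc, dd, ← hsa, ← hsb, ← hsc, ← hsd, ← hl,
      ← hm, ← hba, ← hbc, ← hl']
    simp only [eq_intCast]
    push_cast
    rw [eq_sub_of_add_eq hYd.symm, hY']
    field_simp
    ring
  · rw [hmu, hb, hd']
    simp only [mul_ea, mul_eb, mul_ec, mul_ed, da, db, dc, dd, ← hsa, ← hsb, ← hsc, ← hsd, ← hl,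
      ← hm, ← hbb, ← hbd, ← hm']
    simp only [eq_intCast]
    push_cast
    rw [eq_sub_of_add_eq hYd.symm, hY']
    field_simp
    ring

/-- Two elements of `𝕏(d)` with the same symplectic part, the same class and the same integral parts
have the same Heisenberg vector. -/
theorem eq_of_floor_eq {l l' b : ℝ} {y : ℤ} (h : l - y * b ∈ realIntegers)
    (h' : l' - y * b ∈ realIntegers) (hf : ⌊l⌋ = ⌊l'⌋) : l = l' := by
  obtain ⟨z, hz⟩ := h
  obtain ⟨z', hz'⟩ := h'
  simp only [eq_intCast] at hz hz'
  have e : l = l' + ((z - z' : ℤ) : ℝ) := by push_cast; linarith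
  rw [e, Int.floor_add_intCast] at hf
  have : z - z' = 0 := by omega
  rw [e, this]
  simp

end JacobiGroup

/-! ### Absolute convergence of the full family -/

open JacobiGroup in
/-- Absolute convergence of the series of all the terms `ψ⁻¹ | ξ` with `ξ ∈ ⋃ 𝕏(d)`. -/
theorem summable_slash_psi_inv {ι : Type*} (δ : ι → ℕ+) (Ξ : ι → JacobiGroup 1 ℝ)
    (hΞ : ∀ i, Ξ i ∈ heckeDoubleCoset (δ i))
    (hinj : ∀ i i', δ i = δ i' → (Ξ i).g = (Ξ i').g → (Ξ i).lam 0 = (Ξ i').lam 0 →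
      (Ξ i).mu 0 = (Ξ i').mu 0 → i = i')
    {k m : ℕ} (hk : 4 < k) (hk2 : Even k) (hm : 1 ≤ m) {x : JacobiPoint 2}
    (hx : x ∈ jacobiHalfSpace 2) :
    Summable fun i => ((δ i : ℂ) ^ k)⁻¹ * (Ξ i).up.slash k m (fun y => (psi k m y)⁻¹) x := by
  obtain ⟨j, rfl⟩ := hk2
  rw [← two_mul] at *
  obtain ⟨ε, hε, K, hK, hT⟩ := exists_norm_slash_psi_inv_le j hm hx
  obtain ⟨K', hK', hW⟩ := mul_exp_le_totalWeight hε
  have hint := fun i => integralMul_of_mem_heckeDoubleCoset (hΞ i)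
  choose na hna using fun i => (hint i).1
  choose nb hnb using fun i => (hint i).2.1
  choose nc hnc using fun i => (hint i).2.2.1
  choose nd hnd using fun i => (hint i).2.2.2
  simp only [eq_intCast] at hna hnb hnc hnd
  choose b hb using exists_row_classes
  choose y hy0 hyd hyl hym using fun i => hb (δ i) (Ξ i).g (Ξ i) (hΞ i) rfl
  have hdpos : ∀ i, (0 : ℝ) < δ i := fun i => by exact_mod_cast (δ i).pos
  have hdet : ∀ i, na i * nd i - nc i * nb i = (δ i : ℤ) ^ 2 := by
    intro i
    have h := (Ξ i).det_eq
    have : (na i * nd i - nc i * nb i : ℝ) = (δ i : ℝ) ^ 2 := by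
      rw [hna, hnb, hnc, hnd]
      linear_combination (δ i : ℝ) ^ 2 * h
    exact_mod_cast this
  -- Three entries of dξ suffice, since its determinant d² gives the fourth. The third one recorded
  -- is c or d' according to whether b vanishes, so that the entry solved for has a nonzero
  -- coefficient.
  set Φ : ι → WeightIndex := fun i => (decide (nb i = 0),
    (na i, nb i, if nb i = 0 then nc i else nd i), ((δ i : ℤ), y i),
    (⌊(Ξ i).lam 0⌋, ⌊(Ξ i).mu 0⌋)) with hΦ
  have hΦinj : Function.Injective Φ := by
    intro i i' h
    simp only [hΦ, Prod.mk.injEq] at h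
    obtain ⟨-, ⟨ha, hb', hcd⟩, ⟨hδ, hyy⟩, hfl, hfm⟩ := h
    have hδ' : δ i = δ i' := PNat.coe_injective (by exact_mod_cast hδ)
    have h1 := hdet i
    have h2 := hdet i'
    have hdZ : (0 : ℤ) < (δ i' : ℤ) ^ 2 := by
      have : (0 : ℤ) < δ i' := by exact_mod_cast (δ i').pos
      positivity
    rw [ha, hb', hδ, ← h2] at h1
    have hcc : nc i = nc i' ∧ nd i = nd i' := by
      by_cases h0 : nb i' = 0
      · rw [hb', if_pos h0, if_pos h0] at hcd
        refine ⟨hcd, ?_⟩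
        have hane : na i' ≠ 0 := by
          intro h00
          rw [h00, h0] at h2
          simp at h2
          omega
        rw [hcd] at h1
        exact mul_left_cancel₀ hane (by linarith)
      · rw [hb', if_neg h0, if_neg h0] at hcd
        refine ⟨?_, hcd⟩
        rw [hcd] at h1
        exact mul_right_cancel₀ h0 (by linarith)
    have hdi := (hdpos i').ne'
    have hg : (Ξ i).g = (Ξ i').g := by
      have ea' : (Ξ i).ea = (Ξ i').ea := mul_left_cancel₀ hdi (by
        rw [← hna i', ← ha, hna i, hδ'])
      have eb' : (Ξ i).eb = (Ξ i').eb := mul_left_cancel₀ hdi (by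
        rw [← hnb i', ← hb', hnb i, hδ'])
      have ec' : (Ξ i).ec = (Ξ i').ec := mul_left_cancel₀ hdi (by
        rw [← hnc i', ← hcc.1, hnc i, hδ'])
      have ed' : (Ξ i).ed = (Ξ i').ed := mul_left_cancel₀ hdi (by
        rw [← hnd i', ← hcc.2, hnd i, hδ'])
      refine Subtype.ext ?_
      ext r s
      rcases r with r | r <;> rcases s with s | s <;> fin_cases r <;> fin_cases s <;> assumption
    have l1 := hyl i
    have m1 := hym i
    rw [hδ', hg, hyy] at l1 m1
    exact hinj i i' hδ' hg (eq_of_floor_eq l1 (hyl i') hfl) (eq_of_floor_eq m1 (hym i') hfm)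
  have hsum := (summable_totalWeight.comp_injective hΦinj).mul_left (K * K')
  refine Summable.of_norm_bounded hsum fun i => ?_
  have hT' := hT (Ξ i)
  set S := (Ξ i).ea ^ 2 + (Ξ i).eb ^ 2 + (Ξ i).ec ^ 2 + (Ξ i).ed ^ 2 with hS
  -- V is the sum of squares of the integral entries of dξ, so d^{-2j} S^{-j} = V^{-j} and S = V /
  -- d².
  set V := (δ i : ℝ) ^ 2 * S with hV
  have hVn : V = (na i : ℝ) ^ 2 + (nb i : ℝ) ^ 2 + (nc i : ℝ) ^ 2 + (nd i : ℝ) ^ 2 := by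
    rw [hna, hnb, hnc, hnd, hV, hS]; ring
  have hS1 : 1 ≤ S := by
    have := (Ξ i).det_eq
    nlinarith [sq_nonneg ((Ξ i).ea - (Ξ i).ed), sq_nonneg ((Ξ i).eb + (Ξ i).ec)]
  have hSV : V / (δ i : ℝ) ^ 2 = S := by
    rw [hV, mul_div_cancel_left₀ _ (pow_ne_zero 2 (hdpos i).ne')]
  have hfloor : ∀ t : ℝ, |((⌊t⌋ : ℤ) : ℝ)| ≤ |t| + 1 := by
    intro t
    rw [abs_le]
    constructor
    · linarith [Int.lt_floor_add_one t, neg_abs_le t]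
    · linarith [Int.floor_le t, le_abs_self t]
  have hmain := hW j (decide (nb i = 0)) (na i) (nb i) (if nb i = 0 then nc i else nd i) (δ i)
    (y i) ⌊(Ξ i).lam 0⌋ ⌊(Ξ i).mu 0⌋ V ((Ξ i).lam 0) ((Ξ i).mu 0) (by omega)
    (by exact_mod_cast (δ i).pos) (hy0 i) (hyd i)
    (by
      push_cast
      exact le_mul_of_one_le_right (by positivity) hS1)
    (by rw [hVn]; nlinarith [sq_nonneg (nb i : ℝ), sq_nonneg (nc i : ℝ), sq_nonneg (nd i : ℝ)])
    (by rw [hVn]; nlinarith [sq_nonneg (na i : ℝ), sq_nonneg (nc i : ℝ), sq_nonneg (nd i : ℝ)])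
    (by
      rw [hVn]
      split_ifs <;> nlinarith [sq_nonneg (na i : ℝ), sq_nonneg (nb i : ℝ), sq_nonneg (nc i : ℝ),
        sq_nonneg (nd i : ℝ)])
    (hfloor _) (hfloor _)
  have hcast : (((δ i : ℕ) : ℤ) : ℝ) = (δ i : ℝ) := by push_cast; rfl
  rw [hcast, hSV] at hmain
  have hnorm : ‖(((δ i : ℕ) : ℂ) ^ (2 * j))⁻¹‖ = (((δ i : ℝ) ^ 2) ^ j)⁻¹ := by
    rw [norm_inv, norm_pow, Complex.norm_natCast, pow_mul]
  rw [norm_mul, hnorm]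
  calc _ ≤ (((δ i : ℝ) ^ 2) ^ j)⁻¹ * (K * (S ^ j)⁻¹
        * Real.exp (-(ε * (((Ξ i).lam 0 ^ 2 + (Ξ i).mu 0 ^ 2) / S)))) := by gcongr
    _ = K * ((V ^ j)⁻¹ * Real.exp (-(ε * (((Ξ i).lam 0 ^ 2 + (Ξ i).mu 0 ^ 2) / S)))) := by
        rw [hV, mul_pow, mul_inv]
        ring
    _ ≤ K * (K' * totalWeight (Φ i)) := by gcongr
    _ = _ := by rw [mul_assoc]; rfl

theorem IsCosetReps.eq_of_eq_mul {G : Type} [Group G] {H S R : Set G} (h : IsCosetReps H S R)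
    (h1 : (1 : G) ∈ H) {r r' : G} (hr : r ∈ R) (hr' : r' ∈ R) {p : G} (hp : p ∈ H)
    (e : r = p * r') : r = r' :=
  (h.2 r (h.1 hr)).unique ⟨hr, 1, h1, (one_mul r).symm⟩ ⟨hr', p, hp, e⟩

/-! ### Finiteness of Γ^J \ 𝕏(d) -/

namespace JacobiGroup

instance {n : ℕ} {R : Type} [CommRing R] [Finite R] : Finite (JacobiGroup n R) :=
  Finite.of_injective
    (fun x : JacobiGroup n R => ((x.g.1, x.lam, x.mu, x.kappa) :
      Matrix (Fin n ⊕ Fin n) (Fin n ⊕ Fin n) R × (Fin n → R) × (Fin n → R) × R))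
    fun x y h => by
      simp only [Prod.mk.injEq] at h
      exact JacobiGroup.ext (Subtype.ext h.1) h.2.1 h.2.2.1 h.2.2.2

/-- Elements of `Γ^J` congruent to `1` modulo `d²` are conjugated into `Γ^J` by `diag(d, d⁻¹)`. -/
theorem exists_diagElement_mul_eq (d : ℕ+) {σ : JacobiGroup 1 ℤ}
    (hσ : map (Int.castRingHom (ZMod ((d : ℕ) ^ 2))) σ = 1) :
    ∃ γ ∈ jacobiModularGroup 1, diagElement d * map (Int.castRingHom ℝ) σ = γ * diagElement d := by
  have hd : (d : ℝ) ≠ 0 := by exact_mod_cast d.ne_zero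
  have hc : ((σ.ec : ℤ) : ZMod ((d : ℕ) ^ 2)) = 0 := congrArg ec hσ
  have hl : ((σ.lam 0 : ℤ) : ZMod ((d : ℕ) ^ 2)) = 0 := congrArg (fun x => x.lam 0) hσ
  rw [ZMod.intCast_zmod_eq_zero_iff_dvd] at hc hl
  obtain ⟨c, hc⟩ := hc
  obtain ⟨l, hl⟩ := hl
  push_cast at hc hl
  have hdet : (σ.ea : ℝ) * σ.ed - c * ((d : ℝ) ^ 2 * σ.eb) = 1 := by
    have h := σ.det_eq
    rw [hc] at h
    have h' : ((σ.ea : ℤ) : ℝ) * σ.ed - (d : ℝ) ^ 2 * c * σ.eb = 1 := by exact_mod_cast h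
    linear_combination h'
  have da : (diagElement d).ea = d := rfl
  have db : (diagElement d).eb = 0 := rfl
  have dc : (diagElement d).ec = 0 := rfl
  have dd : (diagElement d).ed = (d : ℝ)⁻¹ := rfl
  have dl : (diagElement d).lam 0 = 0 := rfl
  have dm : (diagElement d).mu 0 = 0 := rfl
  have dk : (diagElement d).kappa = 0 := rfl
  set s := map (Int.castRingHom ℝ) σ with hs
  have sa : s.ea = σ.ea := rfl
  have sb : s.eb = σ.eb := rfl
  have sc : s.ec = (d : ℝ) ^ 2 * c := by
    have : s.ec = ((σ.ec : ℤ) : ℝ) := rfl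
    rw [this, hc]; push_cast; ring
  have sd : s.ed = σ.ed := rfl
  have sl : s.lam 0 = (d : ℝ) ^ 2 * l := by
    have : s.lam 0 = ((σ.lam 0 : ℤ) : ℝ) := rfl
    rw [this, hl]; push_cast; ring
  have sm : s.mu 0 = ((σ.mu 0 : ℤ) : ℝ) := rfl
  have sk : s.kappa = ((σ.kappa : ℤ) : ℝ) := rfl
  -- Conjugation by diag(d, d⁻¹) multiplies b by d² and μ by d, and divides c by d² and λ by d.
  set γ := mk₁ (σ.ea : ℝ) ((d : ℝ) ^ 2 * σ.eb) c σ.ed (d * l) (d * σ.mu 0) σ.kappa hdet with hγ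
  have ga : γ.ea = σ.ea := rfl
  have gb : γ.eb = (d : ℝ) ^ 2 * σ.eb := rfl
  have gc : γ.ec = c := rfl
  have gd : γ.ed = σ.ed := rfl
  have gl : γ.lam 0 = d * l := rfl
  have gm : γ.mu 0 = d * σ.mu 0 := rfl
  have gk : γ.kappa = σ.kappa := rfl
  have hz := intCast_mem_realIntegers
  have hdz : (d : ℝ) ∈ realIntegers := by exact_mod_cast hz d
  refine ⟨γ, mem_jacobiModularGroup_one_iff.2 ⟨⟨hz _, mul_mem (pow_mem hdz 2) (hz _), hz _, hz _⟩,
    mul_mem hdz (hz _), mul_mem hdz (hz _), hz _⟩, ?_⟩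
  apply ext₁ <;>
    simp only [mul_ea, mul_eb, mul_ec, mul_ed, mul_lam₁, mul_mu₁, mul_kappa₁, da, db, dc, dd, dl,
      dm, dk, sa, sb, sc, sd, sl, sm, sk, ga, gb, gc, gd, gl, gm, gk] <;>
    field_simp <;> ring

/-- The coset of α diag(d, d⁻¹) β depends only on β modulo d², and the Jacobi group over a finite
ring is finite. -/
theorem finite_cosetReps_heckeDoubleCoset {d : ℕ+} {R : Set (JacobiGroup 1 ℝ)}
    (hR : IsCosetReps (jacobiModularGroup 1 : Set (JacobiGroup 1 ℝ)) (heckeDoubleCoset d) R) :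
    R.Finite := by
  have hN : NeZero ((d : ℕ) ^ 2) := ⟨pow_ne_zero 2 d.ne_zero⟩
  have h : ∀ r : R, ∃ α ∈ jacobiModularGroup 1, ∃ β : JacobiGroup 1 ℤ,
      (r : JacobiGroup 1 ℝ) = α * diagElement d * map (Int.castRingHom ℝ) β := by
    intro r
    obtain ⟨α, hα, β, ⟨β₀, rfl⟩, h⟩ := mem_heckeDoubleCoset_iff.1 (hR.1 r.2)
    exact ⟨α, hα, β₀, h⟩
  choose α hα β hβ using h
  refine Set.finite_coe_iff.1 (Finite.of_injective
    (fun r => map (Int.castRingHom (ZMod ((d : ℕ) ^ 2))) (β r)) fun r r' h => Subtype.ext ?_)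
  have hσ : map (Int.castRingHom (ZMod ((d : ℕ) ^ 2))) (β r * (β r')⁻¹) = 1 := by
    rw [map_mul, map_inv, mul_inv_eq_one]
    exact h
  obtain ⟨γ, hγ, e⟩ := exists_diagElement_mul_eq d hσ
  rw [map_mul, map_inv] at e
  refine hR.eq_of_eq_mul (one_mem _) r.2 r'.2 (mul_mem (mul_mem (hα r) hγ) (inv_mem (hα r'))) ?_
  calc (r : JacobiGroup 1 ℝ)
      = α r * (diagElement d * (map (Int.castRingHom ℝ) (β r)
          * (map (Int.castRingHom ℝ) (β r'))⁻¹)) * map (Int.castRingHom ℝ) (β r') := by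
        rw [hβ r]; group
    _ = α r * (γ * diagElement d) * map (Int.castRingHom ℝ) (β r') := by rw [e]
    _ = _ := by rw [hβ r']; group

end JacobiGroup

/-! ### Indexing the cosets of the cell -/

namespace JacobiGroup

theorem isParabolicOfNorm_one_of_mem {p : JacobiGroup 2 ℝ} (hp : p ∈ jacobiModularGroup 2)
    (hp' : p ∈ siegelJacobi 2) : IsParabolicOfNorm 1 p := by
  have hint : ∀ q ∈ jacobiModularGroup 2, q.detD ∈ realIntegers := by
    intro q hq
    have h := mem_siegelModularGroup_iff.1 (mem_jacobiModularGroup_iff.1 hq).1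
    rw [detD, det_fin_two]
    exact sub_mem (mul_mem (h _ _) (h _ _)) (mul_mem (h _ _) (h _ _))
  obtain ⟨a, ha⟩ := hint p hp
  obtain ⟨b, hb⟩ := hint p⁻¹ (inv_mem hp)
  have h1 : p.detD * p⁻¹.detD = 1 := by
    rw [← detD_mul hp', mul_inv_cancel]
    change ((1 : symplecticGroup (Fin 2) ℝ).1.toBlocks₂₂).det = 1
    simp [← fromBlocks_one]
  refine ⟨hp', ?_, (mem_jacobiModularGroup_iff.1 hp).2.2.2⟩
  rw [← ha, ← hb] at h1
  rw [← ha]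
  simp only [eq_intCast] at h1 ⊢
  have h2 : a * b = 1 := by exact_mod_cast h1
  rcases Int.isUnit_iff.1 (IsUnit.of_mul_eq_one _ h2) with rfl | rfl <;> norm_num

theorem up_central_mul_garrettElement (κ : ℝ) :
    garrettElement 1 * (central κ).up = (central κ).up * garrettElement 1 := by
  have hg : (central κ).up.g = 1 := congrArg g (up_one (R := ℝ))
  refine JacobiGroup.ext ?_ ?_ ?_ ?_
  · rw [mul_g, mul_g, hg, mul_one, one_mul]
  · funext i; fin_cases i <;> simp [mul_lam_apply, central, up, garrettElement, ofSymplectic]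
  · funext i; fin_cases i <;> simp [mul_mu_apply, central, up, garrettElement, ofSymplectic]
  · simp [mul_kappa_apply, mul_lam_apply, mul_mu_apply, central, up, garrettElement, ofSymplectic]

theorem up_central_mem_siegelJacobi (κ : ℝ) : (central κ).up ∈ siegelJacobi 2 := by
  have hg : (central κ).up.g = 1 := congrArg g (up_one (R := ℝ))
  refine ⟨?_, ?_⟩
  · funext i; fin_cases i <;> rfl
  · rw [hg]
    exact toBlocks₂₁_one 2

theorem diagElement_one : diagElement 1 = 1 := by
  apply ext₁ <;> simp [diagElement, ea, eb, ec, ed] <;> rfl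

theorem mem_heckeDoubleCoset_one {γ : JacobiGroup 1 ℝ} (hγ : γ ∈ jacobiModularGroup 1) :
    γ ∈ heckeDoubleCoset 1 :=
  mem_heckeDoubleCoset_iff.2 ⟨γ, hγ, 1, one_mem _, by rw [diagElement_one, mul_one, mul_one]⟩

theorem central_g (κ : ℝ) (ξ : JacobiGroup 1 ℝ) : (central κ * ξ).g = ξ.g := one_mul _

section Reindex

variable {RE : Set (JacobiGroup 2 ℝ)} {RP : Set (JacobiGroup 1 ℝ)}
  {RX : ℕ+ → Set (JacobiGroup 1 ℝ)}

/-- The product `γ η` of representatives of `Z(Γ^J) \ Γ^J` and `Γ^J \ 𝕏(d)`. -/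
def repProd (i : Σ d : ℕ+, RX d × RP) : JacobiGroup 1 ℝ := i.2.2 * i.2.1

theorem repProd_mem
    (hRP : IsCosetReps (centerJacobiModularGroup : Set (JacobiGroup 1 ℝ))
      (jacobiModularGroup 1 : Set (JacobiGroup 1 ℝ)) RP)
    (hRX : ∀ d : ℕ+, IsCosetReps (jacobiModularGroup 1 : Set (JacobiGroup 1 ℝ))
      (heckeDoubleCoset d) (RX d))
    (i : Σ d : ℕ+, RX d × RP) : repProd i ∈ heckeDoubleCoset i.1 :=
  mul_mem_heckeDoubleCoset (hRP.1 i.2.2.2) ((hRX i.1).1 i.2.1.2)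

/-- The symplectic part determines d, which makes κ integral. The two elements η then lie in one
Γ^J-coset and agree; cancelling η leaves two γ that differ by the center. -/
theorem eq_of_repProd_eq
    (hRP : IsCosetReps (centerJacobiModularGroup : Set (JacobiGroup 1 ℝ))
      (jacobiModularGroup 1 : Set (JacobiGroup 1 ℝ)) RP)
    (hRX : ∀ d : ℕ+, IsCosetReps (jacobiModularGroup 1 : Set (JacobiGroup 1 ℝ))
      (heckeDoubleCoset d) (RX d))
    {i i' : Σ d : ℕ+, RX d × RP} {κ : ℝ}
    (h : repProd i = central κ * repProd i') : i = i' := by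
  have hi := repProd_mem hRP hRX i
  have hi' := repProd_mem hRP hRX i'
  have hd : i.1 = i'.1 := eq_of_mem_heckeDoubleCoset hi hi' (by rw [h, central_g])
  obtain ⟨d, ⟨η, hη⟩, ⟨γ, hγ⟩⟩ := i
  obtain ⟨d', ⟨η', hη'⟩, ⟨γ', hγ'⟩⟩ := i'
  obtain rfl : d = d' := hd
  have hκ := mem_realIntegers_of_central hi hi' h
  change γ * η = central κ * (γ' * η') at h
  have h1 : η = γ⁻¹ * (central κ * γ') * η' := by
    rw [mul_assoc, mul_assoc, ← h, inv_mul_cancel_left]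
  obtain rfl : η = η' := (hRX d).eq_of_eq_mul (one_mem _) hη hη'
    (mul_mem (inv_mem (hRP.1 hγ)) (mul_mem (central_mem_iff.2 hκ) (hRP.1 hγ'))) h1
  have h2 : γ = central κ * γ' := mul_right_cancel (h.trans (mul_assoc _ _ _).symm)
  obtain rfl : γ = γ' := hRP.eq_of_eq_mul (one_mem _) hγ hγ'
    (mem_centerJacobiModularGroup_iff.2 ⟨κ, hκ, rfl⟩) h2
  rfl

theorem exists_eq_central_mul_repProd
    (hRP : IsCosetReps (centerJacobiModularGroup : Set (JacobiGroup 1 ℝ))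
      (jacobiModularGroup 1 : Set (JacobiGroup 1 ℝ)) RP)
    (hRX : ∀ d : ℕ+, IsCosetReps (jacobiModularGroup 1 : Set (JacobiGroup 1 ℝ))
      (heckeDoubleCoset d) (RX d))
    {d : ℕ+} {ξ : JacobiGroup 1 ℝ}
    (hξ : ξ ∈ heckeDoubleCoset d) :
    ∃ i : Σ d : ℕ+, RX d × RP, ∃ κ, ξ = central κ * repProd i := by
  obtain ⟨η, ⟨hη, g, hg, rfl⟩, -⟩ := (hRX d).2 ξ hξ
  obtain ⟨γ, ⟨hγ, ζ, hζ, rfl⟩, -⟩ := hRP.2 g hg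
  obtain ⟨κ, -, rfl⟩ := mem_centerJacobiModularGroup_iff.1 hζ
  exact ⟨⟨d, ⟨η, hη⟩, ⟨γ, hγ⟩⟩, κ, mul_assoc _ _ _⟩

/-- The cosets in the cell are indexed by the products `γ η`. -/
theorem exists_equiv_cosetReps (hRE : IsCosetReps (jacobiParabolic 2) garrettCell RE)
    (hRP : IsCosetReps (centerJacobiModularGroup : Set (JacobiGroup 1 ℝ))
      (jacobiModularGroup 1 : Set (JacobiGroup 1 ℝ)) RP)
    (hRX : ∀ d : ℕ+, IsCosetReps (jacobiModularGroup 1 : Set (JacobiGroup 1 ℝ))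
      (heckeDoubleCoset d) (RX d)) :
    ∃ e : (Σ d : ℕ+, RX d × RP) ≃ RE, ∀ i, ∃ p,
    IsParabolicOfNorm (i.1 : ℕ) p ∧
      (e i : JacobiGroup 2 ℝ) = p * (garrettElement 1 * (repProd i).up) := by
  have one_mem' : (1 : JacobiGroup 2 ℝ) ∈ jacobiParabolic 2 :=
    mem_jacobiParabolic_iff.2 ⟨one_mem _, one_mem _⟩
  have h : ∀ i : Σ d : ℕ+, RX d × RP, ∃ r : RE, ∃ p, IsParabolicOfNorm (i.1 : ℕ) p ∧
      (r : JacobiGroup 2 ℝ) = p * (garrettElement 1 * (repProd i).up) := by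
    intro i
    obtain ⟨q, hq, hcell⟩ := exists_mul_mem_garrettCell (repProd_mem hRP hRX i)
    obtain ⟨r, ⟨hr, h, hh, e⟩, -⟩ := hRE.2 _ hcell
    obtain ⟨h1, h2⟩ := mem_jacobiParabolic_iff.1 hh
    have := (isParabolicOfNorm_one_of_mem (inv_mem h1) (inv_mem h2)).mul hq
    rw [one_mul] at this
    exact ⟨⟨r, hr⟩, _, this, by rw [mul_assoc, e, inv_mul_cancel_left]⟩
  choose f p hp hf using h
  have hbij : Function.Bijective f := by
    constructor
    · intro i i' hii
      have e : garrettElement 1 * (repProd i).up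
          = ((p i)⁻¹ * p i') * (garrettElement 1 * (repProd i').up) := by
        rw [mul_assoc, ← hf, ← hii, hf, inv_mul_cancel_left]
      obtain ⟨κ, hκ⟩ := eq_central_mul_of_eq_mul (mul_mem (inv_mem (hp i).1) (hp i').1) e
      exact eq_of_repProd_eq hRP hRX hκ
    · intro r
      obtain ⟨d, ξ, hξ, q, hq, e⟩ := exists_eq_mul_of_mem_garrettCell (hRE.1 r.2)
      obtain ⟨i, κ, rfl⟩ := exists_eq_central_mul_repProd hRP hRX hξ
      refine ⟨i, Subtype.ext (Eq.symm ?_)⟩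
      have e' : (r : JacobiGroup 2 ℝ) = (q * (central κ).up * (p i)⁻¹) * f i := by
        rw [e, hf, up_mul, ← mul_assoc (garrettElement 1), up_central_mul_garrettElement]
        group
      refine hRE.eq_of_eq_mul one_mem' r.2 (f i).2 (mem_jacobiParabolic_iff.2 ⟨?_,
        mul_mem (mul_mem hq.1 (up_central_mem_siegelJacobi κ)) (inv_mem (hp i).1)⟩) e'
      -- The individual factors need not be integral; their product is, being the quotient of two
      -- elements of Γ_2^J.
      rw [eq_mul_inv_of_mul_eq e'.symm]
      exact mul_mem (hRE.1 r.2).1 (inv_mem (hRE.1 (f i).2).1)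
  exact ⟨Equiv.ofBijective f hbij, fun i => ⟨p i, hp i, hf i⟩⟩

end Reindex

end JacobiGroup

end

/-! ### The identity of series -/

theorem mainTheorem4 (k m : ℕ) (hk : 4 < k) (hk2 : Even k) (hm : 1 ≤ m)
    (RE : Set (JacobiGroup 2 ℝ))
    (hRE : IsCosetReps (jacobiParabolic 2) garrettCell RE)
    (RP : Set (JacobiGroup 1 ℝ))
    (hRP : IsCosetReps (centerJacobiModularGroup : Set (JacobiGroup 1 ℝ))
      (jacobiModularGroup 1 : Set (JacobiGroup 1 ℝ)) RP)
    (RX : ℕ+ → Set (JacobiGroup 1 ℝ))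
    (hRX : ∀ d : ℕ+, IsCosetReps (jacobiModularGroup 1 : Set (JacobiGroup 1 ℝ))
      (heckeDoubleCoset d) (RX d)) :
    (∀ d : ℕ+, (RX d).Finite) ∧
    ∀ x ∈ jacobiHalfSpace 2,
      Summable (fun γ : RE => ((γ : JacobiGroup 2 ℝ).automorphyFactor k m x)⁻¹) ∧
      Summable (fun γ : RP =>
        (γ : JacobiGroup 1 ℝ).up.slash k m (fun y => (psi k m y)⁻¹) x) ∧
      HasSum (fun d : ℕ+ => heckeUp k m (RX d) (jacobiPoincare k m RP) x * ((d : ℂ) ^ k)⁻¹)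
        (jacobiEisensteinSum k m RE x) := by
  refine ⟨fun d => JacobiGroup.finite_cosetReps_heckeDoubleCoset (hRX d), fun x hx => ?_⟩
  have hsum := summable_slash_psi_inv (fun i : Σ d : ℕ+, RX d × RP => i.1) JacobiGroup.repProd
    (JacobiGroup.repProd_mem hRP hRX) (fun i i' _ hg hl hμ => by
      obtain ⟨κ, hκ⟩ := JacobiGroup.eq_central_mul_of_row_eq hg hl hμ
      exact JacobiGroup.eq_of_repProd_eq hRP hRX hκ) hk hk2 hm hx
  -- The Poincaré series is covered by the same estimate with d = 1, as Γ^J ⊂ 𝕏(1).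
  have hsumP := summable_slash_psi_inv (fun _ : RP => 1) (fun γ : RP => (γ : JacobiGroup 1 ℝ))
    (fun γ => JacobiGroup.mem_heckeDoubleCoset_one (hRP.1 γ.2)) (fun γ γ' _ hg hl hμ => by
      obtain ⟨κ, hκ⟩ := JacobiGroup.eq_central_mul_of_row_eq hg hl hμ
      have hz := JacobiGroup.mem_realIntegers_of_central (JacobiGroup.mem_heckeDoubleCoset_one (hRP.1 γ.2))
        (JacobiGroup.mem_heckeDoubleCoset_one (hRP.1 γ'.2)) hκ
      exact Subtype.ext (hRP.eq_of_eq_mul (one_mem _) γ.2 γ'.2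
        (JacobiGroup.mem_centerJacobiModularGroup_iff.2 ⟨κ, hz, rfl⟩) hκ)) hk hk2 hm hx
  obtain ⟨e, he⟩ := JacobiGroup.exists_equiv_cosetReps hRE hRP hRX
  have hterm : ∀ i, ((e i : JacobiGroup 2 ℝ).automorphyFactor k m x)⁻¹
      = ((i.1 : ℂ) ^ k)⁻¹ * (JacobiGroup.repProd i).up.slash k m (fun y => (psi k m y)⁻¹) x := by
    intro i
    obtain ⟨p, hp, h⟩ := he i
    rw [h, hp.automorphyFactor_mul hk2 m _ hx, _root_.mul_inv, JacobiGroup.slash_psi_inv k m _ hx]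
    rw [Complex.ofReal_natCast]
  have hE : Summable (fun γ : RE => ((γ : JacobiGroup 2 ℝ).automorphyFactor k m x)⁻¹) := by
    rw [← e.summable_iff]
    exact hsum.congr fun i => (hterm i).symm
  refine ⟨hE, by simpa using hsumP, ?_⟩
  have hs : HasSum (fun i : Σ d : ℕ+, RX d × RP =>
      ((i.1 : ℂ) ^ k)⁻¹ * (JacobiGroup.repProd i).up.slash k m (fun y => (psi k m y)⁻¹) x)
      (jacobiEisensteinSum k m RE x) :=
    ((e.hasSum_iff.2 hE.hasSum)).congr_fun fun i => (hterm i).symm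
  -- Absolute convergence allows summing first over pairs (η, γ) for fixed d; the inner double sum
  -- is d^{-k} (P | 𝕏(d)^↑) because (ψ⁻¹ | γ^↑) | η^↑ = ψ⁻¹ | (γη)^↑.
  refine hs.sigma fun d => ?_
  have hd := hs.summable.sigma_factor d
  suffices h : heckeUp k m (RX d) (jacobiPoincare k m RP) x * ((d : ℂ) ^ k)⁻¹ = _ from
    h ▸ hd.hasSum
  rw [hd.tsum_prod, heckeUp, ← tsum_mul_right]
  refine tsum_congr fun η => ?_
  rw [JacobiGroup.slash, jacobiPoincare, mul_comm, ← tsum_mul_left, ← tsum_mul_left]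
  refine tsum_congr fun γ => ?_
  change _ = ((d : ℂ) ^ k)⁻¹ * JacobiGroup.slash k m _ (γ * η : JacobiGroup 1 ℝ).up x
  rw [JacobiGroup.up_mul, JacobiGroup.slash_mul _ _ _ _ _ hx]
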